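/- Let $X$ be a finite connected quantum graph: $X$ is obtained from finitely many (at least one) compact intervals $[0,\ell_e]$, $0<\ell_e<\infty$, the edges $e\in\mathcal E$, by gluing their end points to the points of a finite set $\mathcal V$ of vertices (loops and multiple edges are allowed), and $X$ is connected. Give $X$ the quotient topology and the measure $dx$ that is Lebesgue measure on each edge. Let $H_0f=-\frac{d^2f}{dx^2}$ in $L^2(X,dx)$ with Kirchhoff boundary conditions: its domain is the set of all $f$ that are continuous on $X$, lie in $W^{2,2}(e)$ for every edge $e$, and are such that at every vertex the sum of the outgoing derivatives of $f$ along the incident edge ends vanishes. Let $e^{-H_0t}$, $t\ge 0$, be the strongly continuous semigroup on $L^2(X,dx)$ generated by $-H_0$. Then there is a real-valued function $K_0(t,x,y)$, continuous on $(0,\infty)\times X\times X$, that is an integral kernel of $e^{-H_0t}$ for every $t>0$ (the heat kernel), and every such $K_0$ satisfies \[ \lim_{t\to 0+}t^{d/2}K_0(t,x,x)=a\qquad\text{for all }x\in X\setminus N, \] with $d=1$, $a=(4\pi)^{-1/2}>0$ and $N=\mathcal V$ the set of all vertices, which has zero measure. -/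

import Mathlib

open MeasureTheory Filter Topology Set

/-- Combinatorial and metric data of a quantum graph with vertex set `V` and edge set `E`: the edge
`e` is a copy of the interval `[0, length e]`, running from the vertex `src e` to the vertex
`tgt e`. Loops and multiple edges are allowed. -/
structure MetricGraph (V E : Type*) where
  src : E → V
  tgt : E → V
  length : E → ℝ
  length_pos : ∀ e, 0 < length e

namespace MetricGraph

/-- Any two vertices are joined by a finite chain of edges (traversed in either direction). -/
def Connected {V E : Type*} (G : MetricGraph V E) : Prop :=
  ∀ v w : V, Relation.EqvGen (fun v w => ∃ e, G.src e = v ∧ G.tgt e = w) v w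

/-- The points of the quantum graph: the vertices, and the points in the interiors of the edges. -/
inductive Point {V E : Type*} (G : MetricGraph V E) where
  | vertex (v : V) : Point G
  | interior (e : E) (s : Ioo (0 : ℝ) (G.length e)) : Point G

/-- The set of all vertices, as a set of points of the quantum graph. -/
def vertexSet {V E : Type*} (G : MetricGraph V E) : Set G.Point :=
  Set.range Point.vertex

open Classical in
/-- The parametrization of the closed edge `e` by `s ∈ [0, length e]`
(extended by constants to the real line). -/
noncomputable def edgePoint {V E : Type*} (G : MetricGraph V E) (e : E) (s : ℝ) : G.Point :=
  if h : s ∈ Ioo (0 : ℝ) (G.length e) then Point.interior e ⟨s, h⟩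
  else if s ≤ 0 then Point.vertex (G.src e) else Point.vertex (G.tgt e)

/-- The quotient topology: the disjoint union of the closed edges, glued at the vertices. -/
noncomputable instance instTopologicalSpacePoint {V E : Type*} (G : MetricGraph V E) :
    TopologicalSpace G.Point :=
  TopologicalSpace.coinduced
    (fun p : (Σ e : E, Icc (0 : ℝ) (G.length e)) => G.edgePoint p.1 (p.2 : ℝ)) inferInstance

noncomputable instance instMeasurableSpacePoint {V E : Type*} (G : MetricGraph V E) :
    MeasurableSpace G.Point :=
  borel G.Point

instance instBorelSpacePoint {V E : Type*} (G : MetricGraph V E) : BorelSpace G.Point :=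
  ⟨rfl⟩

/-- The measure `dx` on the quantum graph: Lebesgue measure on each edge. -/
noncomputable def measure {V E : Type*} [Fintype E] (G : MetricGraph V E) : Measure G.Point :=
  ∑ e : E, (volume.restrict (Icc (0 : ℝ) (G.length e))).map (G.edgePoint e)

/-- The Hilbert space `L²(X, dx)`. -/
noncomputable abbrev L2 {V E : Type*} [Fintype E] (G : MetricGraph V E) :=
  Lp ℂ 2 G.measure

open Classical in
/-- The graph of the operator `H₀ = -d²/dx²` with Kirchhoff boundary conditions:
`G.KirchhoffLaplacian f g` says that `f ∈ Dom(H₀)` and `H₀ f = g`. That is, `f` has a continuous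
version `u` on the quantum graph; on each edge `e`, `u` is differentiable (up to the end points)
with derivative `p e`, and `p e` is absolutely continuous with derivative `-g`, an `L²` function
(so `u` is in `W^{2,2}` of the edge); at each vertex the sum of the outgoing derivatives of `u`
vanishes, a loop contributing both of its ends. -/
def KirchhoffLaplacian {V E : Type*} [Fintype E] (G : MetricGraph V E) (f g : G.L2) : Prop :=
  ∃ (u : G.Point → ℂ) (p : E → ℝ → ℂ),
    Continuous u ∧ (f : G.Point → ℂ) =ᵐ[G.measure] u ∧
    (∀ e, ∀ s ∈ Icc (0 : ℝ) (G.length e),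
      HasDerivWithinAt (fun r => u (G.edgePoint e r)) (p e s) (Icc (0 : ℝ) (G.length e)) s) ∧
    (∀ e, ∀ s ∈ Icc (0 : ℝ) (G.length e),
      p e s = p e 0 - ∫ r in (0 : ℝ)..s, g (G.edgePoint e r)) ∧
    (∀ v : V, (∑ e : E, ((if G.src e = v then p e 0 else 0)
      + (if G.tgt e = v then -p e (G.length e) else 0))) = 0)

/-- `T t = exp(-H₀ t)` for `t ≥ 0`: `T` is the strongly continuous one-parameter semigroup of
bounded operators on `L²(X, dx)` whose infinitesimal generator is `-H₀`. (The values of `T` at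
negative times play no role.) -/
structure IsHeatSemigroup {V E : Type*} [Fintype E] (G : MetricGraph V E)
    (T : ℝ → G.L2 →L[ℂ] G.L2) : Prop where
  zero : T 0 = ContinuousLinearMap.id ℂ G.L2
  add : ∀ s t : ℝ, 0 ≤ s → 0 ≤ t → T (s + t) = (T s).comp (T t)
  strongly_continuous : ∀ f : G.L2, Tendsto (fun t => T t f) (𝓝[>] 0) (𝓝 f)
  generator : ∀ f g : G.L2, G.KirchhoffLaplacian f g ↔
    Tendsto (fun t : ℝ => ((t⁻¹ : ℝ) : ℂ) • (T t f - f)) (𝓝[>] 0) (𝓝 (-g))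

/-- `K` is the heat kernel: it is continuous on `(0, ∞) × X × X`, and for each `t > 0` it is an
integral kernel of the operator `exp(-H₀ t)`. -/
def IsHeatKernel {V E : Type*} [Fintype E] (G : MetricGraph V E)
    (K : ℝ → G.Point → G.Point → ℝ) : Prop :=
  ContinuousOn (fun q : ℝ × G.Point × G.Point => K q.1 q.2.1 q.2.2) (Ioi 0 ×ˢ univ) ∧
  ∃ T : ℝ → G.L2 →L[ℂ] G.L2, G.IsHeatSemigroup T ∧
    ∀ t : ℝ, 0 < t → ∀ f : G.L2,
      (T t f : G.Point → ℂ) =ᵐ[G.measure] fun x => ∫ y, (K t x y : ℂ) * f y ∂G.measure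

end MetricGraph

/-- On-diagonal small time asymptotics with dimension `d`, constant `a > 0` and an exceptional set
`N` of zero measure: `t^{d/2} K(t,x,x) → a` as `t → 0+`, for all `x ∉ N`. -/
def HasDiagonalAsymptotics {X : Type*} [MeasurableSpace X] (μ : Measure X)
    (K : ℝ → X → X → ℝ) (d a : ℝ) (N : Set X) : Prop :=
  0 < a ∧ μ N = 0 ∧
    ∀ x, x ∉ N → Tendsto (fun t : ℝ => t ^ (d / 2) * K t x x) (𝓝[>] 0) (𝓝 a)

/-!
Write `H₀` for the Kirchhoff Laplacian, `R = (1 + H₀)⁻¹` for its resolvent and `T t = exp (-t H₀)`.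

**Existence of the heat kernel.** Integration by parts on each edge shows that `H₀` is symmetric and
nonnegative, and that its resolvent equation `u + H₀ u = g` reduces to an ordinary differential
equation on each edge together with one linear condition at each vertex. The linear map describing
the vertex conditions is injective, hence bijective (`MetricGraph.exists_isKirchhoff`), so `R` is a
self-adjoint operator with spectrum in `[0, 1]` (`MetricGraph.isSelfAdjoint_resolvent`,
`MetricGraph.spectrum_resolvent_subset`). The continuous functional calculus of the bounded operator
`R` then replaces the spectral theorem for `H₀`: `T t` is `exp (-t (μ⁻¹ - 1))` evaluated at `R`, and
also `(1 + H₀)² T t` is a bounded operator, depending continuously on `t > 0`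
(`isSemigroupGeneratedBy_heatOp`, `continuousOn_heatOpDiv`). As `R g` is continuous and
`g ↦ (R g) x` is bounded on `L²`, there are Green functions `k x ∈ L²` with `⟨k x, g⟩ = (R g) x`,
which depend continuously on `x`. Hence `K t x y = ⟨k y, (1 + H₀)² T t (k x)⟩` is jointly
continuous, and `T t = R ((1 + H₀)² T t) R` shows that it is an integral kernel of `T t`. It is
real because all operators commute with complex conjugation
(`MetricGraph.isHeatKernel_heatKernel`).

**Uniqueness.** Since `H₀` is accretive, a semigroup generated by `-H₀` is unique
(`IsSemigroupGeneratedBy.unique`); two continuous kernels of the same operator agree at interior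
points of the edges, as nonempty open sets around such points have positive measure
(`MetricGraph.IsHeatKernel.diag_eq`). It is therefore enough to study the kernel built above.

**Asymptotics.** The semigroup law gives `K (2 t) x x = ‖K t x ·‖²`, so that it is enough to know
`K t x ·` in `L²`, up to a small error. For `x` in the interior of an edge, let `q t` be the
Gaussian kernel with centre `x`, times a cut-off function supported in that edge and equal to `1`
near `x`. Then `q t` is in the domain of `H₀`, and `q' + H₀ q` is bounded in `L²` as `t → 0`, for
it is supported away from `x`, where the Gaussian is small (`MetricGraph.exists_norm_error_le`).
Since `R (q t)` tends to `k x` as `t → 0`, Duhamel's principle yields `‖K t x · - q t‖ ≤ C t`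
(`MetricGraph.exists_norm_heatSection_sub_le`), while `√t ‖q t‖²` tends to `(8 π)^{-1/2}`, as the
square of a Gaussian is a multiple of a Gaussian. Hence `√t K (2 t) x x` tends to `(8 π)^{-1/2}`.
-/

/-! ### The semigroup generated by `1 - R⁻¹` -/

/-- The function `μ ↦ exp (-t (μ⁻¹ - 1))`, extended by `0` to `μ ≤ 0`. Applied to the resolvent
`(1 + A)⁻¹` it gives `exp (-t A)`. Meaningful for `0 < t`. The smooth function `expNegInvGlue`,
which is `exp (-1 / x)` for `0 < x` and vanishes for `x ≤ 0`, provides the continuous extension. -/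
noncomputable def heatSymbol (t μ : ℝ) : ℝ := Real.exp t * expNegInvGlue (μ / t)

/-- The function `μ ↦ μ⁻² exp (-t (μ⁻¹ - 1))`, extended by `0` to `μ ≤ 0`. Applied to the resolvent
`(1 + A)⁻¹` it gives `(1 + A)² exp (-t A)`. Meaningful for `0 < t`. -/
noncomputable def heatSymbolDiv (t μ : ℝ) : ℝ :=
  Real.exp t * (t⁻¹ ^ 2 * ((μ / t)⁻¹ ^ 2 * expNegInvGlue (μ / t)))

lemma heatSymbol_of_pos {t μ : ℝ} (ht : 0 < t) (hμ : 0 < μ) :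
    heatSymbol t μ = Real.exp (-(t * (μ⁻¹ - 1))) := by
  have : ¬ μ / t ≤ 0 := not_le.2 (div_pos hμ ht)
  rw [heatSymbol, expNegInvGlue, if_neg this, ← Real.exp_add]
  congr 1
  field_simp
  ring

lemma heatSymbol_zero (t : ℝ) : heatSymbol t 0 = 0 := by
  simp [heatSymbol]

lemma heatSymbol_eq_mul {t : ℝ} (ht : 0 < t) (μ : ℝ) :
    heatSymbol t μ = heatSymbolDiv t μ * μ ^ 2 := by
  rcases eq_or_ne μ 0 with rfl | hμ
  · simp [heatSymbol]
  · rw [heatSymbol, heatSymbolDiv]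
    field_simp

lemma heatSymbolDiv_two_mul {t : ℝ} (ht : 0 < t) {μ : ℝ} (hμ : 0 ≤ μ) :
    heatSymbolDiv (2 * t) μ = heatSymbolDiv t μ * heatSymbol t μ := by
  rcases hμ.eq_or_lt with rfl | hμ
  · simp [heatSymbol, heatSymbolDiv]
  · have h2 : (0:ℝ) < 2 * t := by positivity
    have e1 := heatSymbol_eq_mul h2 μ
    have e2 := heatSymbol_eq_mul ht μ
    have e3 : heatSymbol (2 * t) μ = heatSymbol t μ * heatSymbol t μ := by
      rw [heatSymbol_of_pos h2 hμ, heatSymbol_of_pos ht hμ, ← Real.exp_add]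
      congr 1; ring
    have hμ2 : μ ^ 2 ≠ 0 := by positivity
    apply mul_right_cancel₀ hμ2
    rw [← e1, e3, mul_right_comm, ← e2]

lemma continuous_inv_sq_mul_expNegInvGlue : Continuous fun x : ℝ => x⁻¹ ^ 2 * expNegInvGlue x := by
  have h := expNegInvGlue.continuous_polynomial_eval_inv_mul (Polynomial.X ^ 2)
  simp only [Polynomial.eval_pow, Polynomial.eval_X] at h
  exact h

lemma continuous_heatSymbol (t : ℝ) : Continuous (heatSymbol t) := by
  have := (expNegInvGlue.contDiff (n := 0)).continuous
  unfold heatSymbol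
  fun_prop

lemma continuousOn_heatSymbolDiv :
    ContinuousOn (fun q : ℝ × ℝ => heatSymbolDiv q.1 q.2) (Ioi 0 ×ˢ univ) := by
  have h := continuous_inv_sq_mul_expNegInvGlue
  have h1 : ContinuousOn (fun q : ℝ × ℝ => q.1⁻¹) (Ioi 0 ×ˢ univ) :=
    continuousOn_fst.inv₀ fun q hq => (ne_of_gt hq.1)
  have h2 : ContinuousOn (fun q : ℝ × ℝ => q.2 / q.1) (Ioi 0 ×ˢ univ) :=
    continuousOn_snd.mul h1
  have h3 := h.comp_continuousOn h2
  unfold heatSymbolDiv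
  exact (Real.continuous_exp.comp_continuousOn continuousOn_fst).mul ((h1.pow 2).mul h3)

lemma continuous_heatSymbolDiv (t : ℝ) : Continuous (heatSymbolDiv t) := by
  have h := continuous_inv_sq_mul_expNegInvGlue
  unfold heatSymbolDiv
  exact continuous_const.mul (continuous_const.mul (h.comp (by fun_prop)))

lemma heatSymbol_add {s t : ℝ} (hs : 0 < s) (ht : 0 < t) {μ : ℝ} (hμ : 0 ≤ μ) :
    heatSymbol (s + t) μ = heatSymbol s μ * heatSymbol t μ := by
  rcases hμ.eq_or_lt with rfl | hμ
  · simp [heatSymbol_zero]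
  · rw [heatSymbol_of_pos (add_pos hs ht) hμ, heatSymbol_of_pos hs hμ, heatSymbol_of_pos ht hμ,
      ← Real.exp_add]
    congr 1; ring

lemma heatSymbol_nonneg (t μ : ℝ) : 0 ≤ heatSymbol t μ :=
  mul_nonneg (Real.exp_pos _).le (expNegInvGlue.nonneg _)

lemma heatSymbol_le_one {t : ℝ} (ht : 0 < t) {μ : ℝ} (hμ : μ ∈ Icc (0:ℝ) 1) :
    heatSymbol t μ ≤ 1 := by
  rcases hμ.1.eq_or_lt with rfl | h
  · simp [heatSymbol_zero]
  · rw [heatSymbol_of_pos ht h, Real.exp_le_one_iff]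
    have := (one_le_inv₀ h).2 hμ.2
    nlinarith

lemma abs_heatSymbol_mul_sub_le {t : ℝ} (ht : 0 < t) {μ : ℝ} (hμ : μ ∈ Icc (0:ℝ) 1) :
    |heatSymbol t μ * μ - μ| ≤ t := by
  rcases hμ.1.eq_or_lt with rfl | h
  · simpa using ht.le
  · have h1 := heatSymbol_le_one ht hμ
    have h2 : 1 - t * (μ⁻¹ - 1) ≤ heatSymbol t μ := by
      rw [heatSymbol_of_pos ht h]
      have := Real.add_one_le_exp (-(t * (μ⁻¹ - 1)))
      linarith
    have h3 : μ⁻¹ * μ = 1 := inv_mul_cancel₀ h.ne'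
    have h4 := hμ.2
    rw [abs_le]
    constructor <;> nlinarith

lemma abs_exp_neg_sub_le {x : ℝ} (hx : 0 ≤ x) : |Real.exp (-x) - 1 + x| ≤ x ^ 2 := by
  have h0 : 0 ≤ Real.exp (-x) - 1 + x := by
    have := Real.add_one_le_exp (-x); linarith
  rcases le_total x 1 with h | h
  · have := Real.abs_exp_sub_one_sub_id_le (x := -x) (by rwa [abs_neg, abs_of_nonneg hx])
    simpa using this
  · rw [abs_of_nonneg h0]
    have : Real.exp (-x) ≤ 1 := by simpa using hx
    nlinarith

lemma abs_heatSymbol_mul_sq_sub_le {t : ℝ} (ht : 0 < t) {μ : ℝ} (hμ : μ ∈ Icc (0:ℝ) 1) :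
    |heatSymbol t μ * μ ^ 2 - μ ^ 2 + t * ((1 - μ) * μ)| ≤ t ^ 2 := by
  rcases hμ.1.eq_or_lt with rfl | h
  · simpa using sq_nonneg t
  · have h1 : 0 ≤ μ⁻¹ - 1 := by have := (one_le_inv₀ h).2 hμ.2; linarith
    have e : heatSymbol t μ * μ ^ 2 - μ ^ 2 + t * ((1 - μ) * μ)
        = (Real.exp (-(t * (μ⁻¹ - 1))) - 1 + t * (μ⁻¹ - 1)) * μ ^ 2 := by
      rw [heatSymbol_of_pos ht h]; field_simp
    rw [e, abs_mul, abs_of_nonneg (sq_nonneg μ)]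
    have h2 := abs_exp_neg_sub_le (mul_nonneg ht.le h1)
    have e2 : (t * (μ⁻¹ - 1)) ^ 2 * μ ^ 2 = t ^ 2 * (1 - μ) ^ 2 := by field_simp
    have h3 : (1 - μ) ^ 2 ≤ 1 := by nlinarith [hμ.2]
    calc _ ≤ (t * (μ⁻¹ - 1)) ^ 2 * μ ^ 2 := by gcongr
      _ ≤ t ^ 2 := by rw [e2]; nlinarith [sq_nonneg t]

section HeatOp

variable {H : Type*} [NormedAddCommGroup H] [InnerProductSpace ℂ H] [CompleteSpace H]

/-- The operator `exp (-t A)` expressed through the resolvent `R = (1 + A)⁻¹`; the identity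
for `t ≤ 0`. -/
noncomputable def heatOp (R : H →L[ℂ] H) (t : ℝ) : H →L[ℂ] H :=
  if 0 < t then cfc (heatSymbol t) R else 1

/-- The bounded operator `(1 + A)² exp (-t A)`, for `0 < t`, in terms of the resolvent
`R = (1 + A)⁻¹`. -/
noncomputable def heatOpDiv (R : H →L[ℂ] H) (t : ℝ) : H →L[ℂ] H := cfc (heatSymbolDiv t) R

variable {R : H →L[ℂ] H}

lemma heatOp_of_pos {t : ℝ} (ht : 0 < t) : heatOp R t = cfc (heatSymbol t) R := if_pos ht

lemma heatOp_zero : heatOp R 0 = 1 := if_neg (lt_irrefl 0)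

lemma isSelfAdjoint_heatOpDiv (t : ℝ) : IsSelfAdjoint (heatOpDiv R t) := cfc_predicate _ _

lemma heatOp_eq (hR : IsSelfAdjoint R) {t : ℝ} (ht : 0 < t) :
    heatOp R t = heatOpDiv R t * R ^ 2 := by
  rw [heatOp_of_pos ht, heatOpDiv, ← cfc_pow_id (R := ℝ) R 2,
    ← cfc_mul _ _ R (continuous_heatSymbolDiv t).continuousOn (by fun_prop)]
  exact cfc_congr fun μ _ => heatSymbol_eq_mul ht μ

lemma commute_heatOpDiv (hR : IsSelfAdjoint R) (t : ℝ) : Commute (heatOpDiv R t) R := by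
  have := cfc_commute_cfc (heatSymbolDiv t) (fun x : ℝ => x) R
  rwa [cfc_id' ℝ R] at this

lemma heatOp_eq' (hR : IsSelfAdjoint R) {t : ℝ} (ht : 0 < t) :
    heatOp R t = R * heatOpDiv R t * R := by
  rw [heatOp_eq hR ht, pow_two, ← mul_assoc, (commute_heatOpDiv hR t).eq]

lemma commute_heatOp (hR : IsSelfAdjoint R) (t : ℝ) : Commute (heatOp R t) R := by
  unfold heatOp
  split_ifs
  · have := cfc_commute_cfc (heatSymbol t) (fun x : ℝ => x) R
    rwa [cfc_id' ℝ R] at this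
  · exact Commute.one_left _

lemma heatOp_add (hspec : spectrum ℝ R ⊆ Icc 0 1) {s t : ℝ} (hs : 0 ≤ s) (ht : 0 ≤ t) :
    heatOp R (s + t) = heatOp R s * heatOp R t := by
  rcases hs.eq_or_lt with rfl | hs
  · simp [heatOp_zero]
  rcases ht.eq_or_lt with rfl | ht
  · simp [heatOp_zero]
  rw [heatOp_of_pos hs, heatOp_of_pos ht, heatOp_of_pos (add_pos hs ht),
    ← cfc_mul _ _ R (continuous_heatSymbol s).continuousOn (continuous_heatSymbol t).continuousOn]
  exact cfc_congr fun μ hμ => heatSymbol_add hs ht (hspec hμ).1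

/-- The semigroup law, in the form that expresses the diagonal of the heat kernel as a norm. -/
lemma heatOpDiv_two_mul (hR : IsSelfAdjoint R) (hspec : spectrum ℝ R ⊆ Icc 0 1) {t : ℝ}
    (ht : 0 < t) : heatOpDiv R (2 * t) = heatOpDiv R t * R * (R * heatOpDiv R t) := by
  have : heatOpDiv R (2 * t) = heatOpDiv R t * heatOp R t := by
    rw [heatOp_of_pos ht, heatOpDiv, heatOpDiv, ← cfc_mul _ _ R
      (continuous_heatSymbolDiv t).continuousOn (continuous_heatSymbol t).continuousOn]
    exact cfc_congr fun μ hμ => heatSymbolDiv_two_mul ht (hspec hμ).1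
  rw [this, heatOp_eq hR ht, pow_two, mul_assoc (heatOpDiv R t) R, ← (commute_heatOpDiv hR t).eq,
    ← mul_assoc R, ← (commute_heatOpDiv hR t).eq, mul_assoc]

lemma norm_heatOp_le_one (hspec : spectrum ℝ R ⊆ Icc 0 1) (t : ℝ) : ‖heatOp R t‖ ≤ 1 := by
  unfold heatOp
  split_ifs with ht
  · refine norm_cfc_le zero_le_one fun μ hμ => ?_
    rw [Real.norm_of_nonneg (heatSymbol_nonneg _ _)]
    exact heatSymbol_le_one ht (hspec hμ)
  · exact ContinuousLinearMap.norm_id_le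

/-- Strong continuity at `0` on the range of `R`, with a rate. -/
lemma norm_heatOp_mul_sub_le (hR : IsSelfAdjoint R) (hspec : spectrum ℝ R ⊆ Icc 0 1) {t : ℝ}
    (ht : 0 < t) : ‖heatOp R t * R - R‖ ≤ t := by
  have e : heatOp R t * R - R = cfc (fun μ => heatSymbol t μ * μ - μ) R := by
    have hc := continuous_heatSymbol t
    rw [cfc_sub _ _ R (by fun_prop) (by fun_prop), cfc_mul _ _ R (by fun_prop) (by fun_prop),
      cfc_id' ℝ R, heatOp_of_pos ht]
  rw [e]
  exact norm_cfc_le ht.le fun μ hμ => abs_heatSymbol_mul_sub_le ht (hspec hμ)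

/-- The derivative at `0` on the range of `R ^ 2`, with a rate: the generator maps `R ^ 2` to
`(1 - R⁻¹) R ^ 2 = -(1 - R) R`. -/
lemma norm_heatOp_mul_sq_sub_le (hR : IsSelfAdjoint R) (hspec : spectrum ℝ R ⊆ Icc 0 1) {t : ℝ}
    (ht : 0 < t) : ‖heatOp R t * R ^ 2 - R ^ 2 + t • ((1 - R) * R)‖ ≤ t ^ 2 := by
  have e : heatOp R t * R ^ 2 - R ^ 2 + t • ((1 - R) * R)
      = cfc (fun μ => heatSymbol t μ * μ ^ 2 - μ ^ 2 + t * ((1 - μ) * μ)) R := by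
    have hc := continuous_heatSymbol t
    rw [cfc_add R _ _ (by fun_prop) (by fun_prop), cfc_sub _ _ R (by fun_prop) (by fun_prop),
      cfc_mul _ _ R (by fun_prop) (by fun_prop), cfc_pow_id (R := ℝ) R 2,
      cfc_const_mul t _ R (by fun_prop), cfc_mul _ _ R (by fun_prop) (by fun_prop),
      cfc_sub _ _ R (by fun_prop) (by fun_prop), cfc_const_one ℝ R, cfc_id' ℝ R, heatOp_of_pos ht]
  rw [e]
  exact norm_cfc_le (sq_nonneg t) fun μ hμ => abs_heatSymbol_mul_sq_sub_le ht (hspec hμ)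

/-- Continuity in the operator norm, as the symbols depend continuously on `t` uniformly on the
compact spectrum of `R`. -/
lemma continuousOn_heatOpDiv (R : H →L[ℂ] H) : ContinuousOn (heatOpDiv R) (Ioi 0) := by
  intro t ht
  refine continuousWithinAt_cfc_fun ?_ (Eventually.of_forall fun s =>
    (continuous_heatSymbolDiv s).continuousOn)
  have hK : IsCompact (spectrum ℝ R) := spectrum.isCompact R
  intro u hu
  obtain ⟨v, hv, h⟩ := hK.mem_uniformity_of_prod (f := heatSymbolDiv)
    (continuousOn_heatSymbolDiv.mono (prod_mono_right (subset_univ (spectrum ℝ R)))) ht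
    (symm_le_uniformity hu)
  filter_upwards [hv] with s hs x hx using h s hs x hx

/-- Strong convergence for a bounded family of operators follows from convergence on the range
of an operator with dense range. -/
lemma tendsto_of_tendsto_comp_denseRange {H : Type*} [NormedAddCommGroup H]
    [InnerProductSpace ℂ H] {R : H →L[ℂ] H} {ι : Type*} {l : Filter ι} {A : ι → H →L[ℂ] H}
    {B : H →L[ℂ] H} {C : ℝ} (hA : ∀ᶠ i in l, ‖A i - B‖ ≤ C) (hd : DenseRange R)
    (h : ∀ f, Tendsto (fun i => A i (R f)) l (𝓝 (B (R f)))) (f : H) :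
    Tendsto (fun i => A i f) l (𝓝 (B f)) := by
  rw [Metric.tendsto_nhds]
  intro ε hε
  have hC : 0 < |C| + 1 := by positivity
  obtain ⟨g, hg⟩ := hd.exists_dist_lt f (show 0 < ε / 2 / (|C| + 1) by positivity)
  filter_upwards [hA, Metric.tendsto_nhds.1 (h g) (ε / 2) (by positivity)] with i h1 h2
  have e : A i f - B f = (A i - B) (f - R g) + (A i (R g) - B (R g)) := by
    simp only [map_sub, sub_apply]
    abel
  rw [dist_eq_norm] at hg h2 ⊢
  rw [e]
  calc _ ≤ ‖(A i - B) (f - R g)‖ + ‖A i (R g) - B (R g)‖ := norm_add_le _ _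
    _ ≤ (|C| + 1) * ‖f - R g‖ + ‖A i (R g) - B (R g)‖ := by
        gcongr
        refine (ContinuousLinearMap.le_opNorm _ _).trans ?_
        gcongr
        linarith [le_abs_self C]
    _ < (|C| + 1) * (ε / 2 / (|C| + 1)) + ε / 2 := by gcongr
    _ = ε := by field_simp; ring

lemma denseRange_of_injective (hR : IsSelfAdjoint R) (hinj : Function.Injective R) :
    DenseRange R := by
  have h1 : (LinearMap.range (R : H →ₗ[ℂ] H)).topologicalClosure = ⊤ := by
    rw [Submodule.topologicalClosure_eq_top_iff]
    have := ContinuousLinearMap.orthogonal_range R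
    rw [hR.adjoint_eq] at this
    rw [this]
    exact LinearMap.ker_eq_bot.2 hinj
  have h2 := (Submodule.dense_iff_topologicalClosure_eq_top).2 h1
  exact h2

lemma tendsto_heatOp (hR : IsSelfAdjoint R) (hspec : spectrum ℝ R ⊆ Icc 0 1)
    (hinj : Function.Injective R) (f : H) :
    Tendsto (fun t => heatOp R t f) (𝓝[>] 0) (𝓝 f) := by
  refine tendsto_of_tendsto_comp_denseRange (R := R) (A := heatOp R) (B := 1) (C := 2)
    (Eventually.of_forall fun t => ?_) (denseRange_of_injective hR hinj) (fun g => ?_) f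
  · refine (norm_sub_le _ _).trans ?_
    have := norm_heatOp_le_one hspec t
    have h2 : ‖(1 : H →L[ℂ] H)‖ ≤ 1 := ContinuousLinearMap.norm_id_le
    linarith
  · rw [tendsto_iff_norm_sub_tendsto_zero]
    have h0 : Tendsto (fun t : ℝ => t * ‖g‖) (𝓝[>] 0) (𝓝 0) := by
      have : Tendsto (fun t : ℝ => t * ‖g‖) (𝓝 0) (𝓝 (0 * ‖g‖)) :=
        tendsto_id.mul_const _
      simpa using this.mono_left nhdsWithin_le_nhds
    refine squeeze_zero' (Eventually.of_forall fun t => norm_nonneg _) ?_ h0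
    filter_upwards [self_mem_nhdsWithin] with t ht
    have := (heatOp R t * R - R).le_of_opNorm_le (norm_heatOp_mul_sub_le hR hspec ht) g
    simpa using this

lemma tendsto_inv_smul_heatOp_resolvent (hR : IsSelfAdjoint R) (hspec : spectrum ℝ R ⊆ Icc 0 1)
    (hinj : Function.Injective R) (f : H) :
    Tendsto (fun t : ℝ => ((t⁻¹ : ℝ) : ℂ) • (heatOp R t (R f) - R f)) (𝓝[>] 0) (𝓝 (R f - f)) := by
  have key := tendsto_of_tendsto_comp_denseRange (R := R) (l := 𝓝[>] (0:ℝ))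
    (A := fun t : ℝ => t⁻¹ • (heatOp R t * R - R)) (B := R - 1) (C := 1 + ‖R - 1‖) ?_
    (denseRange_of_injective hR hinj) ?_ f
  · refine key.congr fun t => ?_
    rw [Complex.coe_smul]
    rfl
  · filter_upwards [self_mem_nhdsWithin] with t ht
    refine (norm_sub_le _ _).trans ?_
    gcongr
    rw [norm_smul, Real.norm_of_nonneg (inv_nonneg.2 (le_of_lt ht)), inv_mul_le_iff₀ ht, mul_one]
    exact norm_heatOp_mul_sub_le hR hspec ht
  · intro g
    rw [tendsto_iff_norm_sub_tendsto_zero]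
    have h0 : Tendsto (fun t : ℝ => t * ‖g‖) (𝓝[>] 0) (𝓝 0) := by
      have : Tendsto (fun t : ℝ => t * ‖g‖) (𝓝 0) (𝓝 (0 * ‖g‖)) :=
        tendsto_id.mul_const _
      simpa using this.mono_left nhdsWithin_le_nhds
    refine squeeze_zero' (Eventually.of_forall fun t => norm_nonneg _) ?_ h0
    filter_upwards [self_mem_nhdsWithin] with t (ht : 0 < t)
    have h1 := (heatOp R t * R ^ 2 - R ^ 2 + t • ((1 - R) * R) : H →L[ℂ] H).le_of_opNorm_le
      (norm_heatOp_mul_sq_sub_le hR hspec ht) g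
    have e : (t⁻¹ • (heatOp R t * R - R)) (R g) - (R - 1) (R g)
        = t⁻¹ • (heatOp R t * R ^ 2 - R ^ 2 + t • ((1 - R) * R) : H →L[ℂ] H) g := by
      simp only [pow_two, smul_apply, sub_apply,
        add_apply, mul_apply_eq_comp, one_apply_eq_self,
        smul_add, smul_smul, inv_mul_cancel₀ ht.ne', one_smul]
      abel
    rw [e, norm_smul, Real.norm_of_nonneg (inv_nonneg.2 ht.le), inv_mul_le_iff₀ ht]
    linarith

/-- The generator of `heatOp R` is `1 - R⁻¹`, with domain the range of `R`. -/
lemma tendsto_inv_smul_heatOp_iff (hR : IsSelfAdjoint R) (hspec : spectrum ℝ R ⊆ Icc 0 1)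
    (hinj : Function.Injective R) (f g : H) :
    Tendsto (fun t : ℝ => ((t⁻¹ : ℝ) : ℂ) • (heatOp R t f - f)) (𝓝[>] 0) (𝓝 (-g))
      ↔ f = R (f + g) := by
  constructor
  · intro h
    have h1 := (R.continuous.tendsto _).comp h
    have h2 := tendsto_inv_smul_heatOp_resolvent hR hspec hinj f
    have h3 : R (-g) = R f - f := by
      refine tendsto_nhds_unique (h1.congr fun t => ?_) h2
      have := congrArg (fun A : H →L[ℂ] H => A f) (commute_heatOp hR t).eq
      simp only [mul_apply_eq_comp] at this
      simp [this]
    rw [map_neg] at h3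
    rw [map_add]
    rw [← sub_eq_iff_eq_add', ← neg_sub (R f) f, ← h3, neg_neg]
  · intro h
    have h2 := tendsto_inv_smul_heatOp_resolvent hR hspec hinj (f + g)
    rw [← h] at h2
    convert h2 using 2
    abel

end HeatOp

/-! ### Strongly continuous semigroups with a prescribed generator -/

section Semigroup

variable {H : Type*} [NormedAddCommGroup H] [InnerProductSpace ℂ H]

/-- `T` restricted to `[0, ∞)` is a strongly continuous semigroup whose generator has the graph
`{(f, -g) | A f g}`. -/
structure IsSemigroupGeneratedBy (A : H → H → Prop) (T : ℝ → H →L[ℂ] H) : Prop where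
  zero : T 0 = ContinuousLinearMap.id ℂ H
  add : ∀ s t : ℝ, 0 ≤ s → 0 ≤ t → T (s + t) = (T s).comp (T t)
  strongly_continuous : ∀ f : H, Tendsto (fun t => T t f) (𝓝[>] 0) (𝓝 f)
  generator : ∀ f g : H, A f g ↔
    Tendsto (fun t : ℝ => ((t⁻¹ : ℝ) : ℂ) • (T t f - f)) (𝓝[>] 0) (𝓝 (-g))

namespace IsSemigroupGeneratedBy

variable {A : H → H → Prop} {T : ℝ → H →L[ℂ] H}

lemma tendsto_nhdsGE (hT : IsSemigroupGeneratedBy A T) (f : H) :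
    Tendsto (fun t => T t f) (𝓝[≥] 0) (𝓝 f) := by
  have h : ContinuousWithinAt (fun t => T t f) (Ioi 0) 0 := by
    simpa [ContinuousWithinAt, hT.zero] using hT.strongly_continuous f
  have := continuousWithinAt_Ioi_iff_Ici.1 h
  simpa [ContinuousWithinAt, hT.zero] using this

/-- By the uniform boundedness principle, a strongly continuous semigroup is bounded near `0`. -/
lemma exists_norm_le_near_zero [CompleteSpace H] (hT : IsSemigroupGeneratedBy A T) :
    ∃ δ > 0, ∃ M, ∀ t ∈ Icc 0 δ, ‖T t‖ ≤ M := by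
  by_contra! hcon
  have hpos : ∀ n : ℕ, (0:ℝ) < 1 / ((n:ℝ) + 1) := fun n => by positivity
  choose t ht hM using fun n : ℕ => hcon (1 / ((n:ℝ) + 1)) (hpos n) n
  have ht0 : Tendsto t atTop (𝓝[≥] 0) := by
    refine tendsto_nhdsWithin_iff.2 ⟨?_, Eventually.of_forall fun n => (ht n).1⟩
    exact squeeze_zero (fun n => (ht n).1) (fun n => (ht n).2)
      tendsto_one_div_add_atTop_nhds_zero_nat
  obtain ⟨C, hC⟩ := banach_steinhaus (g := fun n => T (t n)) fun f => by
    obtain ⟨C, hC⟩ := ((hT.tendsto_nhdsGE f).comp ht0).norm.bddAbove_range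
    exact ⟨C, fun n => hC ⟨n, rfl⟩⟩
  obtain ⟨n, hn⟩ := exists_nat_gt C
  exact absurd (hC n) (not_le.2 (hn.trans (hM n)))

lemma exists_norm_le [CompleteSpace H] (hT : IsSemigroupGeneratedBy A T) (b : ℝ) :
    ∃ M, 0 ≤ M ∧ ∀ t ∈ Icc 0 b, ‖T t‖ ≤ M := by
  obtain ⟨δ, hδ, M, hM⟩ := hT.exists_norm_le_near_zero
  have key : ∀ n : ℕ, ∃ C, 0 ≤ C ∧ ∀ t ∈ Icc 0 (n * δ), ‖T t‖ ≤ C := by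
    intro n
    induction n with
    | zero =>
      refine ⟨‖T 0‖, norm_nonneg _, fun t ht => ?_⟩
      have : t = 0 := le_antisymm (by simpa using ht.2) ht.1
      rw [this]
    | succ n ih =>
      obtain ⟨C, hC0, hC⟩ := ih
      refine ⟨max M (|M| * C), le_max_of_le_right (by positivity), fun t ht => ?_⟩
      rcases le_total t δ with h | h
      · exact le_max_of_le_left (hM t ⟨ht.1, h⟩)
      · refine le_max_of_le_right ?_
        have e : T t = (T δ).comp (T (t - δ)) := by
          rw [← hT.add δ (t - δ) hδ.le (by linarith)]; congr 1; ring
        have h2 := ht.2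
        push_cast at h2
        rw [e]
        refine (ContinuousLinearMap.opNorm_comp_le _ _).trans ?_
        gcongr
        · exact (hM δ ⟨hδ.le, le_rfl⟩).trans (le_abs_self M)
        · exact hC _ ⟨by linarith, by linarith⟩
  obtain ⟨n, hn⟩ := exists_nat_gt (b / δ)
  obtain ⟨C, hC0, hC⟩ := key n
  refine ⟨C, hC0, fun t ht => hC t ⟨ht.1, ht.2.trans ?_⟩⟩
  rw [div_lt_iff₀ hδ] at hn
  exact hn.le

lemma continuousOn [CompleteSpace H] (hT : IsSemigroupGeneratedBy A T) (f : H) :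
    ContinuousOn (fun t => T t f) (Ici 0) := by
  intro t₀ ht₀
  obtain ⟨M, hM0, hM⟩ := hT.exists_norm_le (t₀ + 1)
  have habs : Tendsto (fun t => |t - t₀|) (𝓝[Ici 0] t₀) (𝓝[≥] 0) := by
    refine tendsto_nhdsWithin_iff.2 ⟨?_, Eventually.of_forall fun t => mem_Ici.2 (abs_nonneg _)⟩
    have : Tendsto (fun t => |t - t₀|) (𝓝 t₀) (𝓝 |t₀ - t₀|) :=
      (continuous_abs.comp (continuous_sub_right t₀)).tendsto t₀
    simpa using this.mono_left nhdsWithin_le_nhds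
  have h1 : Tendsto (fun t => M * ‖T |t - t₀| f - f‖) (𝓝[Ici 0] t₀) (𝓝 0) := by
    have := ((tendsto_iff_norm_sub_tendsto_zero.1 (hT.tendsto_nhdsGE f)).comp habs).const_mul M
    simpa using this
  refine tendsto_iff_norm_sub_tendsto_zero.2
    (squeeze_zero' (Eventually.of_forall fun t => norm_nonneg _) ?_ h1)
  have hev : ∀ᶠ t in 𝓝[Ici 0] t₀, t < t₀ + 1 :=
    nhdsWithin_le_nhds (eventually_lt_nhds (by linarith))
  filter_upwards [self_mem_nhdsWithin, hev] with t (ht : 0 ≤ t) ht1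
  have ht₀' : (0:ℝ) ≤ t₀ := ht₀
  rcases le_total t₀ t with h | h
  · have e : T t f = T t₀ (T |t - t₀| f) := by
      rw [← ContinuousLinearMap.comp_apply, ← hT.add _ _ ht₀ (abs_nonneg _),
        abs_of_nonneg (sub_nonneg.2 h)]
      congr 2; ring
    rw [e, ← map_sub]
    exact (T t₀).le_of_opNorm_le (hM t₀ ⟨ht₀', by linarith⟩) _
  · have e : T t₀ f = T t (T |t - t₀| f) := by
      rw [← ContinuousLinearMap.comp_apply, ← hT.add _ _ ht (abs_nonneg _),
        abs_of_nonpos (sub_nonpos.2 h)]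
      congr 2; ring
    rw [e, norm_sub_rev, ← map_sub]
    exact (T t).le_of_opNorm_le (hM t ⟨ht, by linarith⟩) _

lemma tendsto_sub_nhdsGT (t : ℝ) : Tendsto (fun s => s - t) (𝓝[>] t) (𝓝[>] 0) := by
  refine tendsto_nhdsWithin_iff.2 ⟨?_, ?_⟩
  · have : Tendsto (fun s => s - t) (𝓝 t) (𝓝 (t - t)) := (continuous_sub_right t).tendsto t
    simpa using this.mono_left nhdsWithin_le_nhds
  · filter_upwards [self_mem_nhdsWithin] with s hs using mem_Ioi.2 (sub_pos.2 (mem_Ioi.1 hs))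

lemma hasDerivWithinAt (hT : IsSemigroupGeneratedBy A T) {f g : H} (h : A f g) {t : ℝ}
    (ht : 0 ≤ t) : HasDerivWithinAt (fun s => T s f) (-T t g) (Ici t) t := by
  rw [hasDerivWithinAt_iff_tendsto_slope, Ici_sdiff_left]
  have h1 := ((T t).continuous.tendsto _).comp
    (((hT.generator f g).1 h).comp (tendsto_sub_nhdsGT t))
  rw [map_neg] at h1
  refine h1.congr' ?_
  filter_upwards [self_mem_nhdsWithin] with s (hs : t < s)
  have e : T s f = T t (T (s - t) f) := by
    rw [← ContinuousLinearMap.comp_apply, ← hT.add _ _ ht (by linarith)]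
    congr 2; ring
  simp only [Function.comp_apply, slope, vsub_eq_sub, map_smul, map_sub, e]
  rw [Complex.coe_smul]

/-- The domain of the generator is invariant, and the generator commutes with the semigroup. -/
lemma generator_apply (hT : IsSemigroupGeneratedBy A T) {f g : H} (h : A f g) {t : ℝ}
    (ht : 0 ≤ t) : A (T t f) (T t g) := by
  refine (hT.generator _ _).2 ?_
  have h1 := ((T t).continuous.tendsto _).comp ((hT.generator f g).1 h)
  rw [map_neg] at h1
  refine h1.congr' ?_
  filter_upwards [self_mem_nhdsWithin] with s (hs : 0 < s)
  have e : T t (T s f) = T s (T t f) := by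
    rw [← ContinuousLinearMap.comp_apply, ← ContinuousLinearMap.comp_apply,
      ← hT.add _ _ ht hs.le, ← hT.add _ _ hs.le ht, add_comm]
  simp [e]

/-- A strongly continuous semigroup is determined by its generator, for accretive generators: the
square of the norm of the difference of two orbits has a nonpositive right derivative. -/
lemma unique [CompleteSpace H] {T' : ℝ → H →L[ℂ] H} (hT : IsSemigroupGeneratedBy A T)
    (hT' : IsSemigroupGeneratedBy A T')
    (hsub : ∀ f g f' g', A f g → A f' g' → A (f - f') (g - g'))
    (hacc : ∀ f g, A f g → 0 ≤ (inner ℂ f g).re) (hdense : Dense {f | ∃ g, A f g})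
    {t : ℝ} (ht : 0 ≤ t) : T t = T' t := by
  refine ContinuousLinearMap.ext fun f => ?_
  refine congrFun (Continuous.ext_on hdense (T t).continuous (T' t).continuous ?_) f
  rintro f ⟨g, h⟩
  have hc : ContinuousOn (fun s => T s f - T' s f) (Icc 0 t) :=
    ((hT.continuousOn f).sub (hT'.continuousOn f)).mono Icc_subset_Ici_self
  have hd : ∀ s ∈ Ico 0 t, HasDerivWithinAt (fun s => T s f - T' s f) (-T s g - -T' s g)
      (Ici s) s := fun s hs => (hT.hasDerivWithinAt h hs.1).sub (hT'.hasDerivWithinAt h hs.1)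
  have key := image_le_of_deriv_right_le_deriv_boundary
    (f := fun s => (inner ℂ (T s f - T' s f) (T s f - T' s f)).re)
    (f' := fun s => (inner ℂ (T s f - T' s f) (-T s g - -T' s g)
      + inner ℂ (-T s g - -T' s g) (T s f - T' s f)).re)
    (B := fun _ => 0) (B' := fun _ => 0) (a := 0) (b := t)
    (Complex.continuous_re.comp_continuousOn (ContinuousOn.inner hc hc))
    (fun s hs => Complex.reCLM.hasFDerivAt.comp_hasDerivWithinAt s ((hd s hs).inner ℂ (hd s hs)))
    (by simp [hT.zero, hT'.zero]) continuousOn_const (fun s hs => hasDerivWithinAt_const _ _ _) ?_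
    ⟨ht, le_rfl⟩
  · have h0 : ‖T t f - T' t f‖ ^ 2 ≤ 0 := by
      rw [← inner_self_eq_norm_sq (𝕜 := ℂ)]; exact key
    have := pow_eq_zero_iff (two_ne_zero) |>.1 (le_antisymm h0 (sq_nonneg _))
    exact sub_eq_zero.1 (norm_eq_zero.1 this)
  · intro s hs
    have h1 := hacc _ _ (hsub _ _ _ _ (hT.generator_apply h hs.1) (hT'.generator_apply h hs.1))
    have e : -T s g - -T' s g = -(T s g - T' s g) := by abel
    rw [e, inner_neg_right, inner_neg_left, Complex.add_re, Complex.neg_re, Complex.neg_re,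
      ← inner_conj_symm (T s g - T' s g), Complex.conj_re]
    linarith

/-- Differentiation of `T_r q(τ - r)`, in Duhamel's formula. -/
lemma hasDerivWithinAt_comp_sub [CompleteSpace H] (hT : IsSemigroupGeneratedBy A T) {q : ℝ → H}
    {q' b : H} {τ r : ℝ} (hr : 0 ≤ r) (hq : HasDerivAt q q' (τ - r)) (hb : A (q (τ - r)) b) :
    HasDerivWithinAt (fun s => T s (q (τ - s))) (-T r (b + q')) (Ici r) r := by
  have h1 := hT.hasDerivWithinAt hb hr
  rw [hasDerivWithinAt_iff_tendsto_slope, Ici_sdiff_left] at h1 ⊢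
  have hq2 : HasDerivAt (fun s => q (τ - s)) (-q') r := by
    have := hq.scomp_of_eq r ((hasDerivAt_id r).const_sub τ) rfl
    rw [neg_one_smul] at this
    exact this
  have h2 : Tendsto (slope (fun s => q (τ - s)) r) (𝓝[>] r) (𝓝 (-q')) :=
    (hasDerivAt_iff_tendsto_slope.1 hq2).mono_left
      (nhdsWithin_mono _ fun s hs => ne_of_gt hs)
  obtain ⟨M, hM0, hM⟩ := hT.exists_norm_le (r + 1)
  have hev : ∀ᶠ s in 𝓝[>] r, s < r + 1 := nhdsWithin_le_nhds (eventually_lt_nhds (by linarith))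
  have h3 : Tendsto (fun s => T s (slope (fun s => q (τ - s)) r s + q')) (𝓝[>] r) (𝓝 0) := by
    have : Tendsto (fun s => M * ‖slope (fun s => q (τ - s)) r s + q'‖) (𝓝[>] r) (𝓝 0) := by
      simpa using ((h2.add_const q').norm.const_mul M)
    refine squeeze_zero_norm' ?_ this
    filter_upwards [self_mem_nhdsWithin, hev] with s (hs : r < s) hs1
    exact (T s).le_of_opNorm_le (hM s ⟨by linarith, hs1.le⟩) _
  have h4 : Tendsto (fun s => T s q') (𝓝[>] r) (𝓝 (T r q')) :=
    ((hT.continuousOn q') r hr).mono_left (nhdsWithin_mono _ fun s hs => hr.trans (le_of_lt hs))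
  have h5 := (h1.add h3).sub h4
  have e : -T r b + 0 - T r q' = -T r (b + q') := by rw [map_add]; abel
  rw [e] at h5
  refine h5.congr fun s => ?_
  simp only [slope, vsub_eq_sub, map_add, map_sub, smul_sub]
  have e2 : ∀ x : H, (s - r)⁻¹ • T s x = T s ((s - r)⁻¹ • x) := fun x => by
    exact ((T s).map_smul_of_tower _ _).symm
  simp only [e2]
  abel

end IsSemigroupGeneratedBy

lemma isSemigroupGeneratedBy_heatOp [CompleteSpace H] {R : H →L[ℂ] H} (hR : IsSelfAdjoint R)
    (hspec : spectrum ℝ R ⊆ Icc 0 1) (hinj : Function.Injective R) :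
    IsSemigroupGeneratedBy (fun f g => f = R (f + g)) (heatOp R) where
  zero := heatOp_zero
  add _ _ hs ht := heatOp_add hspec hs ht
  strongly_continuous := tendsto_heatOp hR hspec hinj
  generator f g := (tendsto_inv_smul_heatOp_iff hR hspec hinj f g).symm

end Semigroup

/-! ### Primitives of integrable functions on an interval -/

lemma AbsolutelyContinuousOnInterval.congr {f g : ℝ → ℂ} {a b : ℝ}
    (hf : AbsolutelyContinuousOnInterval f a b) (h : EqOn f g (uIcc a b)) :
    AbsolutelyContinuousOnInterval g a b := by
  rw [absolutelyContinuousOnInterval_iff] at hf ⊢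
  intro ε hε
  obtain ⟨δ, hδ, H⟩ := hf ε hε
  refine ⟨δ, hδ, fun I hI hl => ?_⟩
  convert H I hI hl using 1
  refine Finset.sum_congr rfl fun i hi => ?_
  have := hI.1 i hi
  rw [h this.1, h this.2]

/-- The indefinite integral of a complex-valued integrable function is absolutely continuous. -/
lemma IntervalIntegrable.absolutelyContinuousOnInterval_primitive {f : ℝ → ℂ} {l : ℝ}
    (hl : 0 ≤ l) (hf : IntervalIntegrable f volume 0 l) :
    AbsolutelyContinuousOnInterval (fun s => ∫ r in (0:ℝ)..s, f r) 0 l := by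
  have h0 : (0:ℝ) ∈ uIcc 0 l := left_mem_uIcc
  have hconst : ∀ c : ℂ, AbsolutelyContinuousOnInterval (fun _ : ℝ => c) 0 l := fun c =>
    (LipschitzWith.const c).lipschitzOnWith.absolutelyContinuousOnInterval
  have hre : IntervalIntegrable (fun r => (f r).re) volume 0 l := ⟨hf.1.re, hf.2.re⟩
  have him : IntervalIntegrable (fun r => (f r).im) volume 0 l := ⟨hf.1.im, hf.2.im⟩
  have h1 := hre.absolutelyContinuousOnInterval_intervalIntegral h0
  have h2 := him.absolutelyContinuousOnInterval_intervalIntegral h0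
  have h := (AbsolutelyContinuousOnInterval.smul (M := ℝ) (F := ℂ) h1 (hconst 1)).add
    (AbsolutelyContinuousOnInterval.smul (M := ℝ) (F := ℂ) h2 (hconst Complex.I))
  refine h.congr fun s hs => ?_
  rw [uIcc_of_le hl] at hs
  have hsub : uIcc 0 s ⊆ uIcc 0 l := by
    rw [uIcc_of_le hl, uIcc_of_le hs.1]; exact Icc_subset_Icc_right hs.2
  have hs1 := hre.mono_set hsub
  have hs2 := him.mono_set hsub
  have hs3 : IntervalIntegrable (fun r => ((f r).re : ℂ)) volume 0 s := ⟨hs1.1.ofReal, hs1.2.ofReal⟩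
  have hs4 : IntervalIntegrable (fun r => ((f r).im : ℂ)) volume 0 s := ⟨hs2.1.ofReal, hs2.2.ofReal⟩
  simp only [Pi.add_apply, Pi.smul_apply', Complex.real_smul, mul_one]
  rw [← intervalIntegral.integral_ofReal, ← intervalIntegral.integral_ofReal,
    ← intervalIntegral.integral_mul_const, ← intervalIntegral.integral_add hs3 (hs4.mul_const _)]
  exact intervalIntegral.integral_congr fun r _ => Complex.re_add_im (f r)

/-- Integration by parts for two absolutely continuous functions, given as primitives of integrable
functions. -/
lemma integral_add_mul_of_primitive {F G f g : ℝ → ℂ} {l : ℝ} (hl : 0 ≤ l)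
    (hf : IntervalIntegrable f volume 0 l) (hg : IntervalIntegrable g volume 0 l)
    (hF : ∀ s ∈ Icc 0 l, F s = F 0 + ∫ r in (0:ℝ)..s, f r)
    (hG : ∀ s ∈ Icc 0 l, G s = G 0 + ∫ r in (0:ℝ)..s, g r) :
    ∫ s in (0:ℝ)..l, (f s * G s + F s * g s) = F l * G l - F 0 * G 0 := by
  have hu : uIcc 0 l = Icc 0 l := uIcc_of_le hl
  have h0 : (0:ℝ) ∈ uIcc 0 l := left_mem_uIcc
  obtain ⟨F1, hF1⟩ : ∃ F1 : ℝ → ℂ, F1 = fun s => F 0 + ∫ r in (0:ℝ)..s, f r := ⟨_, rfl⟩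
  obtain ⟨G1, hG1⟩ : ∃ G1 : ℝ → ℂ, G1 = fun s => G 0 + ∫ r in (0:ℝ)..s, g r := ⟨_, rfl⟩
  have hconst : ∀ c : ℂ, AbsolutelyContinuousOnInterval (fun _ : ℝ => c) 0 l := fun c =>
    (LipschitzWith.const c).lipschitzOnWith.absolutelyContinuousOnInterval
  have aF : AbsolutelyContinuousOnInterval F1 0 l := by
    rw [hF1]
    have := hf.absolutelyContinuousOnInterval_primitive hl
    exact (hconst (F 0)).add this
  have aG : AbsolutelyContinuousOnInterval G1 0 l := by
    rw [hG1]
    have := hg.absolutelyContinuousOnInterval_primitive hl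
    exact (hconst (G 0)).add this
  have hi : IntervalIntegrable (fun s => f s * G1 s + F1 s * g s) volume 0 l :=
    (hf.mul_continuousOn aG.continuousOn).add (hg.continuousOn_mul aF.continuousOn)
  have aD : AbsolutelyContinuousOnInterval
      (fun s => F1 s * G1 s - ∫ r in (0:ℝ)..s, (f r * G1 r + F1 r * g r)) 0 l :=
    (AbsolutelyContinuousOnInterval.smul (M := ℂ) (F := ℂ) aF aG).sub
      (hi.absolutelyContinuousOnInterval_primitive hl)
  obtain ⟨C, hC⟩ := aD.const_of_ae_hasDerivAt_zero (by
    filter_upwards [hf.ae_hasDerivAt_integral, hg.ae_hasDerivAt_integral,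
      hi.ae_hasDerivAt_integral] with x h1 h2 h3 hx
    have d1 : HasDerivAt F1 (f x) x := by
      rw [hF1]; exact (h1 hx 0 h0).const_add (F 0)
    have d2 : HasDerivAt G1 (g x) x := by
      rw [hG1]; exact (h2 hx 0 h0).const_add (G 0)
    have d := (d1.mul d2).sub (h3 hx 0 h0)
    rw [sub_self] at d
    exact d)
  have hF' : ∀ s ∈ Icc 0 l, F s = F1 s := by rw [hF1]; exact hF
  have hG' : ∀ s ∈ Icc 0 l, G s = G1 s := by rw [hG1]; exact hG
  have e0 := hC 0 h0
  have el := hC l right_mem_uIcc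
  have e : ∫ s in (0:ℝ)..l, (f s * G s + F s * g s)
      = ∫ s in (0:ℝ)..l, (f s * G1 s + F1 s * g s) := by
    refine intervalIntegral.integral_congr fun s hs => ?_
    rw [hu] at hs
    simp only [hF' s hs, hG' s hs]
  rw [e, hF' l ⟨hl, le_rfl⟩, hG' l ⟨hl, le_rfl⟩, hF' 0 ⟨le_rfl, hl⟩, hG' 0 ⟨le_rfl, hl⟩]
  rw [intervalIntegral.integral_same] at e0
  linear_combination e0 - el

lemma eq_add_integral_of_hasDerivWithinAt_Icc {F f : ℝ → ℂ} {l : ℝ}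
    (hF : ∀ s ∈ Icc 0 l, HasDerivWithinAt F (f s) (Icc 0 l) s) (hf : ContinuousOn f (Icc 0 l))
    {s : ℝ} (hs : s ∈ Icc 0 l) : F s = F 0 + ∫ r in (0:ℝ)..s, f r := by
  have hsub : Icc 0 s ⊆ Icc 0 l := Icc_subset_Icc_right hs.2
  rw [intervalIntegral.integral_eq_sub_of_hasDerivAt_of_le hs.1
    (fun r hr => ((hF r (hsub hr)).continuousWithinAt).mono hsub)
    (fun r hr => (hF r (hsub (Ioo_subset_Icc_self hr))).hasDerivAt
      (Icc_mem_nhds hr.1 (hr.2.trans_le hs.2)))]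
  · ring
  · exact (hf.mono (by rw [uIcc_of_le hs.1]; exact hsub)).intervalIntegrable

/-- The Cauchy-Schwarz inequality against the constant function `1`. -/
lemma norm_integral_le_sqrt_mul {p : ℝ → ℂ} {a b : ℝ} (hab : a ≤ b)
    (hp : ContinuousOn p (Icc a b)) :
    ‖∫ s in a..b, p s‖ ≤ √((b - a) * ∫ s in a..b, ‖p s‖ ^ 2) := by
  rcases hab.eq_or_lt with rfl | hlt
  · simp
  have hp' : ContinuousOn p (uIcc a b) := by rwa [uIcc_of_le hab]
  have i1 : IntervalIntegrable (fun s => ‖p s‖) volume a b := hp'.norm.intervalIntegrable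
  have i2 : IntervalIntegrable (fun s => ‖p s‖ ^ 2) volume a b :=
    (hp'.norm.pow 2).intervalIntegrable
  refine (intervalIntegral.norm_integral_le_integral_norm hab).trans (Real.le_sqrt_of_sq_le ?_)
  set Q := ∫ s in a..b, ‖p s‖ with hQ
  have hba : 0 < b - a := sub_pos.2 hlt
  have key : 0 ≤ ∫ s in a..b, (‖p s‖ ^ 2 - (2 * Q / (b - a)) * ‖p s‖ + (Q / (b - a)) ^ 2) := by
    refine intervalIntegral.integral_nonneg hab fun s _ => ?_
    have := sq_nonneg (‖p s‖ - Q / (b - a))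
    calc (0:ℝ) ≤ (‖p s‖ - Q / (b - a)) ^ 2 := this
      _ = _ := by ring
  rw [intervalIntegral.integral_add (i2.sub (i1.const_mul _)) (by simp),
    intervalIntegral.integral_sub i2 (i1.const_mul _), intervalIntegral.integral_const_mul, ← hQ,
    intervalIntegral.integral_const, smul_eq_mul] at key
  have e : (2 * Q / (b - a)) * Q - (b - a) * (Q / (b - a)) ^ 2 = Q ^ 2 / (b - a) := by
    field_simp; ring
  have h2 : Q ^ 2 / (b - a) ≤ ∫ s in a..b, ‖p s‖ ^ 2 := by rw [← e]; linarith
  rwa [div_le_iff₀ hba, mul_comm] at h2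

namespace MetricGraph

variable {V E : Type*} (G : MetricGraph V E)

/-! ### Topology and measure of a quantum graph -/

lemma edgePoint_zero (e : E) : G.edgePoint e 0 = Point.vertex (G.src e) := by
  simp [edgePoint]

lemma edgePoint_length (e : E) : G.edgePoint e (G.length e) = Point.vertex (G.tgt e) := by
  simp [edgePoint, (G.length_pos e).not_ge]

lemma edgePoint_of_mem {e : E} {s : ℝ} (h : s ∈ Ioo 0 (G.length e)) :
    G.edgePoint e s = Point.interior e ⟨s, h⟩ := dif_pos h

lemma edgePoint_projIcc (e : E) (s : ℝ) :
    G.edgePoint e (projIcc 0 (G.length e) (G.length_pos e).le s) = G.edgePoint e s := by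
  rcases le_or_gt s 0 with h | h
  · have h' : ¬ s ∈ Ioo 0 (G.length e) := fun h' => absurd h'.1 (not_lt.2 h)
    rw [projIcc_of_le_left _ h, edgePoint_zero]
    simp [edgePoint, h, h']
  · rcases le_or_gt (G.length e) s with h1 | h1
    · have h' : ¬ s ∈ Ioo 0 (G.length e) := fun h' => absurd h'.2 (not_lt.2 h1)
      rw [projIcc_of_right_le _ h1, edgePoint_length]
      simp [edgePoint, h', not_le.2 h]
    · rw [projIcc_of_mem _ ⟨h.le, h1.le⟩]

lemma continuous_edgePoint (e : E) : Continuous (G.edgePoint e) := by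
  have h1 : Continuous (fun p : (Σ e : E, Icc (0 : ℝ) (G.length e)) =>
    G.edgePoint p.1 (p.2 : ℝ)) := continuous_coinduced_rng
  have h2 := h1.comp (continuous_sigmaMk.comp
    (continuous_projIcc (h := (G.length_pos e).le)) : Continuous fun s : ℝ =>
      (⟨e, projIcc 0 (G.length e) (G.length_pos e).le s⟩ : Σ e : E, Icc (0 : ℝ) (G.length e)))
  refine h2.congr fun s => G.edgePoint_projIcc e s

/-- The universal property of the quotient topology. -/
lemma continuous_iff {Y : Type*} [TopologicalSpace Y] {u : G.Point → Y} :
    Continuous u ↔ ∀ e, ContinuousOn (fun s => u (G.edgePoint e s)) (Icc 0 (G.length e)) := by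
  constructor
  · intro h e
    exact (h.comp (G.continuous_edgePoint e)).continuousOn
  · intro h
    rw [continuous_coinduced_dom, continuous_sigma_iff]
    intro e
    exact continuousOn_iff_continuous_domRestrict.1 (h e)

/-- A connected graph with an edge has no isolated vertices. -/
lemma exists_edgePoint_eq_of_connected [Nonempty E] {G : MetricGraph V E} (hG : G.Connected)
    (v : V) : ∃ e, G.src e = v ∨ G.tgt e = v := by
  obtain ⟨e₀⟩ := ‹Nonempty E›
  have key : ∀ v w : V, Relation.EqvGen (fun v w => ∃ e, G.src e = v ∧ G.tgt e = w) v w →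
      ((∃ e, G.src e = v ∨ G.tgt e = v) ↔ ∃ e, G.src e = w ∨ G.tgt e = w) := by
    intro v w h
    induction h with
    | rel v w h =>
      obtain ⟨e, h1, h2⟩ := h
      exact ⟨fun _ => ⟨e, Or.inr h2⟩, fun _ => ⟨e, Or.inl h1⟩⟩
    | refl v => exact Iff.rfl
    | symm v w _ ih => exact ih.symm
    | trans u v w _ _ ih1 ih2 => exact ih1.trans ih2
  exact (key _ _ (hG v (G.src e₀))).2 ⟨e₀, Or.inl rfl⟩

lemma exists_edgePoint_eq [Nonempty E] {G : MetricGraph V E} (hG : G.Connected)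
    (x : G.Point) : ∃ e, ∃ s ∈ Icc 0 (G.length e), G.edgePoint e s = x := by
  cases x with
  | vertex v =>
    obtain ⟨e, h | h⟩ := exists_edgePoint_eq_of_connected hG v
    · exact ⟨e, 0, ⟨le_rfl, (G.length_pos e).le⟩, by rw [edgePoint_zero, h]⟩
    · exact ⟨e, G.length e, ⟨(G.length_pos e).le, le_rfl⟩, by rw [edgePoint_length, h]⟩
  | interior e s => exact ⟨e, s, Ioo_subset_Icc_self s.2, G.edgePoint_of_mem s.2⟩

lemma compactSpace [Finite V] [Finite E] : CompactSpace G.Point := by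
  constructor
  have : (univ : Set G.Point)
      = (⋃ e, G.edgePoint e '' Icc 0 (G.length e)) ∪ range Point.vertex := by
    symm
    rw [eq_univ_iff_forall]
    rintro (v | ⟨e, s⟩)
    · exact Or.inr ⟨v, rfl⟩
    · exact Or.inl (mem_iUnion.2 ⟨e, s, Ioo_subset_Icc_self s.2, G.edgePoint_of_mem s.2⟩)
  rw [this]
  exact (isCompact_iUnion fun e => isCompact_Icc.image (G.continuous_edgePoint e)).union
    (finite_range _).isCompact

/-- The function on the graph with values `c v` at the vertices and `φ e s` in the interiors of the
edges. -/
def glue {Y : Type*} (c : V → Y) (φ : E → ℝ → Y) : G.Point → Y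
  | Point.vertex v => c v
  | Point.interior e s => φ e s

lemma glue_edgePoint {Y : Type*} {c : V → Y} {φ : E → ℝ → Y} {e : E}
    (h0 : φ e 0 = c (G.src e)) (h1 : φ e (G.length e) = c (G.tgt e)) {s : ℝ}
    (hs : s ∈ Icc 0 (G.length e)) : G.glue c φ (G.edgePoint e s) = φ e s := by
  rcases hs.1.eq_or_lt with rfl | h
  · rw [edgePoint_zero, h0]; rfl
  rcases hs.2.eq_or_lt with rfl | h'
  · rw [edgePoint_length, h1]; rfl
  rw [G.edgePoint_of_mem ⟨h, h'⟩]; rfl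

lemma continuous_glue {Y : Type*} [TopologicalSpace Y] {c : V → Y} {φ : E → ℝ → Y}
    (h0 : ∀ e, φ e 0 = c (G.src e)) (h1 : ∀ e, φ e (G.length e) = c (G.tgt e))
    (hφ : ∀ e, ContinuousOn (φ e) (Icc 0 (G.length e))) : Continuous (G.glue c φ) := by
  rw [continuous_iff]
  exact fun e => (hφ e).congr fun s hs => G.glue_edgePoint (h0 e) (h1 e) hs

variable [Fintype E]

instance : IsFiniteMeasure G.measure := by
  unfold measure
  infer_instance

lemma map_edgePoint_le (e : E) :
    (volume.restrict (Icc (0 : ℝ) (G.length e))).map (G.edgePoint e) ≤ G.measure :=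
  Finset.single_le_sum
    (f := fun e => (volume.restrict (Icc (0 : ℝ) (G.length e))).map (G.edgePoint e))
    (fun _ _ => Measure.zero_le _) (Finset.mem_univ e)

lemma quasiMeasurePreserving_edgePoint (e : E) :
    Measure.QuasiMeasurePreserving (G.edgePoint e) (volume.restrict (Icc 0 (G.length e)))
      G.measure := by
  exact ⟨(G.continuous_edgePoint e).measurable,
    Measure.absolutelyContinuous_of_le (G.map_edgePoint_le e)⟩

lemma ae_edge {P : G.Point → Prop} (h : ∀ᵐ x ∂G.measure, P x) (e : E) :
    ∀ᵐ s ∂volume.restrict (Icc 0 (G.length e)), P (G.edgePoint e s) :=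
  (G.quasiMeasurePreserving_edgePoint e).ae h

lemma integrable_edge {Y : Type*} [NormedAddCommGroup Y] {F : G.Point → Y}
    (hF : Integrable F G.measure) (e : E) :
    IntervalIntegrable (fun s => F (G.edgePoint e s)) volume 0 (G.length e) := by
  rw [intervalIntegrable_iff_integrableOn_Icc_of_le (G.length_pos e).le]
  have h := hF.mono_measure (G.map_edgePoint_le e)
  exact h.comp_measurable (G.continuous_edgePoint e).measurable

lemma integral_eq_sum {Y : Type*} [NormedAddCommGroup Y] [NormedSpace ℝ Y]
    {F : G.Point → Y} (hF : Integrable F G.measure) :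
    ∫ x, F x ∂G.measure = ∑ e, ∫ s in (0:ℝ)..G.length e, F (G.edgePoint e s) := by
  have h := fun e => hF.mono_measure (G.map_edgePoint_le e)
  unfold measure
  rw [integral_finsetSum_measure fun e _ => h e]
  refine Finset.sum_congr rfl fun e _ => ?_
  rw [integral_map (G.continuous_edgePoint e).measurable.aemeasurable (h e).aestronglyMeasurable,
    intervalIntegral.integral_of_le (G.length_pos e).le, integral_Icc_eq_integral_Ioc]

end MetricGraph

open scoped ComplexConjugate

namespace MetricGraph

variable {V E : Type*} (G : MetricGraph V E)

/-! ### Green's identity -/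

open Classical in
/-- `u` is a function in the domain of the Kirchhoff Laplacian with derivative `p` and `-u'' = h`,
at the level of functions rather than of elements of `L²`. -/
structure IsKirchhoff [Fintype E] (u : G.Point → ℂ) (p : E → ℝ → ℂ) (h : G.Point → ℂ) : Prop where
  continuous : Continuous u
  hasDeriv : ∀ e, ∀ s ∈ Icc (0 : ℝ) (G.length e),
    HasDerivWithinAt (fun r => u (G.edgePoint e r)) (p e s) (Icc (0 : ℝ) (G.length e)) s
  deriv_eq : ∀ e, ∀ s ∈ Icc (0 : ℝ) (G.length e),
    p e s = p e 0 - ∫ r in (0 : ℝ)..s, h (G.edgePoint e r)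
  vertex : ∀ v : V, (∑ e : E, ((if G.src e = v then p e 0 else 0)
      + (if G.tgt e = v then -p e (G.length e) else 0))) = 0

variable [Fintype E] {G}

lemma kirchhoffLaplacian_iff {f g : G.L2} :
    G.KirchhoffLaplacian f g ↔ ∃ u p, (f : G.Point → ℂ) =ᵐ[G.measure] u ∧ G.IsKirchhoff u p g := by
  constructor
  · rintro ⟨u, p, h1, h2, h3, h4, h5⟩
    exact ⟨u, p, h2, h1, h3, h4, h5⟩
  · rintro ⟨u, p, h2, h1, h3, h4, h5⟩
    exact ⟨u, p, h1, h2, h3, h4, h5⟩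

lemma ae_uIoc_edge {P : G.Point → Prop} (h : ∀ᵐ x ∂G.measure, P x) {e : E} {s : ℝ}
    (hs : s ∈ Icc 0 (G.length e)) : ∀ᵐ r : ℝ, r ∈ uIoc 0 s → P (G.edgePoint e r) := by
  have h1 := (ae_restrict_iff' measurableSet_Icc).1 (G.ae_edge h e)
  filter_upwards [h1] with r hr hr'
  rw [uIoc_of_le hs.1] at hr'
  exact hr ⟨hr'.1.le, hr'.2.trans hs.2⟩

lemma integrable_L2 (g : G.L2) : Integrable g G.measure :=
  (Lp.memLp g).integrable one_le_two

lemma integrable_of_continuous [Finite V] {u : G.Point → ℂ} (hu : Continuous u) :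
    Integrable u G.measure := by
  have := G.compactSpace
  exact (BoundedContinuousFunction.mkOfCompact ⟨u, hu⟩).integrable G.measure

namespace IsKirchhoff

variable {u u' : G.Point → ℂ} {p p' : E → ℝ → ℂ} {h h' : G.Point → ℂ}

lemma congr_ae (K : G.IsKirchhoff u p h) (hh : h =ᵐ[G.measure] h') : G.IsKirchhoff u p h' := by
  refine ⟨K.continuous, K.hasDeriv, fun e s hs => ?_, K.vertex⟩
  rw [K.deriv_eq e s hs]
  congr 1
  exact intervalIntegral.integral_congr_ae (ae_uIoc_edge hh hs)

lemma continuousOn_deriv (K : G.IsKirchhoff u p h) (hh : Integrable h G.measure) (e : E) :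
    ContinuousOn (p e) (Icc 0 (G.length e)) := by
  refine ContinuousOn.congr ?_ (K.deriv_eq e)
  have hi := G.integrable_edge hh e
  rw [intervalIntegrable_iff_integrableOn_Icc_of_le (G.length_pos e).le,
    ← uIcc_of_le (G.length_pos e).le] at hi
  have := intervalIntegral.continuousOn_primitive_interval hi
  rw [uIcc_of_le (G.length_pos e).le] at this
  exact continuousOn_const.sub this

lemma eq_add_integral (K : G.IsKirchhoff u p h) (hh : Integrable h G.measure) (e : E) {s : ℝ}
    (hs : s ∈ Icc 0 (G.length e)) :
    u (G.edgePoint e s) = u (G.edgePoint e 0) + ∫ r in (0:ℝ)..s, p e r :=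
  eq_add_integral_of_hasDerivWithinAt_Icc (F := fun s => u (G.edgePoint e s)) (K.hasDeriv e)
    (K.continuousOn_deriv hh e) hs

lemma integrable_mul (K : G.IsKirchhoff u p h) (hh' : Integrable h' G.measure) (e : E) :
    IntervalIntegrable (fun s => u (G.edgePoint e s) * h' (G.edgePoint e s)) volume 0
      (G.length e) :=
  (G.integrable_edge hh' e).continuousOn_mul
    ((K.continuous.comp (G.continuous_edgePoint e)).continuousOn)

/-- Green's identity: the boundary terms at each vertex cancel by the Kirchhoff condition. -/
lemma green [Finite V] (K : G.IsKirchhoff u p h) (K' : G.IsKirchhoff u' p' h')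
    (hh : Integrable h G.measure) (hh' : Integrable h' G.measure) :
    ∑ e, ∫ s in (0:ℝ)..G.length e, p e s * p' e s
      = ∑ e, ∫ s in (0:ℝ)..G.length e, u (G.edgePoint e s) * h' (G.edgePoint e s) := by
  classical
  have := Fintype.ofFinite V
  have hl := fun e => (G.length_pos e).le
  have hp : ∀ e, IntervalIntegrable (p e) volume 0 (G.length e) := fun e =>
    ContinuousOn.intervalIntegrable (by rw [uIcc_of_le (hl e)]; exact K.continuousOn_deriv hh e)
  have hpp : ∀ e, IntervalIntegrable (fun s => p e s * p' e s) volume 0 (G.length e) := fun e =>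
    (hp e).mul_continuousOn (by rw [uIcc_of_le (hl e)]; exact K'.continuousOn_deriv hh' e)
  have key : ∀ e, (∫ s in (0:ℝ)..G.length e, p e s * p' e s)
      - ∫ s in (0:ℝ)..G.length e, u (G.edgePoint e s) * h' (G.edgePoint e s)
      = u (Point.vertex (G.tgt e)) * p' e (G.length e) - u (Point.vertex (G.src e)) * p' e 0 := by
    intro e
    have := integral_add_mul_of_primitive (F := fun s => u (G.edgePoint e s)) (G := p' e)
      (g := fun s => - h' (G.edgePoint e s)) (hl e) (hp e) (G.integrable_edge hh' e).neg
      (fun s hs => K.eq_add_integral hh e hs)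
      (fun s hs => by
        rw [intervalIntegral.integral_neg, ← sub_eq_add_neg]; exact K'.deriv_eq e s hs)
    simp only [edgePoint_zero, edgePoint_length] at this
    rw [← this, ← intervalIntegral.integral_sub (hpp e) (K.integrable_mul hh' e)]
    exact intervalIntegral.integral_congr fun s _ => by ring
  have hv : ∑ v, u (Point.vertex v) * (∑ e : E, ((if G.src e = v then p' e 0 else 0)
      + (if G.tgt e = v then -p' e (G.length e) else 0))) = 0 :=
    Finset.sum_eq_zero fun v _ => by
      have := K'.vertex v
      rw [mul_eq_zero]; right; convert this
  simp only [Finset.mul_sum] at hv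
  rw [Finset.sum_comm] at hv
  rw [← sub_eq_zero, ← Finset.sum_sub_distrib, Finset.sum_congr rfl fun e _ => key e, ← neg_eq_zero,
    ← hv, ← Finset.sum_neg_distrib]
  refine Finset.sum_congr rfl fun e _ => ?_
  simp only [mul_add, mul_ite, mul_zero, Finset.sum_add_distrib, Finset.sum_ite_eq,
    Finset.mem_univ, if_true]
  ring

lemma conjugate (K : G.IsKirchhoff u p h) :
    G.IsKirchhoff (fun x => conj (u x)) (fun e s => conj (p e s)) (fun x => conj (h x)) := by
  refine ⟨Complex.continuous_conj.comp K.continuous, fun e s hs => ?_, fun e s hs => ?_,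
    fun v => ?_⟩
  · exact (K.hasDeriv e s hs).star
  · rw [K.deriv_eq e s hs, map_sub, intervalIntegral.intervalIntegral_conj]
  · have := congrArg conj (K.vertex v)
    simpa [apply_ite conj] using this

lemma sub (K : G.IsKirchhoff u p h) (K' : G.IsKirchhoff u' p' h') (hh : Integrable h G.measure)
    (hh' : Integrable h' G.measure) :
    G.IsKirchhoff (fun x => u x - u' x) (fun e s => p e s - p' e s) (fun x => h x - h' x) := by
  refine ⟨K.continuous.sub K'.continuous, fun e s hs => ?_, fun e s hs => ?_, fun v => ?_⟩
  · exact (K.hasDeriv e s hs).sub (K'.hasDeriv e s hs)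
  · have hsub : uIcc 0 s ⊆ uIcc 0 (G.length e) := by
      rw [uIcc_of_le (G.length_pos e).le, uIcc_of_le hs.1]; exact Icc_subset_Icc_right hs.2
    rw [K.deriv_eq e s hs, K'.deriv_eq e s hs, intervalIntegral.integral_sub
      ((G.integrable_edge hh e).mono_set hsub) ((G.integrable_edge hh' e).mono_set hsub)]
    ring
  · have := congrArg₂ (· - ·) (K.vertex v) (K'.vertex v)
    simp only [← Finset.sum_sub_distrib, sub_zero] at this
    refine Eq.trans (Finset.sum_congr rfl fun e _ => ?_) this
    split_ifs <;> ring

lemma smul (K : G.IsKirchhoff u p h) (c : ℂ) :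
    G.IsKirchhoff (fun x => c * u x) (fun e s => c * p e s) (fun x => c * h x) := by
  refine ⟨continuous_const.mul K.continuous, fun e s hs => ?_, fun e s hs => ?_, fun v => ?_⟩
  · exact (K.hasDeriv e s hs).const_mul c
  · rw [K.deriv_eq e s hs, intervalIntegral.integral_const_mul]
    ring
  · have := congrArg (c * ·) (K.vertex v)
    simpa [Finset.mul_sum, mul_add] using this

end IsKirchhoff

lemma inner_eq_sum {f : G.L2} {u : G.Point → ℂ} (hu : (f : G.Point → ℂ) =ᵐ[G.measure] u)
    (g : G.L2) : inner ℂ f g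
      = ∑ e, ∫ s in (0:ℝ)..G.length e, conj (u (G.edgePoint e s)) * g (G.edgePoint e s) := by
  rw [L2.inner_def, G.integral_eq_sum (L2.integrable_inner f g)]
  refine Finset.sum_congr rfl fun e _ => ?_
  refine intervalIntegral.integral_congr_ae ?_
  filter_upwards [ae_uIoc_edge hu (right_mem_Icc.2 (G.length_pos e).le)] with s hs hs'
  rw [hs hs', RCLike.inner_apply, mul_comm]

/-- The Dirichlet form of the Kirchhoff Laplacian. -/
lemma inner_eq_energy [Finite V] {f g g' : G.L2} {u u' : G.Point → ℂ} {p p' : E → ℝ → ℂ}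
    (hu : (f : G.Point → ℂ) =ᵐ[G.measure] u)
    (K : G.IsKirchhoff u p g) (K' : G.IsKirchhoff u' p' g') :
    inner ℂ f g' = ∑ e, ∫ s in (0:ℝ)..G.length e, conj (p e s) * p' e s := by
  have hc : Integrable (fun x => conj (g x)) G.measure :=
    ((Lp.memLp g).star.integrable one_le_two)
  rw [inner_eq_sum hu, K.conjugate.green K' hc (integrable_L2 g')]

/-- The integral `∑ₑ ∫ |p|²` of a function `p` given on the edges. It is the Dirichlet integral of
`u` if `p` is the derivative of `u`, and the squared `L²` norm of `u` if `p` is `u` itself. -/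
noncomputable def energy (G : MetricGraph V E) (p : E → ℝ → ℂ) : ℝ :=
  ∑ e, ∫ s in (0:ℝ)..G.length e, ‖p e s‖ ^ 2

lemma energy_nonneg (p : E → ℝ → ℂ) : 0 ≤ G.energy p :=
  Finset.sum_nonneg fun e _ => intervalIntegral.integral_nonneg (G.length_pos e).le
    fun _ _ => by positivity

lemma integral_norm_sq_le_energy (p : E → ℝ → ℂ) (e : E) :
    ∫ s in (0:ℝ)..G.length e, ‖p e s‖ ^ 2 ≤ G.energy p :=
  Finset.single_le_sum (f := fun e => ∫ s in (0:ℝ)..G.length e, ‖p e s‖ ^ 2)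
    (fun e _ => intervalIntegral.integral_nonneg (G.length_pos e).le fun _ _ => by positivity)
    (Finset.mem_univ e)

lemma sum_conj_mul_eq_energy (p : E → ℝ → ℂ) :
    ∑ e, ∫ s in (0:ℝ)..G.length e, conj (p e s) * p e s = (G.energy p : ℂ) := by
  rw [energy, Complex.ofReal_sum]
  refine Finset.sum_congr rfl fun e _ => ?_
  rw [← intervalIntegral.integral_ofReal]
  refine intervalIntegral.integral_congr fun s _ => ?_
  simp only [RCLike.conj_mul]
  norm_cast

lemma kirchhoffLaplacian_inner_symm [Finite V] {f g f' g' : G.L2} (h : G.KirchhoffLaplacian f g)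
    (h' : G.KirchhoffLaplacian f' g') : inner ℂ f g' = inner ℂ g f' := by
  obtain ⟨u, p, hu, K⟩ := kirchhoffLaplacian_iff.1 h
  obtain ⟨u', p', hu', K'⟩ := kirchhoffLaplacian_iff.1 h'
  rw [inner_eq_energy hu K K', ← inner_conj_symm, inner_eq_energy hu' K' K, map_sum]
  refine Finset.sum_congr rfl fun e _ => ?_
  rw [← intervalIntegral.intervalIntegral_conj]
  exact intervalIntegral.integral_congr fun s _ => by simp [mul_comm]

lemma kirchhoffLaplacian_sub {f g f' g' : G.L2} (h : G.KirchhoffLaplacian f g)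
    (h' : G.KirchhoffLaplacian f' g') : G.KirchhoffLaplacian (f - f') (g - g') := by
  obtain ⟨u, p, hu, K⟩ := kirchhoffLaplacian_iff.1 h
  obtain ⟨u', p', hu', K'⟩ := kirchhoffLaplacian_iff.1 h'
  refine kirchhoffLaplacian_iff.2 ⟨_, _, ?_,
    (K.sub K' (integrable_L2 g) (integrable_L2 g')).congr_ae (Lp.coeFn_sub g g').symm⟩
  filter_upwards [Lp.coeFn_sub f f', hu, hu'] with x h1 h2 h3
  rw [h1, Pi.sub_apply, h2, h3]

lemma kirchhoffLaplacian_inner_eq_energy [Finite V] {f g : G.L2} {u : G.Point → ℂ}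
    {p : E → ℝ → ℂ} (hu : (f : G.Point → ℂ) =ᵐ[G.measure] u) (K : G.IsKirchhoff u p g) :
    inner ℂ f g = (G.energy p : ℂ) := by
  rw [inner_eq_energy hu K K, sum_conj_mul_eq_energy]

lemma kirchhoffLaplacian_accretive [Finite V] {f g : G.L2} (h : G.KirchhoffLaplacian f g) :
    0 ≤ (inner ℂ f g).re := by
  obtain ⟨u, p, hu, K⟩ := kirchhoffLaplacian_iff.1 h
  rw [kirchhoffLaplacian_inner_eq_energy hu K]
  exact energy_nonneg p

end MetricGraph

/-! ### Solving the resolvent equation on an edge -/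

lemma hasDerivAt_ofReal_exp (s : ℝ) :
    HasDerivAt (fun s : ℝ => (Real.exp s : ℂ)) (Real.exp s : ℂ) s :=
  (Real.hasDerivAt_exp s).ofReal_comp

lemma hasDerivAt_ofReal_exp_neg (s : ℝ) :
    HasDerivAt (fun s : ℝ => (Real.exp (-s) : ℂ)) (-(Real.exp (-s) : ℂ)) s := by
  have := ((hasDerivAt_neg s).exp).ofReal_comp
  simpa using this

/-- The solution of `u'' = u - γ` with `u(0) = u'(0) = 0`. It is
`u(s) = -∫₀ˢ sinh (s - r) γ(r) dr`, where the hyperbolic sine is split into exponentials to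
separate the variables. -/
lemma exists_particular_solution {γ : ℝ → ℂ} (hγ : Integrable γ) :
    ∃ u p : ℝ → ℂ, u 0 = 0 ∧ p 0 = 0 ∧ (∀ s, HasDerivAt u (p s) s) ∧
      ∀ s, 0 ≤ s → p s = - ∫ r in (0:ℝ)..s, (γ r - u r) := by
  have hint : ∀ φ : ℝ → ℂ, Continuous φ → ∀ a b,
      IntervalIntegrable (fun r => φ r * γ r) volume a b := fun φ hφ a b =>
    hγ.intervalIntegrable.continuousOn_mul hφ.continuousOn
  have hγi : ∀ a b, IntervalIntegrable γ volume a b := fun a b => hγ.intervalIntegrable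
  have c1 : Continuous fun s : ℝ => (Real.exp s : ℂ) := by fun_prop
  have c2 : Continuous fun s : ℝ => (Real.exp (-s) : ℂ) := by fun_prop
  obtain ⟨A, hA⟩ : ∃ A : ℝ → ℂ, ∀ s, A s = ∫ r in (0:ℝ)..s, (Real.exp (-r) : ℂ) * γ r :=
    ⟨_, fun _ => rfl⟩
  obtain ⟨B, hB⟩ : ∃ B : ℝ → ℂ, ∀ s, B s = ∫ r in (0:ℝ)..s, (Real.exp r : ℂ) * γ r :=
    ⟨_, fun _ => rfl⟩
  have A0 : A 0 = 0 := by simp [hA]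
  have B0 : B 0 = 0 := by simp [hB]
  have cA : Continuous A := by
    rw [show A = _ from funext hA]; exact intervalIntegral.continuous_primitive (hint _ c2) 0
  have cB : Continuous B := by
    rw [show B = _ from funext hB]; exact intervalIntegral.continuous_primitive (hint _ c1) 0
  have i1 : ∀ a b, IntervalIntegrable (fun r => (Real.exp r : ℂ) * A r) volume a b := fun a b =>
    (c1.mul cA).intervalIntegrable a b
  have i2 : ∀ a b, IntervalIntegrable (fun r => (Real.exp (-r) : ℂ) * B r) volume a b :=
    fun a b => (c2.mul cB).intervalIntegrable a b
  have hee : ∀ r : ℝ, (Real.exp r : ℂ) * (Real.exp (-r) : ℂ) = 1 := fun r => by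
    rw [← Complex.ofReal_mul, ← Real.exp_add]; simp
  have eA : ∀ s, 0 ≤ s → (Real.exp s : ℂ) * A s
      = (∫ r in (0:ℝ)..s, (Real.exp r : ℂ) * A r) + ∫ r in (0:ℝ)..s, γ r := by
    intro s hs
    have := integral_add_mul_of_primitive (F := fun s : ℝ => (Real.exp s : ℂ)) (G := A) hs
      (c1.intervalIntegrable 0 s) (hint _ c2 0 s)
      (fun t ht => eq_add_integral_of_hasDerivWithinAt_Icc
        (fun r _ => (hasDerivAt_ofReal_exp r).hasDerivWithinAt) c1.continuousOn ht)
      (fun t _ => by rw [A0, hA t, zero_add])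
    rw [A0, mul_zero, sub_zero] at this
    rw [← this, ← intervalIntegral.integral_add (i1 0 s) (hγi 0 s)]
    refine intervalIntegral.integral_congr fun r _ => ?_
    simp only [← mul_assoc, hee, one_mul]
  have eB : ∀ s, 0 ≤ s → (Real.exp (-s) : ℂ) * B s
      = -(∫ r in (0:ℝ)..s, (Real.exp (-r) : ℂ) * B r) + ∫ r in (0:ℝ)..s, γ r := by
    intro s hs
    have := integral_add_mul_of_primitive (F := fun s : ℝ => (Real.exp (-s) : ℂ)) (G := B) hs
      (c2.neg.intervalIntegrable 0 s) (hint _ c1 0 s)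
      (fun t ht => eq_add_integral_of_hasDerivWithinAt_Icc
        (fun r _ => (hasDerivAt_ofReal_exp_neg r).hasDerivWithinAt) c2.neg.continuousOn ht)
      (fun t _ => by rw [B0, hB t, zero_add])
    rw [B0, mul_zero, sub_zero] at this
    have i3 : IntervalIntegrable (fun r => -((Real.exp (-r) : ℂ) * B r)) volume 0 s := (i2 0 s).neg
    rw [← this, ← intervalIntegral.integral_neg, ← intervalIntegral.integral_add i3 (hγi 0 s)]
    refine intervalIntegral.integral_congr fun r _ => ?_
    simp only [← mul_assoc, mul_comm (Real.exp (-r) : ℂ) (Real.exp r : ℂ), hee, one_mul,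
      neg_mul, Pi.neg_apply]
  obtain ⟨p, hp⟩ : ∃ p : ℝ → ℂ, ∀ s, p s
      = -((Real.exp s : ℂ) * A s + (Real.exp (-s) : ℂ) * B s) / 2 := ⟨_, fun _ => rfl⟩
  have cp : Continuous p := by
    rw [show p = _ from funext hp]; exact ((c1.mul cA).add (c2.mul cB)).neg.div_const 2
  have hu : ∀ s, 0 ≤ s → ∫ r in (0:ℝ)..s, p r
      = -((Real.exp s : ℂ) * A s - (Real.exp (-s) : ℂ) * B s) / 2 := by
    intro s hs
    simp only [hp]
    rw [intervalIntegral.integral_div, intervalIntegral.integral_neg,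
      intervalIntegral.integral_add (i1 0 s) (i2 0 s), eA s hs, eB s hs]
    ring
  refine ⟨fun s => ∫ r in (0:ℝ)..s, p r, p, by simp, by simp [hp, A0, B0], fun s => ?_, ?_⟩
  · exact (cp.integral_hasStrictDerivAt 0 s).hasDerivAt
  · intro s hs
    have e : ∫ r in (0:ℝ)..s, (γ r - ∫ r in (0:ℝ)..r, p r)
        = ∫ r in (0:ℝ)..s, (γ r - -((Real.exp r : ℂ) * A r - (Real.exp (-r) : ℂ) * B r) / 2) := by
      refine intervalIntegral.integral_congr fun r hr => ?_
      rw [uIcc_of_le hs] at hr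
      simp only [hu r hr.1]
    have i3 : IntervalIntegrable
        (fun r => -((Real.exp r : ℂ) * A r - (Real.exp (-r) : ℂ) * B r) / 2) volume 0 s :=
      ((i1 0 s).sub (i2 0 s)).neg.div_const 2
    rw [e, intervalIntegral.integral_sub (hγi 0 s) i3, intervalIntegral.integral_div,
      intervalIntegral.integral_neg, intervalIntegral.integral_sub (i1 0 s) (i2 0 s), hp,
      eA s hs, eB s hs]
    ring

/-- Solution of the Dirichlet problem for `u'' = u - γ` on `[0, l]`, with the outgoing derivatives
expressed through the boundary values. -/
lemma exists_dirichlet_solution {γ : ℝ → ℂ} {l : ℝ} (hl : 0 < l)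
    (hγ : IntervalIntegrable γ volume 0 l) :
    ∃ κ₀ κ₁ : ℂ, ∀ α β : ℂ, ∃ u p : ℝ → ℂ, u 0 = α ∧ u l = β ∧
      (∀ s, HasDerivAt u (p s) s) ∧
      (∀ s ∈ Icc 0 l, p s = p 0 - ∫ r in (0:ℝ)..s, (γ r - u r)) ∧
      p 0 = (β - α * Real.cosh l) / Real.sinh l + κ₀ ∧
      p l = (β * Real.cosh l - α) / Real.sinh l + κ₁ := by
  have hγ' : Integrable ((Icc 0 l).indicator γ) := by
    rw [integrable_indicator_iff measurableSet_Icc]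
    exact (intervalIntegrable_iff_integrableOn_Icc_of_le hl.le).1 hγ
  obtain ⟨u₀, p₀, hu0, hp0, hd, hp⟩ := exists_particular_solution hγ'
  have hS : (Real.sinh l : ℂ) ≠ 0 := by
    exact_mod_cast (Real.sinh_pos_iff.2 hl).ne'
  have hCS : (Real.cosh l : ℂ) ^ 2 = 1 + (Real.sinh l : ℂ) ^ 2 := by
    have := Real.cosh_sq' l
    exact_mod_cast this
  refine ⟨-u₀ l / Real.sinh l, p₀ l - u₀ l * Real.cosh l / Real.sinh l, fun α β => ?_⟩
  obtain ⟨b, hb⟩ : ∃ b : ℂ, b = (β - α * Real.cosh l - u₀ l) / Real.sinh l := ⟨_, rfl⟩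
  have dC : ∀ s : ℝ, HasDerivAt (fun s : ℝ => (Real.cosh s : ℂ)) (Real.sinh s : ℂ) s :=
    fun s => (Real.hasDerivAt_cosh s).ofReal_comp
  have dS : ∀ s : ℝ, HasDerivAt (fun s : ℝ => (Real.sinh s : ℂ)) (Real.cosh s : ℂ) s :=
    fun s => (Real.hasDerivAt_sinh s).ofReal_comp
  have cu : Continuous u₀ := continuous_iff_continuousAt.2 fun s => (hd s).continuousAt
  have cS : Continuous fun s : ℝ => (Real.sinh s : ℂ) := by fun_prop
  have cC : Continuous fun s : ℝ => (Real.cosh s : ℂ) := by fun_prop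
  refine ⟨fun s => α * Real.cosh s + b * Real.sinh s + u₀ s,
    fun s => α * Real.sinh s + b * Real.cosh s + p₀ s, by simp [hu0], ?_, fun s => ?_, ?_, ?_, ?_⟩
  · simp only [hb]; field_simp; ring
  · exact (((dC s).const_mul α).add ((dS s).const_mul b)).add (hd s)
  · intro s hs
    have h1 := eq_add_integral_of_hasDerivWithinAt_Icc (l := l)
      (F := fun s : ℝ => α * (Real.sinh s : ℂ) + b * Real.cosh s)
      (f := fun s : ℝ => α * (Real.cosh s : ℂ) + b * Real.sinh s)
      (fun r _ => (((dS r).const_mul α).add ((dC r).const_mul b)).hasDerivWithinAt)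
      (by fun_prop) hs
    have hsub : uIcc 0 s ⊆ uIcc 0 l := by
      rw [uIcc_of_le hl.le, uIcc_of_le hs.1]; exact Icc_subset_Icc_right hs.2
    have i1 : IntervalIntegrable (fun r => γ r - u₀ r) volume 0 s :=
      (hγ.mono_set hsub).sub (cu.intervalIntegrable 0 s)
    have i2 : IntervalIntegrable (fun r : ℝ => α * (Real.cosh r : ℂ) + b * Real.sinh r)
        volume 0 s :=
      Continuous.intervalIntegrable (by fun_prop) 0 s
    have h2 : p₀ s = - ∫ r in (0:ℝ)..s, (γ r - u₀ r) := by
      rw [hp s hs.1]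
      congr 1
      refine intervalIntegral.integral_congr fun r hr => ?_
      rw [uIcc_of_le hs.1] at hr
      simp only [indicator_of_mem (show r ∈ Icc 0 l from ⟨hr.1, hr.2.trans hs.2⟩)]
    have h3 : ∫ r in (0:ℝ)..s, (γ r - (α * Real.cosh r + b * Real.sinh r + u₀ r))
        = (∫ r in (0:ℝ)..s, (γ r - u₀ r))
          - ∫ r in (0:ℝ)..s, (α * (Real.cosh r : ℂ) + b * Real.sinh r) := by
      rw [← intervalIntegral.integral_sub i1 i2]
      exact intervalIntegral.integral_congr fun r _ => by ring
    simp only [h3, h1, h2, hp0]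
    ring
  · simp only [hp0, hb]; simp; ring
  · simp only [hb]; field_simp; linear_combination -α * hCS

namespace MetricGraph

variable {V E : Type*} [Fintype E] {G : MetricGraph V E}

/-! ### The vertex conditions -/

open Classical in
/-- The map from the vertex values `c` of an edgewise solution of `u'' = u` to the sums of its
outgoing derivatives at the vertices: minus the Dirichlet-to-Neumann map. -/
noncomputable def vertexMap (G : MetricGraph V E) : (V → ℂ) →ₗ[ℂ] (V → ℂ) where
  toFun c v := ∑ e, ((if G.src e = v then
      (c (G.tgt e) - c (G.src e) * Real.cosh (G.length e)) / Real.sinh (G.length e) else 0)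
    + (if G.tgt e = v then
      -((c (G.tgt e) * Real.cosh (G.length e) - c (G.src e)) / Real.sinh (G.length e)) else 0))
  map_add' c d := by
    funext v
    rw [Pi.add_apply, ← Finset.sum_add_distrib]
    refine Finset.sum_congr rfl fun e _ => ?_
    simp only [Pi.add_apply]
    split_ifs <;> ring
  map_smul' a c := by
    funext v
    simp only [RingHom.id_apply, Pi.smul_apply, smul_eq_mul, Finset.mul_sum]
    refine Finset.sum_congr rfl fun e _ => ?_
    split_ifs <;> ring

/-- The quadratic form of a single edge in `vertexMap` is negative definite. -/
lemma re_edge_form_le (a b : ℂ) {l : ℝ} (hl : 0 < l) :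
    (conj a * ((b - a * Real.cosh l) / Real.sinh l)
      + conj b * -((b * Real.cosh l - a) / Real.sinh l)).re
      ≤ -((Real.cosh l - 1) / Real.sinh l * (‖a‖ ^ 2 + ‖b‖ ^ 2)) := by
  have hS := Real.sinh_pos_iff.2 hl
  have e : conj a * ((b - a * Real.cosh l) / Real.sinh l)
      + conj b * -((b * Real.cosh l - a) / Real.sinh l)
      = (conj a * (b - a * Real.cosh l) - conj b * (b * Real.cosh l - a)) / (Real.sinh l : ℝ) := by
    ring
  rw [e, Complex.div_ofReal_re, div_mul_eq_mul_div, ← neg_div]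
  refine div_le_div_of_nonneg_right ?_ hS.le
  rw [← Complex.normSq_eq_norm_sq, ← Complex.normSq_eq_norm_sq, Complex.normSq_apply,
    Complex.normSq_apply]
  simp only [Complex.sub_re, Complex.mul_re, Complex.conj_re, Complex.conj_im, Complex.ofReal_re,
    Complex.ofReal_im, Complex.sub_im, Complex.mul_im]
  nlinarith [sq_nonneg (a.re - b.re), sq_nonneg (a.im - b.im)]

/-- The sum of the edge forms is negative definite, because every vertex is an end of an edge. -/
lemma vertexMap_injective [Nonempty E] [Finite V] (hG : G.Connected) :
    Function.Injective G.vertexMap := by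
  classical
  have := Fintype.ofFinite V
  rw [← LinearMap.ker_eq_bot, LinearMap.ker_eq_bot']
  intro c hc
  have h0 : ∑ v, conj (c v) * G.vertexMap c v = 0 := by simp [hc]
  simp only [vertexMap, LinearMap.coe_mk, AddHom.coe_mk, Finset.mul_sum] at h0
  rw [Finset.sum_comm] at h0
  simp only [mul_add, mul_ite, mul_zero, Finset.sum_add_distrib, Finset.sum_ite_eq,
    Finset.mem_univ, if_true] at h0
  rw [← Finset.sum_add_distrib] at h0
  have h1 := congrArg Complex.re h0
  rw [Complex.re_sum, Complex.zero_re] at h1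
  have hpos : ∀ e, 0 < (Real.cosh (G.length e) - 1) / Real.sinh (G.length e) := fun e =>
    div_pos (sub_pos.2 (Real.one_lt_cosh.2 (G.length_pos e).ne'))
      (Real.sinh_pos_iff.2 (G.length_pos e))
  have h2 : ∀ e ∈ Finset.univ, (conj (c (G.src e)) * ((c (G.tgt e) - c (G.src e)
      * Real.cosh (G.length e)) / Real.sinh (G.length e)) + conj (c (G.tgt e)) *
      -((c (G.tgt e) * Real.cosh (G.length e) - c (G.src e)) / Real.sinh (G.length e))).re ≤ 0 :=
    fun e _ => (re_edge_form_le _ _ (G.length_pos e)).trans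
      (neg_nonpos.2 (mul_nonneg (hpos e).le (by positivity)))
  rw [Finset.sum_eq_zero_iff_of_nonpos h2] at h1
  have h3 : ∀ e, ‖c (G.src e)‖ ^ 2 + ‖c (G.tgt e)‖ ^ 2 = 0 := by
    intro e
    have h4 := re_edge_form_le (c (G.src e)) (c (G.tgt e)) (G.length_pos e)
    rw [h1 e (Finset.mem_univ e)] at h4
    have h5 : 0 ≤ ‖c (G.src e)‖ ^ 2 + ‖c (G.tgt e)‖ ^ 2 := by positivity
    nlinarith [hpos e]
  funext v
  obtain ⟨e, rfl | rfl⟩ := exists_edgePoint_eq_of_connected hG v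
  · have := h3 e
    have h6 : ‖c (G.src e)‖ ^ 2 = 0 := by
      nlinarith [sq_nonneg ‖c (G.src e)‖, sq_nonneg ‖c (G.tgt e)‖]
    simpa using h6
  · have := h3 e
    have h6 : ‖c (G.tgt e)‖ ^ 2 = 0 := by
      nlinarith [sq_nonneg ‖c (G.src e)‖, sq_nonneg ‖c (G.tgt e)‖]
    simpa using h6

/-- Solvability of `-u'' + u = g` with Kirchhoff conditions: the vertex values of `u` are found by
inverting `vertexMap`, and `u` is the solution of the Dirichlet problem on each edge. -/
lemma exists_isKirchhoff [Nonempty E] [Finite V] (hG : G.Connected) (g : G.L2) :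
    ∃ u p, G.IsKirchhoff u p (fun x => g x - u x) := by
  classical
  choose κ₀ κ₁ hκ using fun e => exists_dirichlet_solution (G.length_pos e)
    (G.integrable_edge (integrable_L2 g) e)
  have hsurj : Function.Surjective G.vertexMap :=
    LinearMap.injective_iff_surjective.1 (vertexMap_injective hG)
  obtain ⟨c, hc⟩ := hsurj fun v => -∑ e, ((if G.src e = v then κ₀ e else 0)
    + (if G.tgt e = v then -κ₁ e else 0))
  choose u p hu0 hul hd hp hp0 hpl using fun e => hκ e (c (G.src e)) (c (G.tgt e))
  have hglue : ∀ e, ∀ s ∈ Icc 0 (G.length e), G.glue c u (G.edgePoint e s) = u e s :=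
    fun e s hs => G.glue_edgePoint (hu0 e) (hul e) hs
  refine ⟨G.glue c u, p, G.continuous_glue hu0 hul
    (fun e s _ => (hd e s).continuousAt.continuousWithinAt), fun e s hs => ?_, fun e s hs => ?_,
    fun v => ?_⟩
  · exact (hd e s).hasDerivWithinAt.congr (hglue e) (hglue e s hs)
  · rw [hp e s hs]
    congr 1
    refine intervalIntegral.integral_congr fun r hr => ?_
    rw [uIcc_of_le hs.1] at hr
    simp only [hglue e r ⟨hr.1, hr.2.trans hs.2⟩]
  · have hv := congrFun hc v
    simp only [vertexMap, LinearMap.coe_mk, AddHom.coe_mk] at hv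
    rw [eq_neg_iff_add_eq_zero, ← Finset.sum_add_distrib] at hv
    refine Eq.trans (Finset.sum_congr rfl fun e _ => ?_) hv
    rw [hp0 e, hpl e]
    split_ifs <;> ring

/-! ### The resolvent of the Kirchhoff Laplacian -/

instance [Finite V] : CompactSpace G.Point := G.compactSpace

/-- The class in `L²` of a continuous function. -/
noncomputable abbrev toL2 [Finite V] (G : MetricGraph V E) : C(G.Point, ℂ) →L[ℂ] G.L2 :=
  ContinuousMap.toLp 2 G.measure ℂ

lemma coeFn_toL2 [Finite V] (u : C(G.Point, ℂ)) : (G.toL2 u : G.Point → ℂ) =ᵐ[G.measure] u :=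
  ContinuousMap.coeFn_toLp G.measure u

lemma norm_sq_eq_energy {f : G.L2} {u : G.Point → ℂ} (hu : (f : G.Point → ℂ) =ᵐ[G.measure] u) :
    ‖f‖ ^ 2 = G.energy fun e s => u (G.edgePoint e s) := by
  have h := inner_eq_sum hu f
  rw [inner_self_eq_norm_sq_to_K] at h
  have h2 := sum_conj_mul_eq_energy (G := G) fun e s => u (G.edgePoint e s)
  have h3 : ∑ e, ∫ s in (0:ℝ)..G.length e, conj (u (G.edgePoint e s)) * f (G.edgePoint e s)
      = ∑ e, ∫ s in (0:ℝ)..G.length e, conj (u (G.edgePoint e s)) * u (G.edgePoint e s) := by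
    refine Finset.sum_congr rfl fun e _ => intervalIntegral.integral_congr_ae ?_
    filter_upwards [ae_uIoc_edge hu (right_mem_Icc.2 (G.length_pos e).le)] with s hs hs'
    rw [hs hs']
  rw [h3, h2] at h
  exact Complex.ofReal_injective (by rw [Complex.ofReal_pow]; exact h)

/-- Two continuous functions on the graph that agree almost everywhere are equal: there are no
isolated vertices. -/
lemma eq_of_ae_eq [Nonempty E] (hG : G.Connected) {u u' : G.Point → ℂ} (hu : Continuous u)
    (hu' : Continuous u') (h : u =ᵐ[G.measure] u') : u = u' := by
  funext x
  obtain ⟨e, s, hs, rfl⟩ := exists_edgePoint_eq hG x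
  have h1 : (fun s => u (G.edgePoint e s)) =ᵐ[volume.restrict (Icc 0 (G.length e))]
      fun s => u' (G.edgePoint e s) := G.ae_edge h e
  exact Measure.eqOn_Icc_of_ae_eq volume (G.length_pos e).ne h1
    (hu.comp (G.continuous_edgePoint e)).continuousOn
    (hu'.comp (G.continuous_edgePoint e)).continuousOn hs

lemma IsKirchhoff.integrable_sub [Finite V] {u : G.Point → ℂ} (hu : Continuous u) (g : G.L2) :
    Integrable (fun x => g x - u x) G.measure :=
  (integrable_L2 g).sub (integrable_of_continuous hu)

lemma IsKirchhoff.unique [Nonempty E] [Finite V] (hG : G.Connected) {g : G.L2}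
    {u u' : G.Point → ℂ} {p p' : E → ℝ → ℂ} (K : G.IsKirchhoff u p fun x => g x - u x)
    (K' : G.IsKirchhoff u' p' fun x => g x - u' x) : u = u' := by
  have K2 := K.sub K' (integrable_sub K.continuous g) (integrable_sub K'.continuous g)
  set f : G.L2 := G.toL2 ⟨fun x => u x - u' x, K2.continuous⟩ with hf
  have hfu : (f : G.Point → ℂ) =ᵐ[G.measure] fun x => u x - u' x := coeFn_toL2 _
  have K3 : G.IsKirchhoff (fun x => u x - u' x) (fun e s => p e s - p' e s) (-f : G.L2) := by
    refine K2.congr_ae ?_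
    filter_upwards [hfu, Lp.coeFn_neg f] with x h1 h2
    rw [h2, Pi.neg_apply, h1]; ring
  have h1 := kirchhoffLaplacian_inner_eq_energy hfu K3
  rw [inner_neg_right, inner_self_eq_norm_sq_to_K] at h1
  have h2 : -‖f‖ ^ 2 = G.energy fun e s => p e s - p' e s  :=
    Complex.ofReal_injective (by rw [Complex.ofReal_neg, Complex.ofReal_pow]; exact h1)
  have h3 : f = 0 := by
    have := energy_nonneg (G := G) fun e s => p e s - p' e s
    rw [← norm_eq_zero]
    nlinarith [norm_nonneg f]
  refine eq_of_ae_eq hG K.continuous K'.continuous ?_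
  rw [h3] at hfu
  filter_upwards [hfu, Lp.coeFn_zero ℂ 2 G.measure] with x h4 h5
  rw [h5] at h4
  exact sub_eq_zero.1 h4.symm

section

variable [Nonempty E] [Finite V] (hG : G.Connected)

lemma exists_resolvent (hG : G.Connected) (g : G.L2) :
    ∃ u : C(G.Point, ℂ), ∃ p, G.IsKirchhoff u p fun x => g x - u x := by
  obtain ⟨u, p, K⟩ := exists_isKirchhoff hG g
  exact ⟨⟨u, K.continuous⟩, p, K⟩

/-- The continuous solution `u` of `-u'' + u = g` with Kirchhoff conditions. -/
noncomputable def resolventFun (g : G.L2) : C(G.Point, ℂ) := (exists_resolvent hG g).choose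

/-- The derivative of `resolventFun` along the edges. -/
noncomputable def resolventDeriv (g : G.L2) : E → ℝ → ℂ :=
  (exists_resolvent hG g).choose_spec.choose

lemma isKirchhoff_resolventFun (g : G.L2) : G.IsKirchhoff (resolventFun hG g) (resolventDeriv hG g)
    fun x => g x - resolventFun hG g x := (exists_resolvent hG g).choose_spec.choose_spec

variable {hG} in
lemma eq_resolventFun {g : G.L2} {u : G.Point → ℂ} {p : E → ℝ → ℂ}
    (K : G.IsKirchhoff u p fun x => g x - u x) : u = resolventFun hG g :=
  K.unique hG (isKirchhoff_resolventFun hG g)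

lemma resolventFun_sub (g g' : G.L2) :
    resolventFun hG (g - g') = resolventFun hG g - resolventFun hG g' := by
  have K := isKirchhoff_resolventFun hG g
  have K' := isKirchhoff_resolventFun hG g'
  refine (ContinuousMap.ext fun x => congrFun (eq_resolventFun (hG := hG) ((K.sub K'
    (IsKirchhoff.integrable_sub K.continuous g)
    (IsKirchhoff.integrable_sub K'.continuous g')).congr_ae ?_)) x).symm
  filter_upwards [Lp.coeFn_sub g g'] with x hx
  rw [hx, Pi.sub_apply]
  ring

lemma resolventFun_smul (c : ℂ) (g : G.L2) :
    resolventFun hG (c • g) = c • resolventFun hG g := by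
  have K := isKirchhoff_resolventFun hG g
  refine (ContinuousMap.ext fun x =>
    congrFun (eq_resolventFun (hG := hG) ((K.smul c).congr_ae ?_)) x).symm
  filter_upwards [Lp.coeFn_smul c g] with x hx
  rw [hx, Pi.smul_apply, smul_eq_mul]
  ring

lemma resolventFun_add (g g' : G.L2) :
    resolventFun hG (g + g') = resolventFun hG g + resolventFun hG g' := by
  have := resolventFun_sub hG (g + g') g'
  rw [add_sub_cancel_right] at this
  rw [this, sub_add_cancel]

lemma resolventFun_star (g : G.L2) (x : G.Point) :
    resolventFun hG (star g) x = conj (resolventFun hG g x) := by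
  have K := (isKirchhoff_resolventFun hG g).conjugate
  refine (congrFun (eq_resolventFun (hG := hG) (K.congr_ae ?_)) x).symm
  filter_upwards [Lp.coeFn_star g] with x hx
  rw [hx, Pi.star_apply, map_sub]
  rfl

lemma kirchhoffLaplacian_resolventFun (g : G.L2) :
    G.KirchhoffLaplacian (G.toL2 (resolventFun hG g)) (g - G.toL2 (resolventFun hG g)) := by
  refine kirchhoffLaplacian_iff.2 ⟨_, _, coeFn_toL2 _,
    (isKirchhoff_resolventFun hG g).congr_ae ?_⟩
  filter_upwards [coeFn_toL2 (resolventFun hG g),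
    Lp.coeFn_sub g (G.toL2 (resolventFun hG g))] with x h1 h2
  rw [h2, Pi.sub_apply, h1]

/-- The identity `⟨u, g⟩ = ‖u'‖² + ‖u‖²` for the solution `u` of `-u'' + u = g`. -/
lemma inner_resolventFun (g : G.L2) : inner ℂ (G.toL2 (resolventFun hG g)) g
    = ((G.energy (resolventDeriv hG g) + ‖G.toL2 (resolventFun hG g)‖ ^ 2 : ℝ) : ℂ) := by
  have K : G.IsKirchhoff (resolventFun hG g) (resolventDeriv hG g)
      (g - G.toL2 (resolventFun hG g) : G.L2) := by
    refine (isKirchhoff_resolventFun hG g).congr_ae ?_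
    filter_upwards [coeFn_toL2 (resolventFun hG g),
      Lp.coeFn_sub g (G.toL2 (resolventFun hG g))] with x h1 h2
    rw [h2, Pi.sub_apply, h1]
  have h := kirchhoffLaplacian_inner_eq_energy (coeFn_toL2 _) K
  rw [inner_sub_right, inner_self_eq_norm_sq_to_K, sub_eq_iff_eq_add] at h
  rw [h]
  push_cast
  rfl

lemma norm_toL2_resolventFun_le (g : G.L2) : ‖G.toL2 (resolventFun hG g)‖ ≤ ‖g‖ := by
  have h1 := inner_resolventFun hG g
  have h2 := norm_inner_le_norm (𝕜 := ℂ) (G.toL2 (resolventFun hG g)) g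
  have h0 := energy_nonneg (G := G) (resolventDeriv hG g)
  rw [h1, Complex.norm_real, Real.norm_of_nonneg (by positivity)] at h2
  rcases (norm_nonneg (G.toL2 (resolventFun hG g))).eq_or_lt with h | h
  · rw [← h]; exact norm_nonneg g
  · nlinarith

lemma energy_resolventDeriv_le (g : G.L2) : G.energy (resolventDeriv hG g) ≤ ‖g‖ ^ 2 := by
  have h1 := inner_resolventFun hG g
  have h2 := norm_inner_le_norm (𝕜 := ℂ) (G.toL2 (resolventFun hG g)) g
  have h0 := energy_nonneg (G := G) (resolventDeriv hG g)
  rw [h1, Complex.norm_real, Real.norm_of_nonneg (by positivity)] at h2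
  have h3 := norm_toL2_resolventFun_le hG g
  nlinarith [norm_nonneg (G.toL2 (resolventFun hG g)), norm_nonneg g]

/-- The resolvent `(1 + H₀)⁻¹` as a bounded operator on `L²`. -/
noncomputable def resolvent : G.L2 →L[ℂ] G.L2 :=
  LinearMap.mkContinuous
    { toFun := fun g => G.toL2 (resolventFun hG g)
      map_add' := fun g g' => by rw [resolventFun_add, map_add]
      map_smul' := fun c g => by rw [resolventFun_smul, map_smul, RingHom.id_apply] } 1
    fun g => by rw [one_mul]; exact norm_toL2_resolventFun_le hG g

lemma resolvent_apply (g : G.L2) : resolvent hG g = G.toL2 (resolventFun hG g) := rfl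

lemma coeFn_resolvent (g : G.L2) :
    (resolvent hG g : G.Point → ℂ) =ᵐ[G.measure] resolventFun hG g := coeFn_toL2 _

lemma norm_resolvent_le : ‖resolvent hG‖ ≤ 1 := LinearMap.mkContinuous_norm_le _ zero_le_one _

lemma inner_resolvent_left (f g : G.L2) :
    inner ℂ (resolvent hG f) g = inner ℂ f (resolvent hG g) := by
  have h := kirchhoffLaplacian_inner_symm (kirchhoffLaplacian_resolventFun hG f)
    (kirchhoffLaplacian_resolventFun hG g)
  rw [inner_sub_right, inner_sub_left] at h
  exact sub_left_injective h

lemma isSelfAdjoint_resolvent : IsSelfAdjoint (resolvent hG) :=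
  ContinuousLinearMap.isSelfAdjoint_iff_isSymmetric.2 fun f g => inner_resolvent_left hG f g

lemma spectrum_resolvent_subset : spectrum ℝ (resolvent hG) ⊆ Icc 0 1 := by
  have hpos : 0 ≤ resolvent hG := by
    rw [ContinuousLinearMap.nonneg_iff_isPositive, ContinuousLinearMap.isPositive_def']
    refine ⟨isSelfAdjoint_resolvent hG, fun g => ?_⟩
    rw [ContinuousLinearMap.reApplyInnerSelf_apply, resolvent_apply, inner_resolventFun,
      RCLike.re_eq_complex_re, Complex.ofReal_re]
    have := energy_nonneg (G := G) (resolventDeriv hG g)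
    positivity
  intro μ hμ
  refine ⟨spectrum_nonneg_of_nonneg hpos hμ, ?_⟩
  have h1 := spectrum.norm_le_norm_mul_of_mem hμ
  have h2 : ‖(1 : G.L2 →L[ℂ] G.L2)‖ ≤ 1 := ContinuousLinearMap.norm_id_le
  have h3 := norm_resolvent_le hG
  have h4 : ‖μ‖ ≤ 1 := h1.trans (mul_le_one₀ h3 (norm_nonneg _) h2)
  exact (le_abs_self μ).trans h4

/-- `H₀ f = g` if and only if `f = (1 + H₀)⁻¹ (f + g)`. -/
lemma kirchhoffLaplacian_iff_resolvent (f g : G.L2) :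
    G.KirchhoffLaplacian f g ↔ f = resolvent hG (f + g) := by
  constructor
  · intro h
    obtain ⟨u, p, hu, K⟩ := kirchhoffLaplacian_iff.1 h
    have K' : G.IsKirchhoff u p fun x => (f + g : G.L2) x - u x := by
      refine K.congr_ae ?_
      filter_upwards [hu, Lp.coeFn_add f g] with x h1 h2
      rw [h2, Pi.add_apply, h1]; ring
    have h1 := eq_resolventFun (hG := hG) K'
    refine Lp.ext (hu.trans ?_)
    rw [h1]
    exact (coeFn_resolvent hG _).symm
  · intro h
    have h1 := kirchhoffLaplacian_resolventFun hG (f + g)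
    rw [← resolvent_apply, ← h, add_sub_cancel_left] at h1
    exact h1

/-- If the solution of `-u'' + u = g` vanishes, then so do the primitives of `g` on the edges. -/
lemma resolvent_injective : Function.Injective (resolvent hG) := by
  rw [injective_iff_map_eq_zero]
  intro g hg
  have hu : ⇑(resolventFun hG g) = fun _ => 0 := by
    refine eq_of_ae_eq hG (resolventFun hG g).continuous continuous_const ?_
    have h1 := coeFn_resolvent hG g
    rw [hg] at h1
    exact h1.symm.trans (Lp.coeFn_zero ℂ 2 G.measure)
  have K := isKirchhoff_resolventFun hG g
  rw [hu] at K
  have hp : ∀ e, ∀ s ∈ Icc 0 (G.length e), resolventDeriv hG g e s = 0 := fun e s hs =>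
    (uniqueDiffOn_Icc (G.length_pos e) s hs).eq_deriv _ (K.hasDeriv e s hs)
      (hasDerivWithinAt_const _ _ _)
  have hint : ∀ e, ∀ s ∈ Icc 0 (G.length e), ∫ r in (0:ℝ)..s, g (G.edgePoint e r) = 0 := by
    intro e s hs
    have := K.deriv_eq e s hs
    rw [hp e s hs, hp e 0 ⟨le_rfl, (G.length_pos e).le⟩] at this
    simpa using this
  have hae : ∀ e, ∀ᵐ s : ℝ, s ∈ uIoc 0 (G.length e) → g (G.edgePoint e s) = 0 := by
    intro e
    have h1 := (G.integrable_edge (integrable_L2 g) e).ae_hasDerivAt_integral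
    have h2 : ∀ᵐ s : ℝ, s ≠ G.length e := by
      simp [ae_iff]
    filter_upwards [h1, h2] with s hs hsl hs'
    have h3 := hs (uIoc_subset_uIcc hs') 0 left_mem_uIcc
    rw [uIoc_of_le (G.length_pos e).le] at hs'
    have hs2 : s < G.length e := lt_of_le_of_ne hs'.2 hsl
    refine (h3.congr_of_eventuallyEq ?_).unique (hasDerivAt_const s (0:ℂ))
    filter_upwards [Icc_mem_nhds hs'.1 hs2] with r hr
    exact (hint e r hr).symm
  have h4 := inner_eq_sum (f := g) (EventuallyEq.refl _ _) g
  rw [Finset.sum_eq_zero fun e _ => ?_] at h4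
  · exact inner_self_eq_zero.1 h4
  · refine intervalIntegral.integral_zero_ae ?_
    filter_upwards [hae e] with s hs hs'
    rw [hs hs', mul_zero]

end

end MetricGraph

/-! ### Conjugations of a Hilbert space -/

/-- A conjugation of a complex Hilbert space: an antiunitary involution. -/
structure IsConjugation {H : Type*} [NormedAddCommGroup H] [InnerProductSpace ℂ H] (J : H → H) :
    Prop where
  add : ∀ f g, J (f + g) = J f + J g
  smul : ∀ (c : ℂ) f, J (c • f) = conj c • J f
  involutive : Function.Involutive J
  inner : ∀ f g, inner ℂ (J f) (J g) = conj (inner ℂ f g)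

namespace IsConjugation

variable {H : Type*} [NormedAddCommGroup H] [InnerProductSpace ℂ H] {J : H → H}

lemma norm_map (hJ : IsConjugation J) (f : H) : ‖J f‖ = ‖f‖ := by
  have h := hJ.inner f f
  rw [inner_self_eq_norm_sq_to_K, inner_self_eq_norm_sq_to_K, map_pow, RCLike.conj_ofReal] at h
  have h2 : ‖J f‖ ^ 2 = ‖f‖ ^ 2 :=
    Complex.ofReal_injective (by rw [Complex.ofReal_pow, Complex.ofReal_pow]; exact h)
  exact (sq_eq_sq₀ (norm_nonneg _) (norm_nonneg _)).1 h2

lemma continuous (hJ : IsConjugation J) : Continuous J := by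
  have hs : ∀ f g : H, J f - J g = J (f - g) := fun f g => by
    rw [sub_eq_iff_eq_add, ← hJ.add, sub_add_cancel]
  refine (Isometry.of_dist_eq fun f g => ?_).continuous
  rw [dist_eq_norm, dist_eq_norm, hs, hJ.norm_map]

variable [CompleteSpace H]

instance : StarModule ℝ (H →L[ℂ] H) where
  star_smul r a := by
    have h : conj (algebraMap ℝ ℂ r) = algebraMap ℝ ℂ r := Complex.conj_ofReal r
    rw [← algebraMap_smul ℂ r a, star_smul, RCLike.star_def, h, algebraMap_smul, star_trivial r]

/-- The bounded operators that commute with a conjugation form a real star algebra. -/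
noncomputable def commutant (hJ : IsConjugation J) : StarSubalgebra ℝ (H →L[ℂ] H) where
  carrier := {a | ∀ f, a (J f) = J (a f)}
  mul_mem' {a b} ha hb f := by
    rw [mul_apply_eq_comp, mul_apply_eq_comp, hb, ha]
  add_mem' {a b} ha hb f := by
    rw [add_apply, add_apply, ha, hb, hJ.add]
  algebraMap_mem' r f := by
    simp only [Algebra.algebraMap_eq_smul_one, smul_apply, one_apply_eq_self]
    rw [← Complex.coe_smul, ← Complex.coe_smul, hJ.smul, Complex.conj_ofReal]
  star_mem' {a} ha f := by
    refine ext_inner_right ℂ fun g => ?_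
    rw [ContinuousLinearMap.star_eq_adjoint, ContinuousLinearMap.adjoint_inner_left,
      ← hJ.involutive (a g), hJ.inner, ← ha, ← ContinuousLinearMap.adjoint_inner_left,
      ← hJ.inner, hJ.involutive]

lemma mem_commutant (hJ : IsConjugation J) {a : H →L[ℂ] H} :
    a ∈ hJ.commutant ↔ ∀ f, a (J f) = J (a f) := Iff.rfl

lemma isClosed_commutant (hJ : IsConjugation J) :
    IsClosed (hJ.commutant : Set (H →L[ℂ] H)) := by
  have : (hJ.commutant : Set (H →L[ℂ] H)) = ⋂ f, {a | a (J f) = J (a f)} := by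
    ext a
    simp [mem_commutant]
  rw [this]
  exact isClosed_iInter fun f => isClosed_eq (by fun_prop) (hJ.continuous.comp (by fun_prop))

lemma heatOpDiv_apply (hJ : IsConjugation J) {R : H →L[ℂ] H} (hR : ∀ f, R (J f) = J (R f)) (t : ℝ)
    (f : H) : heatOpDiv R t (J f) = J (heatOpDiv R t f) := by
  have := hJ.isClosed_commutant
  exact hJ.mem_commutant.1 (cfc_mem (𝕜' := ℝ) (s := hJ.commutant) (heatSymbolDiv t)
    (hJ.mem_commutant.2 hR)) f

end IsConjugation

namespace MetricGraph

variable {V E : Type*} [Fintype E] {G : MetricGraph V E}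

/-! ### Complex conjugation on `L²` -/

lemma star_add_L2 (f g : G.L2) : star (f + g) = star f + star g := by
  refine Lp.ext ?_
  filter_upwards [Lp.coeFn_star (f + g), Lp.coeFn_add f g, Lp.coeFn_add (star f) (star g),
    Lp.coeFn_star f, Lp.coeFn_star g] with x h1 h2 h3 h4 h5
  simp only [h1, h3, Pi.star_apply, Pi.add_apply, h2, h4, h5, star_add]

lemma star_smul_L2 (c : ℂ) (f : G.L2) : star (c • f) = conj c • star f := by
  refine Lp.ext ?_
  filter_upwards [Lp.coeFn_star (c • f), Lp.coeFn_smul c f, Lp.coeFn_smul (conj c) (star f),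
    Lp.coeFn_star f] with x h1 h2 h3 h4
  simp only [h1, h3, Pi.star_apply, Pi.smul_apply, h2, h4, smul_eq_mul, star_mul', RCLike.star_def]

lemma inner_star_star (f g : G.L2) : inner ℂ (star f) (star g) = conj (inner ℂ f g) := by
  rw [L2.inner_def, L2.inner_def, ← integral_conj]
  refine integral_congr_ae ?_
  filter_upwards [Lp.coeFn_star f, Lp.coeFn_star g] with x h1 h2
  simp only [h1, h2, Pi.star_apply, RCLike.inner_apply, map_mul, RCLike.star_def]

lemma isConjugation_star : IsConjugation (star : G.L2 → G.L2) :=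
  ⟨star_add_L2, star_smul_L2, star_involutive, inner_star_star⟩

section

variable [Nonempty E] [Finite V] (hG : G.Connected)

/-! ### The heat kernel -/

/-- The functions in the range of the resolvent are Hölder continuous with exponent `1 / 2`, because
their derivatives are in `L²`. -/
lemma norm_resolventFun_sub_le (g : G.L2) (e : E) {s t : ℝ} (hs : s ∈ Icc 0 (G.length e))
    (ht : t ∈ Icc 0 (G.length e)) :
    ‖resolventFun hG g (G.edgePoint e t) - resolventFun hG g (G.edgePoint e s)‖
      ≤ √|t - s| * ‖g‖ := by
  wlog hst : s ≤ t generalizing s t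
  · rw [norm_sub_rev, abs_sub_comm]
    exact this ht hs (le_of_not_ge hst)
  have K := isKirchhoff_resolventFun hG g
  have hint := IsKirchhoff.integrable_sub (resolventFun hG g).continuous g
  have hc := K.continuousOn_deriv hint e
  have hsub : Icc s t ⊆ Icc 0 (G.length e) := Icc_subset_Icc hs.1 ht.2
  have hi : ∀ a ∈ Icc 0 (G.length e), IntervalIntegrable (resolventDeriv hG g e) volume 0 a :=
    fun a ha => (hc.mono (by
      rw [uIcc_of_le ha.1]; exact Icc_subset_Icc_right ha.2)).intervalIntegrable
  rw [K.eq_add_integral hint e ht, K.eq_add_integral hint e hs, add_sub_add_left_eq_sub,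
    intervalIntegral.integral_interval_sub_left (hi t ht) (hi s hs)]
  refine (norm_integral_le_sqrt_mul hst (hc.mono hsub)).trans ?_
  rw [Real.sqrt_mul (sub_nonneg.2 hst), abs_of_nonneg (sub_nonneg.2 hst)]
  gcongr
  refine Real.sqrt_le_iff.2 ⟨norm_nonneg g, ?_⟩
  refine le_trans ?_ ((integral_norm_sq_le_energy _ e).trans (energy_resolventDeriv_le hG g))
  refine intervalIntegral.integral_mono_interval hs.1 hst ht.2
    (Eventually.of_forall fun _ => by positivity) ?_
  exact ((hc.norm.pow 2).mono (by rw [uIcc_of_le (G.length_pos e).le])).intervalIntegrable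

/-- Point evaluation after the resolvent is bounded on `L²`: compare the value at a point with the
mean over an edge that contains it. -/
lemma exists_norm_resolventFun_apply_le (x : G.Point) :
    ∃ C, ∀ g : G.L2, ‖resolventFun hG g x‖ ≤ C * ‖g‖ := by
  obtain ⟨e, s, hs, rfl⟩ := exists_edgePoint_eq hG x
  set l := G.length e with hl
  have hl0 : 0 < l := G.length_pos e
  refine ⟨√((2 + 2 * l ^ 2) / l), fun g => ?_⟩
  obtain ⟨u, hu⟩ : ∃ u : ℝ → ℂ, u = fun r => resolventFun hG g (G.edgePoint e r) := ⟨_, rfl⟩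
  have cu : Continuous u := by
    rw [hu]; exact (resolventFun hG g).continuous.comp (G.continuous_edgePoint e)
  have h1 : ∀ r ∈ Icc 0 l, ‖u s‖ ^ 2 ≤ 2 * ‖u r‖ ^ 2 + 2 * (l * ‖g‖ ^ 2) := by
    intro r hr
    have h2 := norm_resolventFun_sub_le hG g e hr hs
    have h3 : |s - r| ≤ l := abs_le.2 ⟨by linarith [hs.1, hr.2], by linarith [hs.2, hr.1]⟩
    have h4 : ‖u s - u r‖ ≤ √l * ‖g‖ := by
      rw [hu]
      exact h2.trans (by gcongr)
    have h5 : ‖u s‖ ≤ ‖u r‖ + √l * ‖g‖ := by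
      calc ‖u s‖ = ‖u r + (u s - u r)‖ := by rw [add_sub_cancel]
        _ ≤ _ := (norm_add_le _ _).trans (by gcongr)
    have h6 : (√l * ‖g‖) ^ 2 = l * ‖g‖ ^ 2 := by rw [mul_pow, Real.sq_sqrt hl0.le]
    rw [← h6]
    nlinarith [norm_nonneg (u s), sq_nonneg (‖u r‖ - √l * ‖g‖)]
  have h2 : ∫ r in (0:ℝ)..l, ‖u s‖ ^ 2 ≤ ∫ r in (0:ℝ)..l, (2 * ‖u r‖ ^ 2 + 2 * (l * ‖g‖ ^ 2)) :=
    intervalIntegral.integral_mono_on hl0.le (by simp)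
      (Continuous.intervalIntegrable (by fun_prop) _ _) h1
  have h3 : ∫ r in (0:ℝ)..l, ‖u r‖ ^ 2 ≤ ‖g‖ ^ 2 := by
    have h4 := integral_norm_sq_le_energy (G := G)
      (fun e r => resolventFun hG g (G.edgePoint e r)) e
    rw [← norm_sq_eq_energy (coeFn_toL2 _)] at h4
    rw [hu]
    refine h4.trans ?_
    have := norm_toL2_resolventFun_le hG g
    gcongr
  rw [intervalIntegral.integral_add (Continuous.intervalIntegrable (by fun_prop) _ _) (by simp),
    intervalIntegral.integral_const_mul, intervalIntegral.integral_const,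
    intervalIntegral.integral_const, smul_eq_mul, smul_eq_mul, sub_zero] at h2
  have h4 : ‖u s‖ ^ 2 ≤ (2 + 2 * l ^ 2) / l * ‖g‖ ^ 2 := by
    rw [div_mul_eq_mul_div, le_div_iff₀ hl0]
    nlinarith
  have h5 := Real.le_sqrt_of_sq_le h4
  rw [Real.sqrt_mul (by positivity), Real.sqrt_sq (norm_nonneg g), hu] at h5
  exact h5

/-- Evaluation at the point `x` of the continuous version of `(1 + H₀)⁻¹ g`. -/
noncomputable def resolventEval (x : G.Point) : G.L2 →L[ℂ] ℂ :=
  LinearMap.mkContinuousOfExistsBound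
    { toFun := fun g => resolventFun hG g x
      map_add' := fun g g' => by rw [resolventFun_add, ContinuousMap.add_apply]
      map_smul' := fun c g => by
        rw [resolventFun_smul, ContinuousMap.smul_apply, RingHom.id_apply] }
    (exists_norm_resolventFun_apply_le hG x)

lemma resolventEval_apply (x : G.Point) (g : G.L2) :
    resolventEval hG x g = resolventFun hG g x := rfl

/-- The resolvent kernel (Green function) with pole `x`, as an element of `L²`. -/
noncomputable def greenFun (x : G.Point) : G.L2 :=
  (InnerProductSpace.toDual ℂ G.L2).symm (resolventEval hG x)

lemma inner_greenFun (x : G.Point) (g : G.L2) :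
    inner ℂ (greenFun hG x) g = resolventFun hG g x := by
  rw [greenFun, InnerProductSpace.toDual_symm_apply, resolventEval_apply]

/-- The Green function is real-valued. -/
lemma star_greenFun (x : G.Point) : star (greenFun hG x) = greenFun hG x := by
  refine ext_inner_right ℂ fun g => ?_
  rw [← star_star g, inner_star_star, inner_greenFun, inner_greenFun, star_star,
    resolventFun_star, Complex.conj_conj]

lemma continuous_greenFun : Continuous (greenFun hG) := by
  refine (InnerProductSpace.toDual ℂ G.L2).symm.continuous.comp (G.continuous_iff.2 fun e => ?_)
  intro s hs
  rw [ContinuousWithinAt, tendsto_iff_norm_sub_tendsto_zero]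
  have h0 : Tendsto (fun t => √|t - s|) (𝓝[Icc 0 (G.length e)] s) (𝓝 0) := by
    have : Tendsto (fun t => √|t - s|) (𝓝 s) (𝓝 √|s - s|) :=
      Continuous.tendsto (by fun_prop) s
    rw [sub_self, abs_zero, Real.sqrt_zero] at this
    exact this.mono_left nhdsWithin_le_nhds
  refine squeeze_zero' (Eventually.of_forall fun _ => norm_nonneg _) ?_ h0
  filter_upwards [self_mem_nhdsWithin] with t ht
  exact ContinuousLinearMap.opNorm_le_bound _ (Real.sqrt_nonneg _) fun g =>
    norm_resolventFun_sub_le hG g e hs ht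

/-- The operator `(1 + H₀)² exp (-t H₀)`. -/
noncomputable abbrev smoothing (t : ℝ) : G.L2 →L[ℂ] G.L2 := heatOpDiv (resolvent hG) t

/-- `(1 + H₀)² exp (-t H₀)` commutes with complex conjugation. -/
lemma smoothing_star (t : ℝ) (f : G.L2) :
    smoothing hG t (star f) = star (smoothing hG t f) := by
  refine isConjugation_star.heatOpDiv_apply (fun f => Lp.ext ?_) t f
  filter_upwards [coeFn_resolvent hG (star f), Lp.coeFn_star (resolvent hG f),
    coeFn_resolvent hG f] with x h1 h2 h3
  rw [h1, h2, Pi.star_apply, h3, resolventFun_star]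
  rfl

/-- The section `K(t, x, ·)` of the heat kernel. -/
noncomputable def heatSection (t : ℝ) (x : G.Point) : G.L2 :=
  resolvent hG (smoothing hG t (greenFun hG x))

/-- The heat kernel `K(t, x, y) = ⟨k y, (1 + H₀)² exp (-t H₀) (k x)⟩`, where `k` is the Green
function. This inner product is real (`ofReal_heatKernel`), so that taking the real part loses
nothing. -/
noncomputable def heatKernel (t : ℝ) (x y : G.Point) : ℝ :=
  (inner ℂ (greenFun hG y) (smoothing hG t (greenFun hG x))).re

/-- The inner product in the definition of the heat kernel is real. -/
lemma ofReal_heatKernel (t : ℝ) (x y : G.Point) :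
    (heatKernel hG t x y : ℂ) = inner ℂ (greenFun hG y) (smoothing hG t (greenFun hG x)) := by
  refine Complex.conj_eq_iff_re.1 ?_
  rw [← inner_star_star, star_greenFun, ← smoothing_star, star_greenFun]

lemma coeFn_heatSection (t : ℝ) (x : G.Point) :
    (heatSection hG t x : G.Point → ℂ) =ᵐ[G.measure] fun y => (heatKernel hG t x y : ℂ) := by
  filter_upwards [coeFn_resolvent hG (smoothing hG t (greenFun hG x))] with y hy
  rw [ofReal_heatKernel, inner_greenFun, heatSection, hy]

/-- The semigroup law `K(2t, x, x) = ∫ K(t, x, y)² dy`. -/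
lemma heatKernel_two_mul (t : ℝ) (ht : 0 < t) (x : G.Point) :
    heatKernel hG (2 * t) x x = ‖heatSection hG t x‖ ^ 2 := by
  have h : inner ℂ (greenFun hG x) (smoothing hG (2 * t) (greenFun hG x))
      = inner ℂ (heatSection hG t x) (heatSection hG t x) := by
    rw [smoothing, heatOpDiv_two_mul (isSelfAdjoint_resolvent hG) (spectrum_resolvent_subset hG) ht]
    simp only [mul_apply_eq_comp]
    rw [heatSection, inner_resolvent_left]
    exact ((isSelfAdjoint_heatOpDiv t).isSymmetric _ _).symm
  rw [heatKernel, h, inner_self_eq_norm_sq_to_K]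
  norm_cast

lemma continuousOn_heatKernel : ContinuousOn
    (fun q : ℝ × G.Point × G.Point => heatKernel hG q.1 q.2.1 q.2.2) (Ioi 0 ×ˢ univ) := by
  have hk := continuous_greenFun hG
  have h1 : ContinuousOn (fun q : ℝ × G.Point × G.Point => smoothing hG q.1) (Ioi 0 ×ˢ univ) :=
    (continuousOn_heatOpDiv (resolvent hG)).comp continuousOn_fst fun q hq => hq.1
  have h2 : ContinuousOn (fun q : ℝ × G.Point × G.Point => smoothing hG q.1 (greenFun hG q.2.1))
      (Ioi 0 ×ˢ univ) := h1.clm_apply (hk.comp (by fun_prop)).continuousOn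
  have h3 : ContinuousOn (fun q : ℝ × G.Point × G.Point => greenFun hG q.2.2) (Ioi 0 ×ˢ univ) :=
    (hk.comp (by fun_prop)).continuousOn
  exact Complex.continuous_re.comp_continuousOn (ContinuousOn.inner h3 h2)

lemma heatOp_apply_ae (t : ℝ) (ht : 0 < t) (f : G.L2) :
    (heatOp (resolvent hG) t f : G.Point → ℂ) =ᵐ[G.measure]
      fun x => ∫ y, (heatKernel hG t x y : ℂ) * f y ∂G.measure := by
  rw [heatOp_eq' (isSelfAdjoint_resolvent hG) ht]
  simp only [mul_apply_eq_comp]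
  filter_upwards [coeFn_resolvent hG (heatOpDiv (resolvent hG) t (resolvent hG f))] with x hx
  have h : inner ℂ (greenFun hG x) (heatOpDiv (resolvent hG) t (resolvent hG f))
      = inner ℂ (heatSection hG t x) f := by
    rw [heatSection, inner_resolvent_left]
    exact ((isSelfAdjoint_heatOpDiv t).isSymmetric _ _).symm
  rw [hx, ← inner_greenFun, h, L2.inner_def]
  refine integral_congr_ae ?_
  filter_upwards [coeFn_heatSection hG t x] with y hy
  rw [hy, RCLike.inner_apply, mul_comm, Complex.conj_ofReal]

lemma isSemigroupGeneratedBy_kirchhoffLaplacian :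
    IsSemigroupGeneratedBy G.KirchhoffLaplacian (heatOp (resolvent hG)) := by
  have h := isSemigroupGeneratedBy_heatOp (isSelfAdjoint_resolvent hG)
    (spectrum_resolvent_subset hG) (resolvent_injective hG)
  exact ⟨h.zero, h.add, h.strongly_continuous, fun f g =>
    (kirchhoffLaplacian_iff_resolvent hG f g).trans (h.generator f g)⟩

lemma isHeatKernel_heatKernel : G.IsHeatKernel (heatKernel hG) := by
  have h := isSemigroupGeneratedBy_kirchhoffLaplacian hG
  exact ⟨continuousOn_heatKernel hG, heatOp (resolvent hG),
    ⟨h.zero, h.add, h.strongly_continuous, h.generator⟩, heatOp_apply_ae hG⟩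

lemma IsHeatSemigroup.eq_heatOp {T : ℝ → G.L2 →L[ℂ] G.L2} (hT : G.IsHeatSemigroup T) {t : ℝ}
    (ht : 0 ≤ t) : T t = heatOp (resolvent hG) t := by
  have hT' : IsSemigroupGeneratedBy G.KirchhoffLaplacian T :=
    ⟨hT.zero, hT.add, hT.strongly_continuous, hT.generator⟩
  refine hT'.unique (isSemigroupGeneratedBy_kirchhoffLaplacian hG)
    (fun f g f' g' h h' => kirchhoffLaplacian_sub h h') (fun f g => kirchhoffLaplacian_accretive)
    ?_ ht
  refine (denseRange_of_injective (isSelfAdjoint_resolvent hG) (resolvent_injective hG)).mono ?_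
  rintro _ ⟨g, rfl⟩
  exact ⟨_, kirchhoffLaplacian_resolventFun hG g⟩

end

/-! ### Uniqueness of the heat kernel -/

lemma measure_pos_of_isOpen {U : Set G.Point} (hU : IsOpen U) {e : E} {s : ℝ}
    (hs : s ∈ Ioo 0 (G.length e)) (hsU : G.edgePoint e s ∈ U) : 0 < G.measure U := by
  have ho : IsOpen (G.edgePoint e ⁻¹' U ∩ Ioo 0 (G.length e)) :=
    (hU.preimage (G.continuous_edgePoint e)).inter isOpen_Ioo
  refine (ho.measure_pos volume ⟨s, hsU, hs⟩).trans_le ?_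
  refine le_trans ?_ (G.map_edgePoint_le e U)
  rw [Measure.map_apply (G.continuous_edgePoint e).measurable hU.measurableSet,
    Measure.restrict_apply ((G.continuous_edgePoint e).measurable hU.measurableSet)]
  exact measure_mono (inter_subset_inter_right _ Ioo_subset_Icc_self)

/-- Two continuous integral kernels of the same operator agree on the diagonal, at the points in the
interiors of the edges. -/
lemma kernel_diag_eq [Finite V] {K K' : G.Point → G.Point → ℝ}
    (hK : Continuous (fun q : G.Point × G.Point => K q.1 q.2))
    (hK' : Continuous (fun q : G.Point × G.Point => K' q.1 q.2))
    (h : ∀ f : G.L2, (fun x => ∫ y, (K x y : ℂ) * f y ∂G.measure) =ᵐ[G.measure]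
      fun x => ∫ y, (K' x y : ℂ) * f y ∂G.measure) {e : E} {s : ℝ}
    (hs : s ∈ Ioo 0 (G.length e)) :
    K (G.edgePoint e s) (G.edgePoint e s) = K' (G.edgePoint e s) (G.edgePoint e s) := by
  set x₀ := G.edgePoint e s
  by_contra hne
  -- otherwise `D` has a constant sign on a square `U × U` around the point: test with the indicator
  -- function of `U`
  set D : G.Point × G.Point → ℝ := fun q => K q.1 q.2 - K' q.1 q.2 with hD
  have cD : Continuous D := hK.sub hK'
  have hD0 : D (x₀, x₀) ≠ 0 := sub_ne_zero.2 hne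
  have hopen : IsOpen {q | 0 < D (x₀, x₀) * D q} :=
    isOpen_lt continuous_const (continuous_const.mul cD)
  have hmem : (x₀, x₀) ∈ {q | 0 < D (x₀, x₀) * D q} := mul_self_pos.2 hD0
  obtain ⟨U₁, U₂, hU₁, hU₂, hx₁, hx₂, hsub⟩ := isOpen_prod_iff.1 hopen x₀ x₀ hmem
  set U := U₁ ∩ U₂
  have hU : IsOpen U := hU₁.inter hU₂
  have hUpos := measure_pos_of_isOpen hU hs (show G.edgePoint e s ∈ U from ⟨hx₁, hx₂⟩)
  have key := h (indicatorConstLp 2 hU.measurableSet (measure_ne_top _ _) (1:ℂ))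
  obtain ⟨x, hxU, hx⟩ : ∃ x ∈ U, (∫ y in U, (K x y : ℂ) ∂G.measure)
      = ∫ y in U, (K' x y : ℂ) ∂G.measure := by
    have hind : ∀ k : G.Point → ℝ, ∫ y, (k y : ℂ) * (indicatorConstLp 2 hU.measurableSet
        (measure_ne_top G.measure U) (1:ℂ) : G.Point → ℂ) y ∂G.measure
        = ∫ y in U, (k y : ℂ) ∂G.measure := by
      intro k
      rw [← integral_indicator hU.measurableSet]
      refine integral_congr_ae ?_
      filter_upwards [indicatorConstLp_coeFn (p := 2) (hs := hU.measurableSet)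
        (hμs := measure_ne_top G.measure U) (c := (1:ℂ))] with y hy
      rw [hy]
      by_cases hyU : y ∈ U <;> simp [hyU]
    have hfr : ∃ᵐ x ∂G.measure, x ∈ U := by
      rw [frequently_ae_mem_iff]; exact hUpos.ne'
    obtain ⟨x, hxU, hx⟩ := (hfr.and_eventually key).exists
    refine ⟨x, hxU, ?_⟩
    rw [← hind, ← hind]
    exact hx
  have i1 : Integrable (fun y => K x y) (G.measure.restrict U) :=
    (BoundedContinuousFunction.mkOfCompact
      ⟨fun y => K x y, hK.comp (by fun_prop : Continuous fun y => (x, y))⟩).integrable _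
  have i2 : Integrable (fun y => K' x y) (G.measure.restrict U) :=
    (BoundedContinuousFunction.mkOfCompact
      ⟨fun y => K' x y, hK'.comp (by fun_prop : Continuous fun y => (x, y))⟩).integrable _
  rw [integral_complex_ofReal, integral_complex_ofReal, Complex.ofReal_inj] at hx
  have h0 : ∫ y in U, D (x₀, x₀) * D (x, y) ∂G.measure = 0 := by
    rw [integral_const_mul]
    simp only [hD]
    rw [integral_sub i1 i2, hx, sub_self, mul_zero]
  have hpos : ∀ y ∈ U, 0 < D (x₀, x₀) * D (x, y) := fun y hy =>
    hsub (mk_mem_prod hxU.1 hy.2)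
  rw [setIntegral_eq_zero_iff_of_nonneg_ae
    ((ae_restrict_iff' hU.measurableSet).2 (Eventually.of_forall fun y hy => (hpos y hy).le))
    ((i1.sub i2).const_mul _)] at h0
  have h1 := (ae_restrict_iff' hU.measurableSet).1 h0
  have hfr : ∃ᵐ x ∂G.measure, x ∈ U := by
    rw [frequently_ae_mem_iff]; exact hUpos.ne'
  obtain ⟨y, hyU, hy⟩ := (hfr.and_eventually h1).exists
  exact (hpos y hyU).ne' (hy hyU)

lemma IsHeatKernel.diag_eq [Nonempty E] [Finite V] (hG : G.Connected)
    {K : ℝ → G.Point → G.Point → ℝ} (hK : G.IsHeatKernel K) {t : ℝ} (ht : 0 < t) {e : E} {s : ℝ}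
    (hs : s ∈ Ioo 0 (G.length e)) :
    K t (G.edgePoint e s) (G.edgePoint e s)
      = heatKernel hG t (G.edgePoint e s) (G.edgePoint e s) := by
  obtain ⟨hc, T, hT, hker⟩ := hK
  have hcont : ∀ K : ℝ → G.Point → G.Point → ℝ,
      ContinuousOn (fun q : ℝ × G.Point × G.Point => K q.1 q.2.1 q.2.2) (Ioi 0 ×ˢ univ) →
      Continuous (fun q : G.Point × G.Point => K t q.1 q.2) := fun K hc =>
    hc.comp_continuous (f := fun q : G.Point × G.Point => (t, q)) (by fun_prop)
      fun q => ⟨ht, mem_univ _⟩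
  refine kernel_diag_eq (hcont K hc) (hcont _ (continuousOn_heatKernel hG)) (fun f => ?_) hs
  have h1 := hker t ht f
  rw [hT.eq_heatOp hG ht.le] at h1
  exact h1.symm.trans (heatOp_apply_ae hG t ht f)

lemma measure_vertexSet [Finite V] : G.measure G.vertexSet = 0 := by
  have hm : MeasurableSet G.vertexSet := by
    refine IsClosed.measurableSet (isOpen_compl_iff.1 (isOpen_coinduced.2 ?_))
    rw [isOpen_sigma_iff]
    intro e
    have : Sigma.mk e ⁻¹' ((fun p : (Σ e : E, Icc (0 : ℝ) (G.length e)) =>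
        G.edgePoint p.1 (p.2 : ℝ)) ⁻¹' G.vertexSetᶜ) = Subtype.val ⁻¹' Ioo 0 (G.length e) := by
      ext ⟨s, hs⟩
      simp only [mem_preimage, mem_compl_iff, vertexSet, mem_range, not_exists]
      constructor
      · intro h
        refine ⟨lt_of_le_of_ne hs.1 ?_, lt_of_le_of_ne hs.2 ?_⟩
        · rintro rfl; exact h (G.src e) (G.edgePoint_zero e).symm
        · rintro rfl; exact h (G.tgt e) (G.edgePoint_length e).symm
      · intro h v hv
        rw [G.edgePoint_of_mem h] at hv
        cases hv
    rw [this]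
    exact isOpen_Ioo.preimage continuous_subtype_val
  unfold measure
  rw [Measure.finsetSum_apply]
  refine Finset.sum_eq_zero fun e _ => ?_
  rw [Measure.map_apply (G.continuous_edgePoint e).measurable hm,
    Measure.restrict_apply ((G.continuous_edgePoint e).measurable hm)]
  refine measure_mono_null (t := {0, G.length e}) ?_ ((Set.toFinite _).measure_zero _)
  rintro s ⟨⟨v, hv⟩, hs⟩
  rcases hs.1.eq_or_lt with h | h
  · exact Or.inl h.symm
  rcases hs.2.eq_or_lt with h' | h'
  · exact Or.inr h'
  rw [G.edgePoint_of_mem ⟨h, h'⟩] at hv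
  cases hv

end MetricGraph

/-! ### The Gaussian kernel on the line -/

/-- The heat kernel of the line. -/
noncomputable def gaussianKernel (t z : ℝ) : ℝ :=
  (√(4 * Real.pi * t))⁻¹ * Real.exp (-(z ^ 2) / (4 * t))

lemma hasDerivAt_gaussianKernel_space {t : ℝ} (ht : 0 < t) (z : ℝ) :
    HasDerivAt (gaussianKernel t) (-(z / (2 * t)) * gaussianKernel t z) z := by
  have h1 : HasDerivAt (fun z : ℝ => -(z ^ 2) / (4 * t)) (-(z / (2 * t))) z := by
    refine ((hasDerivAt_pow 2 z).neg.div_const (4 * t)).congr_deriv ?_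
    field_simp; norm_num; ring
  refine (h1.exp.const_mul (√(4 * Real.pi * t))⁻¹).congr_deriv ?_
  rw [gaussianKernel]; ring

lemma hasDerivAt_gaussianKernel_space' {t : ℝ} (ht : 0 < t) (z : ℝ) :
    HasDerivAt (fun z => -(z / (2 * t)) * gaussianKernel t z)
      ((z ^ 2 / (4 * t ^ 2) - 1 / (2 * t)) * gaussianKernel t z) z := by
  have h1 : HasDerivAt (fun z : ℝ => -(z / (2 * t))) (-(1 / (2 * t))) z :=
    ((hasDerivAt_id z).div_const _).neg
  refine (h1.mul (hasDerivAt_gaussianKernel_space ht z)).congr_deriv ?_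
  field_simp; ring

lemma hasDerivAt_gaussianKernel_time {t : ℝ} (ht : 0 < t) (z : ℝ) :
    HasDerivAt (fun t => gaussianKernel t z)
      ((z ^ 2 / (4 * t ^ 2) - 1 / (2 * t)) * gaussianKernel t z) t := by
  have hpos : 0 < 4 * Real.pi * t := by positivity
  have h1 : HasDerivAt (fun t : ℝ => -(z ^ 2) / (4 * t)) (z ^ 2 / (4 * t ^ 2)) t := by
    have := ((hasDerivAt_id t).const_mul 4).fun_inv (by simp [ht.ne']) |>.const_mul (-(z ^ 2))
    refine this.congr_deriv ?_
    simp only [id]; field_simp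
  have h2 : HasDerivAt (fun t : ℝ => (√(4 * Real.pi * t))⁻¹)
      (-(1 / (2 * t)) * (√(4 * Real.pi * t))⁻¹) t := by
    have := (((hasDerivAt_id t).const_mul (4 * Real.pi)).sqrt (by simpa using hpos.ne')).fun_inv
      (by simpa using (Real.sqrt_pos.2 hpos).ne')
    refine this.congr_deriv ?_
    have hs : √(4 * Real.pi * t) ^ 2 = 4 * Real.pi * t := Real.sq_sqrt hpos.le
    have hs0 := (Real.sqrt_pos.2 hpos).ne'
    simp only [id]
    field_simp
    rw [hs]
  refine (h2.mul h1.exp).congr_deriv ?_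
  rw [gaussianKernel]; ring

lemma continuousOn_gaussianKernel :
    ContinuousOn (fun q : ℝ × ℝ => gaussianKernel q.1 q.2) (Ioi 0 ×ˢ univ) := by
  unfold gaussianKernel
  refine ContinuousOn.mul (ContinuousOn.inv₀ (by fun_prop) fun q hq => ?_)
    (Real.continuous_exp.comp_continuousOn (ContinuousOn.div (by fun_prop) (by fun_prop) ?_))
  · have : 0 < q.1 := hq.1
    positivity
  · intro q hq
    have : 0 < q.1 := hq.1
    positivity

lemma gaussianKernel_nonneg (t z : ℝ) : 0 ≤ gaussianKernel t z := by
  unfold gaussianKernel; positivity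

/-- The square of a Gaussian is a multiple of a Gaussian of half the variance. -/
lemma gaussianKernel_sq {t : ℝ} (ht : 0 < t) (z : ℝ) :
    gaussianKernel t z ^ 2 = (√(8 * Real.pi * t))⁻¹ * gaussianKernel (t / 2) z := by
  unfold gaussianKernel
  have h1 : √(8 * Real.pi * t) * √(4 * Real.pi * (t / 2)) = 4 * Real.pi * t := by
    rw [← Real.sqrt_mul (by positivity)]
    rw [show 8 * Real.pi * t * (4 * Real.pi * (t / 2)) = (4 * Real.pi * t) ^ 2 by ring]
    exact Real.sqrt_sq (by positivity)
  rw [mul_pow, inv_pow, Real.sq_sqrt (by positivity), ← mul_assoc, ← mul_inv, h1,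
    ← Real.exp_nat_mul]
  congr 2
  push_cast
  field_simp

/-- Away from `z = 0`, the Gaussian kernel, even divided by `t`, is bounded for `t ≤ 1`. -/
lemma gaussianKernel_le {t η : ℝ} (ht : 0 < t) (ht1 : t ≤ 1) (hη : 0 < η) {z : ℝ} (hz : η ≤ |z|) :
    gaussianKernel t z ≤ 32 / η ^ 4 ∧ gaussianKernel t z / t ≤ 32 / η ^ 4 := by
  have hz2 : η ^ 2 ≤ z ^ 2 := by rw [← sq_abs z]; gcongr
  have h1 : (√(4 * Real.pi * t))⁻¹ ≤ t⁻¹ := by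
    refine inv_anti₀ ht (Real.le_sqrt_of_sq_le ?_)
    nlinarith [Real.pi_gt_three]
  have h2 : Real.exp (-(z ^ 2) / (4 * t)) ≤ 32 * t ^ 2 / η ^ 4 := by
    have hx : 0 ≤ z ^ 2 / (4 * t) := by positivity
    have h3 := Real.pow_div_factorial_le_exp _ hx 2
    have h4 : (η ^ 2 / (4 * t)) ^ 2 / 2 ≤ Real.exp (z ^ 2 / (4 * t)) := by
      refine le_trans ?_ h3
      norm_num [Nat.factorial]
      gcongr
    rw [neg_div, Real.exp_neg, inv_le_comm₀ (Real.exp_pos _) (by positivity)]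
    refine le_trans (le_of_eq ?_) h4
    field_simp; norm_num
  have h5 : gaussianKernel t z ≤ t⁻¹ * (32 * t ^ 2 / η ^ 4) := by
    unfold gaussianKernel; gcongr
  have h6 : gaussianKernel t z / t ≤ 32 / η ^ 4 := by
    rw [div_le_iff₀ ht]
    refine h5.trans (le_of_eq ?_)
    field_simp
  refine ⟨le_trans ?_ h6, h6⟩
  rw [le_div_iff₀ ht]
  nlinarith [gaussianKernel_nonneg t z]

lemma tendsto_half_nhdsGT_zero : Tendsto (fun t : ℝ => t / 2) (𝓝[>] 0) (𝓝[>] 0) := by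
  refine tendsto_nhdsWithin_iff.2 ⟨?_, ?_⟩
  · have : Tendsto (fun t : ℝ => t / 2) (𝓝 0) (𝓝 (0 / 2)) := Continuous.tendsto (by fun_prop) 0
    rw [zero_div] at this
    exact this.mono_left nhdsWithin_le_nhds
  · filter_upwards [self_mem_nhdsWithin] with t ht
    exact half_pos (mem_Ioi.1 ht)

/-- The Gaussian kernel is an approximate identity as `t → 0+`. -/
lemma tendsto_integral_gaussianKernel_smul {Y : Type*} [NormedAddCommGroup Y] [NormedSpace ℝ Y]
    [CompleteSpace Y] {g : ℝ → Y} (hg : Integrable g) {x₀ : ℝ} (hc : ContinuousAt g x₀) :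
    Tendsto (fun t => ∫ y, gaussianKernel t (y - x₀) • g y) (𝓝[>] 0) (𝓝 (g x₀)) := by
  have hφ1 : ∫ x, gaussianKernel 1 x = 1 := by
    unfold gaussianKernel
    rw [integral_const_mul]
    have h := integral_gaussian (1 / 4)
    have e : ∀ x : ℝ, -(x ^ 2) / (4 * 1) = -(1 / 4) * x ^ 2 := fun x => by ring
    simp only [e, h]
    rw [show Real.pi / (1 / 4) = 4 * Real.pi * 1 by ring]
    exact inv_mul_cancel₀ (Real.sqrt_pos.2 (by positivity)).ne'
  have hdec : Tendsto (fun x : ℝ => ‖x‖ ^ Module.finrank ℝ ℝ * gaussianKernel 1 x)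
      (Bornology.cobounded ℝ) (𝓝 0) := by
    have hb : Tendsto (fun x : ℝ => (32:ℝ) / |x| ^ 3) (Bornology.cobounded ℝ) (𝓝 0) := by
      have h1 : Tendsto (fun x : ℝ => |x| ^ 3) (Bornology.cobounded ℝ) atTop :=
        (tendsto_pow_atTop (by norm_num)).comp tendsto_norm_cobounded_atTop
      exact h1.const_div_atTop 32
    refine squeeze_zero' (Eventually.of_forall fun x =>
      mul_nonneg (by positivity) (gaussianKernel_nonneg _ _)) ?_ hb
    filter_upwards [tendsto_norm_cobounded_atTop.eventually_ge_atTop (1:ℝ)] with x hx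
    have hx0 : 0 < |x| := lt_of_lt_of_le one_pos hx
    have h1 := (gaussianKernel_le one_pos le_rfl hx0 (le_refl |x|)).1
    rw [Module.finrank_self, pow_one, Real.norm_eq_abs]
    calc |x| * gaussianKernel 1 x ≤ |x| * (32 / |x| ^ 4) := by gcongr
      _ = 32 / |x| ^ 3 := by field_simp
  -- rescaling of the kernel at time `1` by the factor `t ^ (-1/2)`
  have key := tendsto_integral_comp_smul_smul_of_integrable' (μ := volume)
    (gaussianKernel_nonneg 1) hφ1 hdec hg hc
  have hlim : Tendsto (fun t : ℝ => (√t)⁻¹) (𝓝[>] 0) atTop := by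
    refine tendsto_inv_nhdsGT_zero.comp (tendsto_nhdsWithin_iff.2 ⟨?_, ?_⟩)
    · have : Tendsto Real.sqrt (𝓝 0) (𝓝 √0) := Real.continuous_sqrt.tendsto 0
      rw [Real.sqrt_zero] at this
      exact this.mono_left nhdsWithin_le_nhds
    · filter_upwards [self_mem_nhdsWithin] with t ht using Real.sqrt_pos.2 ht
  refine (key.comp hlim).congr' ?_
  filter_upwards [self_mem_nhdsWithin] with t (ht : 0 < t)
  simp only [Function.comp_apply, Module.finrank_self, pow_one]
  refine integral_congr_ae (Eventually.of_forall fun y => ?_)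
  simp only
  congr 1
  unfold gaussianKernel
  have hs : √t ^ 2 = t := Real.sq_sqrt ht.le
  have hs0 := (Real.sqrt_pos.2 ht).ne'
  rw [Real.sqrt_mul (by positivity) t, mul_inv, mul_one, smul_eq_mul, mul_pow, inv_pow, hs, mul_one]
  rw [← mul_assoc, mul_comm (√t)⁻¹]
  congr 2
  field_simp
  ring

/-! ### Cut-off functions -/

/-- `χ` is a twice continuously differentiable cut-off function supported in `(0, l)` and equal to
`1` on the `η`-neighbourhood of `x₀`, with derivatives `χ'` and `χ''`. -/
structure IsCutoff (l x₀ η : ℝ) (χ χ' χ'' : ℝ → ℝ) : Prop where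
  hasDeriv : ∀ y, HasDerivAt χ (χ' y) y
  hasDeriv' : ∀ y, HasDerivAt χ' (χ'' y) y
  continuous'' : Continuous χ''
  eq_zero : ∀ y, y ∉ Ioo 0 l → χ y = 0 ∧ χ' y = 0 ∧ χ'' y = 0
  eq_one : ∀ y, |y - x₀| < η → χ y = 1 ∧ χ' y = 0 ∧ χ'' y = 0

lemma exists_isCutoff {l x₀ : ℝ} (hx : x₀ ∈ Ioo 0 l) :
    ∃ η > 0, ∃ χ χ' χ'', IsCutoff l x₀ η χ χ' χ'' := by
  obtain ⟨η, hη, h1, h2⟩ : ∃ η > 0, 2 * η < x₀ ∧ 2 * η < l - x₀ := by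
    refine ⟨min x₀ (l - x₀) / 4, ?_, ?_, ?_⟩
    · have := lt_min hx.1 (sub_pos.2 hx.2); linarith
    · have := min_le_left x₀ (l - x₀); have := hx.1; linarith
    · have := min_le_right x₀ (l - x₀); have := sub_pos.2 hx.2; linarith
  let f : ContDiffBump x₀ := ⟨η, 2 * η, hη, by linarith⟩
  have c2 : ContDiff ℝ 2 f := f.contDiff
  have c1 : ContDiff ℝ 1 (deriv f) := (contDiff_succ_iff_deriv (n := 1).1 c2).2.2
  have c0 : ContDiff ℝ 0 (deriv (deriv f)) := (contDiff_succ_iff_deriv (n := 0).1 c1).2.2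
  refine ⟨η, hη, f, deriv f, deriv (deriv f),
    fun y => (c2.differentiable (by norm_num) y).hasDerivAt,
    fun y => (c1.differentiable (by norm_num) y).hasDerivAt, c0.continuous, fun y hy => ?_,
    fun y hy => ?_⟩
  · have hev : (f : ℝ → ℝ) =ᶠ[𝓝 y] fun _ => 0 := by
      have hopen : IsOpen (Metric.closedBall x₀ (2 * η))ᶜ := Metric.isClosed_closedBall.isOpen_compl
      have hmem : y ∈ (Metric.closedBall x₀ (2 * η))ᶜ := by
        intro h
        rw [Metric.mem_closedBall, Real.dist_eq, abs_le] at h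
        exact hy ⟨by linarith [h.1], by linarith [h.2]⟩
      filter_upwards [hopen.mem_nhds hmem] with z hz
      refine f.zero_of_le_dist ?_
      rw [mem_compl_iff, Metric.mem_closedBall, not_le] at hz
      exact hz.le
    have h3 := hev.deriv
    have h4 := h3.deriv
    refine ⟨hev.eq_of_nhds, ?_, ?_⟩
    · simpa using h3.eq_of_nhds
    · simpa using h4.eq_of_nhds
  · have hev : (f : ℝ → ℝ) =ᶠ[𝓝 y] fun _ => 1 := by
      have hmem : y ∈ Metric.ball x₀ η := by rwa [Metric.mem_ball, Real.dist_eq]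
      filter_upwards [Metric.isOpen_ball.mem_nhds hmem] with z hz
      exact f.one_of_mem_closedBall (Metric.ball_subset_closedBall hz)
    have h3 := hev.deriv
    have h4 := h3.deriv
    refine ⟨hev.eq_of_nhds, ?_, ?_⟩
    · simpa using h3.eq_of_nhds
    · simpa using h4.eq_of_nhds

namespace IsCutoff

variable {l x₀ η : ℝ} {χ χ' χ'' : ℝ → ℝ}

lemma continuous (h : IsCutoff l x₀ η χ χ' χ'') : Continuous χ :=
  continuous_iff_continuousAt.2 fun y => (h.hasDeriv y).continuousAt

lemma continuous' (h : IsCutoff l x₀ η χ χ' χ'') : Continuous χ' :=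
  continuous_iff_continuousAt.2 fun y => (h.hasDeriv' y).continuousAt

lemma left_notMem : (0:ℝ) ∉ Ioo 0 l := fun h => lt_irrefl _ h.1

lemma right_notMem : l ∉ Ioo 0 l := fun h => lt_irrefl _ h.2

end IsCutoff

/-- The second space derivative, and the time derivative, of the Gaussian kernel. -/
noncomputable def gaussianKernel'' (t z : ℝ) : ℝ :=
  (z ^ 2 / (4 * t ^ 2) - 1 / (2 * t)) * gaussianKernel t z

lemma continuous_gaussianKernel (t : ℝ) : Continuous (gaussianKernel t) := by
  unfold gaussianKernel; fun_prop

lemma continuous_gaussianKernel'' (t : ℝ) : Continuous (gaussianKernel'' t) := by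
  have := continuous_gaussianKernel t
  unfold gaussianKernel''; fun_prop

lemma continuousOn_gaussianKernel'' :
    ContinuousOn (fun q : ℝ × ℝ => gaussianKernel'' q.1 q.2) (Ioi 0 ×ˢ univ) := by
  unfold gaussianKernel''
  refine ContinuousOn.mul (ContinuousOn.sub (ContinuousOn.div (by fun_prop) (by fun_prop) ?_)
    (ContinuousOn.div (by fun_prop) (by fun_prop) ?_)) continuousOn_gaussianKernel
  all_goals
    intro q hq
    have : 0 < q.1 := hq.1
    positivity

namespace MetricGraph

variable {V E : Type*} {G : MetricGraph V E}

/-! ### Functions supported in a single edge -/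

open Classical in
/-- The extension by zero to the whole graph of a continuous function `φ` on the edge `e` which
vanishes at both ends of `e` (for other `φ`, the value is the zero function). -/
noncomputable def edgeExt (G : MetricGraph V E) (e : E) (φ : ℝ → ℂ) : C(G.Point, ℂ) :=
  if h : Continuous φ ∧ φ 0 = 0 ∧ φ (G.length e) = 0 then
    ⟨G.glue (fun _ => 0) (fun e' s => if e' = e then φ s else 0), by
      refine G.continuous_glue (fun e' => ?_) (fun e' => ?_) (fun e' => ?_)
      · split_ifs <;> simp [h]
      · split_ifs with h'
        · rw [h', h.2.2]
        · rfl
      · split_ifs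
        · exact h.1.continuousOn
        · exact continuousOn_const⟩
  else 0

open Classical in
lemma edgeExt_edgePoint {e : E} {φ : ℝ → ℂ} (hc : Continuous φ) (h0 : φ 0 = 0)
    (h1 : φ (G.length e) = 0) (e' : E) {s : ℝ} (hs : s ∈ Icc 0 (G.length e')) :
    G.edgeExt e φ (G.edgePoint e' s) = if e' = e then φ s else 0 := by
  rw [edgeExt, dif_pos ⟨hc, h0, h1⟩]
  refine G.glue_edgePoint (φ := fun e' s => if e' = e then φ s else 0) ?_ ?_ hs
  · split_ifs <;> simp [h0]
  · split_ifs with h'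
    · rw [h', h1]
    · rfl

variable [Fintype E]

open Classical in
/-- A function supported in the interior of an edge satisfies the Kirchhoff conditions. -/
lemma isKirchhoff_edgeExt {e : E} {φ φ' φ'' : ℝ → ℂ}
    (hφ : ∀ y, HasDerivAt φ (φ' y) y)
    (hφ' : ∀ y, HasDerivAt φ' (φ'' y) y) (hc : Continuous φ'')
    (h0 : ∀ y, y ∉ Ioo 0 (G.length e) → φ y = 0 ∧ φ' y = 0 ∧ φ'' y = 0) :
    G.IsKirchhoff (G.edgeExt e φ) (fun e' s => if e' = e then φ' s else 0)
      (G.edgeExt e fun y => -φ'' y) := by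
  have c : Continuous φ := continuous_iff_continuousAt.2 fun y => (hφ y).continuousAt
  have c' : Continuous φ' := continuous_iff_continuousAt.2 fun y => (hφ' y).continuousAt
  have z0 := h0 0 IsCutoff.left_notMem
  have z1 := h0 _ IsCutoff.right_notMem
  refine ⟨(G.edgeExt e φ).continuous, fun e' s hs => ?_, fun e' s hs => ?_, fun v => ?_⟩
  · have h1 : ∀ r ∈ Icc 0 (G.length e'), G.edgeExt e φ (G.edgePoint e' r)
        = if e' = e then φ r else 0 := fun r hr => by
      rw [edgeExt_edgePoint c z0.1 z1.1 e' hr]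
    have h2 : HasDerivAt (fun r => if e' = e then φ r else 0) (if e' = e then φ' s else 0) s := by
      split_ifs
      · exact hφ s
      · exact hasDerivAt_const _ _
    exact h2.hasDerivWithinAt.congr h1 (h1 s hs)
  · have h1 : ∫ r in (0:ℝ)..s, G.edgeExt e (fun y => -φ'' y) (G.edgePoint e' r)
        = ∫ r in (0:ℝ)..s, if e' = e then -φ'' r else 0 := by
      refine intervalIntegral.integral_congr fun r hr => ?_
      rw [uIcc_of_le hs.1] at hr
      rw [edgeExt_edgePoint (φ := fun y => -φ'' y) hc.neg (by simp [z0.2.2])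
        (by simp [z1.2.2]) e' ⟨hr.1, hr.2.trans hs.2⟩]
    rw [h1]
    split_ifs
    · rw [intervalIntegral.integral_neg, intervalIntegral.integral_eq_sub_of_hasDerivAt
        (fun r _ => hφ' r) (hc.intervalIntegrable _ _)]
      ring
    · simp
  · refine Finset.sum_eq_zero fun e' _ => ?_
    by_cases he : e' = e
    · subst he; simp [z0.2.1, z1.2.1]
    · simp [he]

lemma norm_le_of_edgePoint [Nonempty E] [Finite V] (hG : G.Connected) {u : C(G.Point, ℂ)} {C : ℝ}
    (hC : 0 ≤ C) (h : ∀ e, ∀ s ∈ Icc 0 (G.length e), ‖u (G.edgePoint e s)‖ ≤ C) : ‖u‖ ≤ C := by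
  refine (ContinuousMap.norm_le u hC).2 fun x => ?_
  obtain ⟨e, s, hs, rfl⟩ := exists_edgePoint_eq hG x
  exact h e s hs

/-- Differentiation under the extension map of a family of functions on an edge. -/
lemma hasDerivAt_edgeExt [Nonempty E] [Finite V] (hG : G.Connected) {e : E} {Γ Γ' : ℝ → ℝ → ℂ}
    (hΓc : ∀ t, 0 < t → Continuous (Γ t)) (hΓc' : ∀ t, 0 < t → Continuous (Γ' t))
    (h0 : ∀ t y, y ∉ Ioo 0 (G.length e) → Γ t y = 0 ∧ Γ' t y = 0)
    (hd : ∀ t, 0 < t → ∀ y, HasDerivAt (fun t => Γ t y) (Γ' t y) t)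
    (hc : ContinuousOn (Function.uncurry Γ') (Ioi 0 ×ˢ univ)) {t : ℝ} (ht : 0 < t) :
    HasDerivAt (fun t => G.edgeExt e (Γ t)) (G.edgeExt e (Γ' t)) t := by
  classical
  rw [hasDerivAt_iff_isLittleO, Asymptotics.isLittleO_iff]
  intro ε hε
  obtain ⟨v, hv, hvε⟩ := (isCompact_Icc (a := (0:ℝ)) (b := G.length e)).mem_uniformity_of_prod
    (hc.mono (prod_mono_right (subset_univ _))) (mem_Ioi.2 ht) (Metric.dist_mem_uniformity hε)
  rw [IsOpen.nhdsWithin_eq isOpen_Ioi (mem_Ioi.2 ht)] at hv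
  obtain ⟨δ, hδ, hball⟩ := Metric.mem_nhds_iff.1 (inter_mem hv (Ioi_mem_nhds ht))
  filter_upwards [Metric.ball_mem_nhds t hδ] with s hs
  have hsp : 0 < s := (hball hs).2
  refine norm_le_of_edgePoint hG (by positivity) fun e' y hy => ?_
  have z := fun t => h0 t 0 IsCutoff.left_notMem
  have z' := fun t => h0 t _ (IsCutoff.right_notMem (l := G.length e))
  simp only [ContinuousMap.sub_apply, ContinuousMap.smul_apply]
  rw [edgeExt_edgePoint (hΓc s hsp) (z s).1 (z' s).1 e' hy,
    edgeExt_edgePoint (hΓc t ht) (z t).1 (z' t).1 e' hy,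
    edgeExt_edgePoint (hΓc' t ht) (z t).2 (z' t).2 e' hy]
  by_cases he : e' = e
  · subst he
    simp only [if_true]
    have key := (convex_ball t δ).norm_image_sub_le_of_norm_hasDerivWithin_le
      (f := fun r => Γ r y - r • Γ' t y) (f' := fun r => Γ' r y - Γ' t y) (C := ε)
      (fun r hr => by
        have h1 := (hd r (hball hr).2 y).sub ((hasDerivAt_id r).smul_const (Γ' t y))
        rw [one_smul] at h1
        exact h1.hasDerivWithinAt)
      (fun r hr => by
        have h1 := hvε r (hball hr).1 y hy
        rw [mem_ofPred_eq, dist_eq_norm] at h1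
        exact h1.le) (Metric.mem_ball_self hδ) hs
    refine le_trans (le_of_eq ?_) key
    congr 1
    simp only [sub_smul]
    abel
  · simp only [he, if_false, sub_zero, smul_zero, norm_zero]
    positivity

/-! ### The cut-off Gaussian as an approximate heat kernel -/

/-- The Gaussian kernel centred at the point `x₀` of the edge `e`, multiplied by the cut-off `χ` and
extended by zero to the graph. -/
noncomputable def cutGaussian [Finite V] (G : MetricGraph V E) (e : E) (x₀ : ℝ) (χ : ℝ → ℝ)
    (t : ℝ) : G.L2 :=
  G.toL2 (G.edgeExt e fun y => ((χ y * gaussianKernel t (y - x₀) : ℝ) : ℂ))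

section

variable [Finite V] {e : E} {x₀ η : ℝ} {χ χ' χ'' : ℝ → ℝ}

/-- The continuous version of the time derivative of `cutGaussian`. -/
noncomputable def cutGaussianDeriv (G : MetricGraph V E) (e : E) (x₀ : ℝ) (χ : ℝ → ℝ) (t : ℝ) :
    C(G.Point, ℂ) :=
  G.edgeExt e fun y => ((χ y * gaussianKernel'' t (y - x₀) : ℝ) : ℂ)

/-- The second space derivative of the cut-off Gaussian. -/
noncomputable def cutGaussianSecond (t x₀ : ℝ) (χ χ' χ'' : ℝ → ℝ) (y : ℝ) : ℝ :=
  χ'' y * gaussianKernel t (y - x₀)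
    + 2 * (χ' y * (-((y - x₀) / (2 * t)) * gaussianKernel t (y - x₀)))
    + χ y * gaussianKernel'' t (y - x₀)

lemma hasDerivAt_cutGaussian [Nonempty E] (hG : G.Connected)
    (h : IsCutoff (G.length e) x₀ η χ χ' χ'') {t : ℝ} (ht : 0 < t) :
    HasDerivAt (G.cutGaussian e x₀ χ) (G.toL2 (G.cutGaussianDeriv e x₀ χ t)) t := by
  have hχ := h.continuous
  refine G.toL2.restrictScalars ℝ |>.hasFDerivAt.comp_hasDerivAt t
    (hasDerivAt_edgeExt hG (e := e)
      (Γ := fun t y => ((χ y * gaussianKernel t (y - x₀) : ℝ) : ℂ))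
      (Γ' := fun t y => ((χ y * gaussianKernel'' t (y - x₀) : ℝ) : ℂ)) ?_ ?_ ?_ ?_ ?_ ht)
  · intro t _
    have := continuous_gaussianKernel t
    fun_prop
  · intro t _
    have := continuous_gaussianKernel'' t
    fun_prop
  · intro t y hy
    simp [(h.eq_zero y hy).1]
  · intro t ht y
    exact ((hasDerivAt_gaussianKernel_time ht (y - x₀)).const_mul (χ y)).ofReal_comp
  · refine Complex.continuous_ofReal.comp_continuousOn (ContinuousOn.mul
      (hχ.comp continuous_snd).continuousOn ?_)
    exact continuousOn_gaussianKernel''.comp (f := fun q : ℝ × ℝ => (q.1, q.2 - x₀)) (by fun_prop)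
      fun q hq => ⟨hq.1, mem_univ _⟩

lemma kirchhoffLaplacian_cutGaussian (h : IsCutoff (G.length e) x₀ η χ χ' χ'') {t : ℝ}
    (ht : 0 < t) : G.KirchhoffLaplacian (G.cutGaussian e x₀ χ t)
      (G.toL2 (G.edgeExt e fun y => -((cutGaussianSecond t x₀ χ χ' χ'' y : ℝ) : ℂ))) := by
  classical
  have hχ := h.continuous
  have hχ' := h.continuous'
  have hχ'' := h.continuous''
  have hg := continuous_gaussianKernel t
  have hg'' := continuous_gaussianKernel'' t
  have e1 : ∀ y, HasDerivAt (fun y => gaussianKernel t (y - x₀))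
      (-((y - x₀) / (2 * t)) * gaussianKernel t (y - x₀)) y := fun y =>
    (hasDerivAt_gaussianKernel_space ht (y - x₀)).comp_sub_const y x₀
  have e2 : ∀ y, HasDerivAt (fun y => -((y - x₀) / (2 * t)) * gaussianKernel t (y - x₀))
      (gaussianKernel'' t (y - x₀)) y := fun y =>
    (hasDerivAt_gaussianKernel_space' ht (y - x₀)).comp_sub_const y x₀
  refine kirchhoffLaplacian_iff.2 ⟨_, _, coeFn_toL2 _, (isKirchhoff_edgeExt
    (φ := fun y => ((χ y * gaussianKernel t (y - x₀) : ℝ) : ℂ))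
    (φ' := fun y => ((χ' y * gaussianKernel t (y - x₀)
      + χ y * (-((y - x₀) / (2 * t)) * gaussianKernel t (y - x₀)) : ℝ) : ℂ))
    (φ'' := fun y => ((cutGaussianSecond t x₀ χ χ' χ'' y : ℝ) : ℂ)) ?_ ?_ ?_ ?_).congr_ae
      (coeFn_toL2 _).symm⟩
  · exact fun y => ((h.hasDeriv y).mul (e1 y)).ofReal_comp
  · refine fun y => HasDerivAt.ofReal_comp (HasDerivAt.congr_deriv
      (((h.hasDeriv' y).mul (e1 y)).add ((h.hasDeriv y).mul (e2 y))) ?_)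
    unfold cutGaussianSecond
    ring
  · unfold cutGaussianSecond
    fun_prop
  · intro y hy
    obtain ⟨z0, z1, z2⟩ := h.eq_zero y hy
    simp [cutGaussianSecond, z0, z1, z2]

/-- The cut-off Gaussian satisfies the heat equation up to an error that is bounded as `t → 0`:
the error lives where the cut-off varies, away from the centre of the Gaussian. -/
lemma exists_norm_error_le [Nonempty E] (hG : G.Connected)
    (h : IsCutoff (G.length e) x₀ η χ χ' χ'') (hη : 0 < η)
    (hx₀ : x₀ ∈ Ioo 0 (G.length e)) :
    ∃ C, 0 ≤ C ∧ ∀ t, 0 < t → t ≤ 1 →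
      ‖G.toL2 (G.edgeExt e fun y => -((cutGaussianSecond t x₀ χ χ' χ'' y : ℝ) : ℂ))
        + G.toL2 (G.cutGaussianDeriv e x₀ χ t)‖ ≤ C := by
  classical
  have hχ := h.continuous
  have hχ' := h.continuous'
  have hχ'' := h.continuous''
  set l := G.length e with hl
  have hl0 : 0 < l := G.length_pos e
  obtain ⟨M₁, hM₁⟩ := isCompact_Icc.exists_bound_of_continuousOn (s := Icc 0 l) hχ'.continuousOn
  obtain ⟨M₂, hM₂⟩ := isCompact_Icc.exists_bound_of_continuousOn (s := Icc 0 l) hχ''.continuousOn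
  have hM₁0 : 0 ≤ M₁ := (norm_nonneg _).trans (hM₁ 0 ⟨le_rfl, hl0.le⟩)
  have hM₂0 : 0 ≤ M₂ := (norm_nonneg _).trans (hM₂ 0 ⟨le_rfl, hl0.le⟩)
  set B := 32 / η ^ 4 with hB
  have hB0 : 0 ≤ B := by positivity
  refine ⟨‖G.toL2‖ * (M₂ * B + M₁ * (l * B)), by positivity, fun t ht ht1 => ?_⟩
  have hg := continuous_gaussianKernel t
  have hg'' := continuous_gaussianKernel'' t
  rw [← map_add]
  refine (G.toL2.le_opNorm _).trans ?_
  gcongr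
  refine norm_le_of_edgePoint hG (by positivity) fun e' y hy => ?_
  have z0 := h.eq_zero 0 IsCutoff.left_notMem
  have z1 := h.eq_zero _ IsCutoff.right_notMem
  rw [ContinuousMap.add_apply, cutGaussianDeriv, edgeExt_edgePoint (e' := e') (by
      unfold cutGaussianSecond; fun_prop) (by simp [cutGaussianSecond, z0])
      (by simp [cutGaussianSecond, ← hl, z1]) hy, edgeExt_edgePoint (e' := e') (by fun_prop)
      (by simp [z0]) (by simp [← hl, z1]) hy]
  by_cases he : e' = e
  · subst he
    simp only [if_true]
    have e1 : -((cutGaussianSecond t x₀ χ χ' χ'' y : ℝ) : ℂ)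
        + ((χ y * gaussianKernel'' t (y - x₀) : ℝ) : ℂ)
        = ((-(χ'' y * gaussianKernel t (y - x₀))
          + χ' y * ((y - x₀) * (gaussianKernel t (y - x₀) / t)) : ℝ) : ℂ) := by
      unfold cutGaussianSecond
      push_cast
      field_simp
      ring
    rw [e1, Complex.norm_real]
    by_cases hyη : |y - x₀| < η
    · obtain ⟨-, h1, h2⟩ := h.eq_one y hyη
      rw [h1, h2]
      simp only [zero_mul, neg_zero, add_zero, norm_zero]
      positivity
    · obtain ⟨g1, g2⟩ := gaussianKernel_le ht ht1 hη (not_lt.1 hyη)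
      have g0 := gaussianKernel_nonneg t (y - x₀)
      have hyl : |y - x₀| ≤ l :=
        abs_le.2 ⟨by linarith [hy.1, hx₀.2], by linarith [hy.2, hx₀.1]⟩
      refine (norm_add_le _ _).trans ?_
      rw [norm_neg, norm_mul, norm_mul, norm_mul, Real.norm_of_nonneg g0,
        Real.norm_of_nonneg (div_nonneg g0 ht.le), Real.norm_eq_abs (y - x₀)]
      have := hM₁ y hy
      have := hM₂ y hy
      gcongr
  · simp only [he, if_false, add_zero, norm_zero]
    positivity

end

section

variable [Finite V]

lemma toL2_edgeExt_ae {e : E} {φ : ℝ → ℂ} (e' : E) :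
    ∀ᵐ s : ℝ, s ∈ uIoc 0 (G.length e') →
      G.toL2 (G.edgeExt e φ) (G.edgePoint e' s) = G.edgeExt e φ (G.edgePoint e' s) :=
  ae_uIoc_edge (coeFn_toL2 _) ⟨(G.length_pos e').le, le_rfl⟩

/-- The extension by zero is isometric from `L²` of an edge to `L²` of the graph. -/
lemma norm_sq_toL2_edgeExt {e : E} {φ : ℝ → ℂ} (hc : Continuous φ) (h0 : φ 0 = 0)
    (h1 : φ (G.length e) = 0) :
    ‖G.toL2 (G.edgeExt e φ)‖ ^ 2 = ∫ s in (0:ℝ)..G.length e, ‖φ s‖ ^ 2 := by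
  classical
  rw [norm_sq_eq_energy (coeFn_toL2 _), energy, Finset.sum_eq_single e]
  · refine intervalIntegral.integral_congr fun s hs => ?_
    rw [uIcc_of_le (G.length_pos e).le] at hs
    rw [edgeExt_edgePoint hc h0 h1 e hs, if_pos rfl]
  · intro e' _ he
    refine Eq.trans ?_ (intervalIntegral.integral_zero (μ := volume) (a := 0) (b := G.length e'))
    refine intervalIntegral.integral_congr fun s hs => ?_
    rw [uIcc_of_le (G.length_pos e').le] at hs
    rw [edgeExt_edgePoint hc h0 h1 e' hs, if_neg he]
    simp
  · simp

/-- The resolvent of a function supported in one edge, as a superposition of Green functions. -/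
lemma resolvent_toL2_edgeExt [Nonempty E] (hG : G.Connected) {e : E} {φ : ℝ → ℂ}
    (hc : Continuous φ) (h0 : φ 0 = 0) (h1 : φ (G.length e) = 0) :
    resolvent hG (G.toL2 (G.edgeExt e φ))
      = ∫ s in (0:ℝ)..G.length e, φ s • greenFun hG (G.edgePoint e s) := by
  classical
  have hk : Continuous fun s => φ s • greenFun hG (G.edgePoint e s) :=
    hc.smul ((continuous_greenFun hG).comp (G.continuous_edgePoint e))
  refine ext_inner_left ℂ fun v => ?_
  rw [← inner_resolvent_left, inner_eq_sum (coeFn_resolvent hG v), Finset.sum_eq_single e]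
  · have h2 := (innerSL ℂ v).intervalIntegral_comp_comm
      (hk.intervalIntegrable (μ := volume) 0 (G.length e))
    simp only [innerSL_apply_apply] at h2
    rw [← h2]
    refine intervalIntegral.integral_congr_ae ?_
    filter_upwards [toL2_edgeExt_ae (G := G) (e := e) (φ := φ) e] with s hs hs'
    have hs2 : s ∈ Icc 0 (G.length e) := by
      rw [uIoc_of_le (G.length_pos e).le] at hs'
      exact ⟨hs'.1.le, hs'.2⟩
    rw [hs hs', edgeExt_edgePoint hc h0 h1 e hs2, if_pos rfl, inner_smul_right, ← inner_greenFun,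
      inner_conj_symm, mul_comm]
  · intro e' _ he
    refine Eq.trans ?_ (intervalIntegral.integral_zero (μ := volume) (a := 0) (b := G.length e'))
    refine intervalIntegral.integral_congr_ae ?_
    filter_upwards [toL2_edgeExt_ae (G := G) (e := e) (φ := φ) e'] with s hs hs'
    have hs2 : s ∈ Icc 0 (G.length e') := by
      rw [uIoc_of_le (G.length_pos e').le] at hs'
      exact ⟨hs'.1.le, hs'.2⟩
    rw [hs hs', edgeExt_edgePoint hc h0 h1 e' hs2, if_neg he, mul_zero]
  · simp

/-- The squared `L²` norm of the Gaussian kernel at time `t` on the line is `(8 π t)^{-1/2}`, and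
the cut-off does not change its leading order. -/
lemma tendsto_sqrt_mul_norm_sq_cutGaussian {e : E} {x₀ η : ℝ} {χ χ' χ'' : ℝ → ℝ}
    (h : IsCutoff (G.length e) x₀ η χ χ' χ'') (hη : 0 < η) :
    Tendsto (fun t => √t * ‖G.cutGaussian e x₀ χ t‖ ^ 2) (𝓝[>] 0) (𝓝 (√(8 * Real.pi))⁻¹) := by
  have hχ := h.continuous
  have hk : Continuous fun y => χ y ^ 2 := by fun_prop
  have hint : Integrable fun y => χ y ^ 2 :=
    hk.integrable_of_hasCompactSupport (HasCompactSupport.intro (isCompact_Icc (a := (0:ℝ))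
      (b := G.length e)) fun y hy => by
        rw [(h.eq_zero y fun h => hy (Ioo_subset_Icc_self h)).1]; simp)
  have key := tendsto_integral_gaussianKernel_smul hint hk.continuousAt (x₀ := x₀)
  rw [(h.eq_one x₀ (by simpa using hη)).1, one_pow] at key
  have h3 := (key.comp tendsto_half_nhdsGT_zero).const_mul (√(8 * Real.pi))⁻¹
  rw [mul_one] at h3
  refine h3.congr' ?_
  filter_upwards [self_mem_nhdsWithin] with t ht
  have ht : 0 < t := ht
  have hg := continuous_gaussianKernel t
  rw [cutGaussian, norm_sq_toL2_edgeExt (by fun_prop)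
    (by simp [(h.eq_zero 0 IsCutoff.left_notMem).1])
    (by simp [(h.eq_zero _ IsCutoff.right_notMem).1]),
    intervalIntegral.integral_of_le (G.length_pos e).le, ← integral_Icc_eq_integral_Ioc,
    setIntegral_eq_integral_of_forall_compl_eq_zero]
  · rw [Function.comp_apply, ← integral_const_mul, ← integral_const_mul]
    refine integral_congr_ae (Eventually.of_forall fun y => ?_)
    simp only [smul_eq_mul]
    rw [Complex.norm_real, Real.norm_eq_abs, sq_abs, mul_pow, gaussianKernel_sq ht,
      Real.sqrt_mul (by positivity : (0:ℝ) ≤ 8 * Real.pi) t, mul_inv]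
    have : √t * (√t)⁻¹ = 1 := mul_inv_cancel₀ (Real.sqrt_pos.2 ht).ne'
    linear_combination (-(√(8 * Real.pi))⁻¹ * gaussianKernel (t / 2) (y - x₀) * χ y ^ 2) * this
  · intro y hy
    rw [(h.eq_zero y fun h => hy (Ioo_subset_Icc_self h)).1]
    simp

end

section

variable [Nonempty E] [Finite V] (hG : G.Connected) {e : E} {x₀ η : ℝ} {χ χ' χ'' : ℝ → ℝ}

/-- The cut-off Gaussian tends to the Dirac measure at `x₀` in a weak sense: its resolvent tends to
the Green function with pole `x₀`. -/
lemma tendsto_resolvent_cutGaussian (h : IsCutoff (G.length e) x₀ η χ χ' χ'') (hη : 0 < η) :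
    Tendsto (fun t => resolvent hG (G.cutGaussian e x₀ χ t)) (𝓝[>] 0)
      (𝓝 (greenFun hG (G.edgePoint e x₀))) := by
  have hχ := h.continuous
  have hk : Continuous fun y => χ y • greenFun hG (G.edgePoint e y) :=
    hχ.smul ((continuous_greenFun hG).comp (G.continuous_edgePoint e))
  have hsupp : ∀ y, y ∉ Icc 0 (G.length e) → χ y • greenFun hG (G.edgePoint e y) = 0 :=
    fun y hy => by rw [(h.eq_zero y fun h => hy (Ioo_subset_Icc_self h)).1, zero_smul]
  have hint : Integrable fun y => χ y • greenFun hG (G.edgePoint e y) :=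
    hk.integrable_of_hasCompactSupport (HasCompactSupport.intro isCompact_Icc hsupp)
  have key := tendsto_integral_gaussianKernel_smul hint hk.continuousAt (x₀ := x₀)
  rw [(h.eq_one x₀ (by simpa using hη)).1, one_smul] at key
  refine key.congr fun t => ?_
  have hg := continuous_gaussianKernel t
  rw [cutGaussian, resolvent_toL2_edgeExt hG (by fun_prop)
    (by simp [(h.eq_zero 0 IsCutoff.left_notMem).1])
    (by simp [(h.eq_zero _ IsCutoff.right_notMem).1]),
    intervalIntegral.integral_of_le (G.length_pos e).le, ← integral_Icc_eq_integral_Ioc,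
    setIntegral_eq_integral_of_forall_compl_eq_zero]
  · refine integral_congr_ae (Eventually.of_forall fun y => ?_)
    beta_reduce
    rw [Complex.coe_smul, mul_comm (χ y)]
    exact smul_smul _ _ _
  · intro y hy
    rw [(h.eq_zero y fun h => hy (Ioo_subset_Icc_self h)).1, zero_mul, Complex.ofReal_zero,
      zero_smul]

/-- Duhamel's principle: the heat kernel differs from the cut-off Gaussian by `O(t)`. The function
`r ↦ T r (q (t - r))` has a bounded derivative, its value at `0` is `q t`, and its limit as `r → t`
is the heat kernel. -/
lemma exists_norm_heatSection_sub_le (h : IsCutoff (G.length e) x₀ η χ χ' χ'') (hη : 0 < η)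
    (hx₀ : x₀ ∈ Ioo 0 (G.length e)) :
    ∃ C, 0 ≤ C ∧ ∀ t, 0 < t → t ≤ 1 →
      ‖heatSection hG t (G.edgePoint e x₀) - G.cutGaussian e x₀ χ t‖ ≤ C * t := by
  obtain ⟨C, hC, hbound⟩ := exists_norm_error_le hG h hη hx₀
  refine ⟨C, hC, fun τ hτ hτ1 => ?_⟩
  have hT := isSemigroupGeneratedBy_kirchhoffLaplacian hG
  have hnorm := norm_heatOp_le_one (spectrum_resolvent_subset hG)
  have hsa := isSelfAdjoint_resolvent hG
  set q := G.cutGaussian e x₀ χ with hq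
  set T := heatOp (resolvent hG) with hT_def
  have hqd : ∀ t, 0 < t → HasDerivAt q (G.toL2 (G.cutGaussianDeriv e x₀ χ t)) t := fun t ht =>
    hasDerivAt_cutGaussian hG h ht
  have hcont : ∀ r ∈ Ico 0 τ, ContinuousWithinAt (fun r => T r (q (τ - r))) (Ici 0) r := by
    intro r hr
    have h1 : ContinuousWithinAt (fun r => T r (q (τ - r))) (Ici 0) r ↔ _ :=
      tendsto_iff_norm_sub_tendsto_zero
    refine h1.2 ?_
    have h2 : Tendsto (fun r => q (τ - r)) (𝓝[Ici 0] r) (𝓝 (q (τ - r))) :=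
      (((hqd _ (sub_pos.2 hr.2)).continuousAt).comp (f := fun r => τ - r)
        (by fun_prop)).continuousWithinAt
    have h3 := tendsto_iff_norm_sub_tendsto_zero.1 h2
    have h4 := tendsto_iff_norm_sub_tendsto_zero.1 (hT.continuousOn (q (τ - r)) r hr.1)
    have h5 := h3.add h4
    rw [add_zero] at h5
    refine squeeze_zero (fun _ => norm_nonneg _) (fun r' => ?_) h5
    -- the operators `T r'` are contractions
    have e1 : T r' (q (τ - r')) - T r (q (τ - r))
        = T r' (q (τ - r') - q (τ - r)) + (T r' (q (τ - r)) - T r (q (τ - r))) := by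
      rw [map_sub]; abel
    rw [e1]
    refine (norm_add_le _ _).trans (add_le_add_left ?_ _)
    exact ((T r').le_of_opNorm_le (hnorm r') _).trans (one_mul _).le
  have hmain : ∀ r ∈ Ico 0 τ, ‖T r (q (τ - r)) - q τ‖ ≤ C * r := by
    intro r hr
    have key := norm_image_sub_le_of_norm_deriv_right_le_segment (a := 0) (b := r) (C := C)
      (f := fun r => T r (q (τ - r)))
      (fun s hs => ((hcont s ⟨hs.1, hs.2.trans_lt hr.2⟩).mono fun _ h => h.1))
      (fun s hs => hT.hasDerivWithinAt_comp_sub hs.1 (hqd _ (sub_pos.2 (hs.2.trans hr.2)))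
        (kirchhoffLaplacian_cutGaussian h (sub_pos.2 (hs.2.trans hr.2))))
      (fun s hs => by
        have h1 := hbound (τ - s) (sub_pos.2 (hs.2.trans hr.2)) (by linarith [hs.1])
        rw [norm_neg]
        exact ((T s).le_of_opNorm_le (hnorm s) _).trans ((one_mul _).le.trans h1))
      r ⟨hr.1, le_rfl⟩
    simpa [hT.zero] using key
  -- `q (τ - r)` has no limit in `L²`, but its resolvent has, and `T r` is the composition of
  -- `(1 + H₀)² T r` with two resolvents
  have hlim : Tendsto (fun r => T r (q (τ - r))) (𝓝[<] τ)
      (𝓝 (heatSection hG τ (G.edgePoint e x₀))) := by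
    have h1 : Tendsto (fun r => τ - r) (𝓝[<] τ) (𝓝[>] 0) := by
      refine tendsto_nhdsWithin_iff.2 ⟨?_, ?_⟩
      · have : Tendsto (fun r => τ - r) (𝓝 τ) (𝓝 (τ - τ)) := Continuous.tendsto (by fun_prop) τ
        rw [sub_self] at this
        exact this.mono_left nhdsWithin_le_nhds
      · filter_upwards [self_mem_nhdsWithin] with r hr
        exact sub_pos.2 (mem_Iio.1 hr)
    have h2 : Tendsto (fun r => smoothing hG r) (𝓝[<] τ) (𝓝 (smoothing hG τ)) :=
      (((continuousOn_heatOpDiv (resolvent hG)).continuousAt (Ioi_mem_nhds hτ)).tendsto).mono_left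
        nhdsWithin_le_nhds
    have h3 := ((resolvent hG).continuous.tendsto _).comp
      ((isBoundedBilinearMap_apply (𝕜 := ℂ)).continuous.tendsto _ |>.comp
        (h2.prodMk_nhds ((tendsto_resolvent_cutGaussian hG h hη).comp h1)))
    refine h3.congr' ?_
    filter_upwards [Ioo_mem_nhdsLT hτ] with r hr
    rw [hT_def, heatOp_eq' hsa hr.1]
    rfl
  refine le_of_tendsto_of_tendsto (hlim.sub_const (q τ)).norm
    (g := fun r => C * r) (tendsto_nhdsWithin_of_tendsto_nhds
      (Continuous.tendsto (by fun_prop) τ)) ?_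
  filter_upwards [Ioo_mem_nhdsLT hτ] with r hr
  exact hmain r ⟨hr.1.le, hr.2⟩

include hG in
/-- The diagonal asymptotics of the heat kernel at time `2 t`, at an interior point of an edge. -/
lemma tendsto_sqrt_mul_heatKernel_two_mul (hx₀ : x₀ ∈ Ioo 0 (G.length e)) :
    Tendsto (fun t => √t * heatKernel hG (2 * t) (G.edgePoint e x₀) (G.edgePoint e x₀)) (𝓝[>] 0)
      (𝓝 (√(8 * Real.pi))⁻¹) := by
  obtain ⟨η, hη, χ, χ', χ'', h⟩ := exists_isCutoff hx₀
  obtain ⟨C, hC, hbound⟩ := exists_norm_heatSection_sub_le hG h hη hx₀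
  set q := G.cutGaussian e x₀ χ with hq
  have hlim := tendsto_sqrt_mul_norm_sq_cutGaussian h hη
  -- `‖h‖² - ‖q‖² = O(t (1 + ‖q‖²))`, because `‖h - q‖ = O(t)`
  have herr : Tendsto (fun t => C * t * (2 * √t + 2 * (√t * ‖q t‖ ^ 2) + √t * (C * t))) (𝓝[>] 0)
      (𝓝 0) := by
    have h1 : Tendsto (fun t : ℝ => t) (𝓝[>] 0) (𝓝 0) :=
      tendsto_id.mono_left nhdsWithin_le_nhds
    have h2 : Tendsto (fun t : ℝ => √t) (𝓝[>] 0) (𝓝 0) := by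
      have := (Real.continuous_sqrt.tendsto 0).mono_left (nhdsWithin_le_nhds (s := Ioi 0))
      rwa [Real.sqrt_zero] at this
    have h3 := (h1.const_mul C).mul (((h2.const_mul 2).add (hlim.const_mul 2)).add
      (h2.mul (h1.const_mul C)))
    rwa [mul_zero, zero_mul] at h3
  have h2 : Tendsto (fun t => √t * ‖heatSection hG t (G.edgePoint e x₀)‖ ^ 2 - √t * ‖q t‖ ^ 2)
      (𝓝[>] 0) (𝓝 0) := by
    refine squeeze_zero_norm' ?_ herr
    filter_upwards [Ioo_mem_nhdsGT zero_lt_one] with t ht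
    have hb := hbound t ht.1 ht.2.le
    have h3 := abs_norm_sub_norm_le (heatSection hG t (G.edgePoint e x₀)) (q t)
    set a := ‖heatSection hG t (G.edgePoint e x₀)‖
    have ha : 0 ≤ a := norm_nonneg _
    have hq0 : 0 ≤ ‖q t‖ := norm_nonneg _
    have h4 : |a - ‖q t‖| ≤ C * t := h3.trans hb
    have h5 : |a + ‖q t‖| ≤ 2 + 2 * ‖q t‖ ^ 2 + C * t := by
      rw [abs_of_nonneg (by positivity)]
      nlinarith [(abs_le.1 h4).2, sq_nonneg (‖q t‖ - 1)]
    have h6 : √t * a ^ 2 - √t * ‖q t‖ ^ 2 = √t * ((a - ‖q t‖) * (a + ‖q t‖)) := by ring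
    rw [h6, Real.norm_eq_abs, abs_mul, abs_mul, abs_of_nonneg (Real.sqrt_nonneg t)]
    have h7 : 0 ≤ C * t := mul_nonneg hC ht.1.le
    calc √t * (|a - ‖q t‖| * |a + ‖q t‖|)
        ≤ √t * ((C * t) * (2 + 2 * ‖q t‖ ^ 2 + C * t)) := by gcongr
      _ = _ := by ring
  have h3 := h2.add hlim
  rw [zero_add] at h3
  refine h3.congr' ?_
  filter_upwards [self_mem_nhdsWithin] with t ht
  rw [heatKernel_two_mul hG t ht]
  ring

lemma tendsto_rpow_mul_heatKernel (hx₀ : x₀ ∈ Ioo 0 (G.length e)) :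
    Tendsto (fun t : ℝ => t ^ ((1:ℝ) / 2)
        * heatKernel hG t (G.edgePoint e x₀) (G.edgePoint e x₀)) (𝓝[>] 0)
      (𝓝 ((4 * Real.pi) ^ (-(1 / 2 : ℝ)))) := by
  have h3 := ((tendsto_sqrt_mul_heatKernel_two_mul hG hx₀).comp
    tendsto_half_nhdsGT_zero).const_mul √2
  have e1 : √2 * (√(8 * Real.pi))⁻¹ = (4 * Real.pi) ^ (-(1 / 2 : ℝ)) := by
    rw [Real.rpow_neg (by positivity), ← Real.sqrt_eq_rpow,
      show 8 * Real.pi = 2 * (4 * Real.pi) by ring, Real.sqrt_mul zero_le_two]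
    have : √(4 * Real.pi) ≠ 0 := by positivity
    field_simp
  rw [e1] at h3
  refine h3.congr' ?_
  filter_upwards [self_mem_nhdsWithin] with t ht
  rw [Function.comp_apply, ← mul_assoc, ← Real.sqrt_mul zero_le_two, mul_div_cancel₀ t two_ne_zero,
    Real.sqrt_eq_rpow]

end

end MetricGraph

theorem mainTheorem7 {V E : Type*} [Finite V] [Fintype E] [Nonempty E]
    (G : MetricGraph V E) (hG : G.Connected) :
    (∃ K : ℝ → G.Point → G.Point → ℝ, G.IsHeatKernel K) ∧
    ∀ K : ℝ → G.Point → G.Point → ℝ, G.IsHeatKernel K →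
      HasDiagonalAsymptotics G.measure K 1 ((4 * Real.pi) ^ (-(1 / 2 : ℝ))) G.vertexSet := by
  refine ⟨⟨_, MetricGraph.isHeatKernel_heatKernel hG⟩, fun K hK =>
    ⟨by positivity, MetricGraph.measure_vertexSet, fun x hx => ?_⟩⟩
  cases x with
  | vertex v => exact absurd ⟨v, rfl⟩ hx
  | interior e s =>
    rw [← MetricGraph.edgePoint_of_mem (G := G) s.2]
    refine (MetricGraph.tendsto_rpow_mul_heatKernel hG s.2).congr' ?_
    filter_upwards [self_mem_nhdsWithin] with t ht
    rw [hK.diag_eq hG ht s.2]
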